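/- **Conventions.** A relation $\le$ on a set $X$ is a *well partial order* if it is a partial order and every sequence $(x_n)_{n\in\mathbb N}$ in $X$ has indices $i<j$ with $x_i\le x_j$. The *maximal order type* $o(X)$ of a well partial order $X$ is the supremum of all ordinals $\beta$ for which there is a map $f:\beta\to X$ such that $f(\sigma)\le f(\tau)$ implies $\sigma\le\tau$. The Veblen functions are given by $\varphi_0(x)=\omega^x$ and, for $\gamma>0$, $\varphi_\gamma$ enumerates the common fixed points of all $\varphi_{\gamma'}$ with $\gamma'<\gamma$. We write $\alpha=_{\mathsf{NF}}\omega^\gamma+\delta$ if $\alpha=\omega^\gamma+\delta$ and $\delta<\omega^{\gamma+1}$; every $\alpha>0$ has exactly one such representation. **Sequences.** Let $\alpha$ be an ordinal and let $\alpha^*$ be the set of finite sequences of elements of $\alpha$. For $s,t\in\alpha^*$ consider strictly increasing maps $f:\{0,\dots,|s|-1\}\to\{0,\dots,|t|-1\}$ with $s_i\le t_{f(i)}$ for all $i<|s|$. - $\mathsf S^{\mathsf g}_\alpha$: $s\le t$ iff there is such an $f$ with $s_i\le t_j$ or $s_{i+1}\le t_j$ whenever $i+1<|s|$ and $f(i)<j<f(i+1)$.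 - $\mathsf S^{\mathsf w}_\alpha$: $s\le t$ iff there is such an $f$ with $s_{i+1}\le t_j$ whenever $i+1<|s|$ and $f(i)<j<f(i+1)$. - $\mathsf S^{\mathsf s}_\alpha$: as for $\mathsf S^{\mathsf w}_\alpha$, where in addition $s_0\le t_j$ for all $j<f(0)$ if $|s|>0$. **Trees.** $\mathsf B_{\alpha,1}$ is the set of finite binary trees that are either a leaf (with the only possible leaf label) or of the form $\beta\star[t_l,t_r]$ with $\beta\in\alpha$ and $t_l,t_r\in\mathsf B_{\alpha,1}$, where $\beta$ is less than or equal to every inner label of $t_l$ and of $t_r$. It is ordered by the smallest relation such that the leaf is $\le$ itself; $s\le\beta\star[t_l,t_r]$ if $s\le t_l$ or $s\le t_r$; and $\beta\star[s_l,s_r]\le\gamma\star[t_l,t_r]$ if $\beta\le\gamma$, $s_l\le t_l$ and $s_r\le t_r$. $\mathsf B^l_{\alpha,1}$ is the suborder of the trees in which, at every inner node $\beta\star[t_l,t_r]$, the label $\beta$ is moreover strictly less than every inner label of $t_l$. **Theorem.** For every ordinal $\alpha$, the orders $\mathsf B_{\alpha,1}$, $\mathsf B^l_{\alpha,1}$,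 $\mathsf S^{\mathsf w}_\alpha$, $\mathsf S^{\mathsf g}_\alpha$ and $\mathsf S^{\mathsf s}_\alpha$ are well partial orders, and $$o(\mathsf B_{\alpha,1})=F(\alpha),\qquad o(\mathsf S^{\mathsf g}_\alpha)=o(\mathsf S^{\mathsf w}_\alpha)=o(\mathsf B^l_{\alpha,1})=G(\alpha),\qquad o(\mathsf S^{\mathsf s}_\alpha)=H(\alpha),$$ where $F,G,H$ are defined by recursion as follows: $$F(\alpha)=\begin{cases}1&\text{if }\alpha=0,\\ \varphi_{1+\gamma}(0)&\text{if }\alpha=\omega^\gamma\text{ and }\gamma<\varphi_\gamma(0),\\ \varphi_{1+\gamma}(F(\delta))&\text{otherwise, if }\alpha=_{\mathsf{NF}}\omega^\gamma+\delta,\end{cases}$$ $$G(\alpha)=\begin{cases}1&\text{if }\alpha=0,\\ \omega&\text{if }\alpha=1,\\ \omega^{\omega^{G(n)}}&\text{if }\alpha=n+1\text{ and }0<n<\omega,\\ \varphi_\gamma(0)&\text{if }\alpha=\omega^\gamma\text{ and }0<\gamma<\varphi_\gamma(0),\\ \varphi_\gamma(G(\delta))&\text{otherwise, if }\alpha=_{\mathsf{NF}}\omega^\gamma+\delta,\end{cases}$$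 $$H(\alpha)=\begin{cases}1&\text{if }\alpha=0,\\ G(\alpha)^{\omega^\gamma}\cdot H(\delta)&\text{if }\alpha=_{\mathsf{NF}}\omega^\gamma+\delta.\end{cases}$$ -/

import Mathlib

universe u v

namespace GapOrder

open Ordinal

/-! ### Well partial orders and maximal order types -/

/-- The relation `r` (read as `≤`) is a well partial order: a partial order in which every infinite
sequence is good, i.e. has indices `i < j` with `x i ≤ x j`. -/
structure IsWellPartialOrder {X : Type u} (r : X → X → Prop) : Prop where
  isPartialOrder : IsPartialOrder X r
  wellQuasiOrdered : WellQuasiOrdered r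

/-- `f` is a quasi-embedding of the ordinal `β`, as the well order of its elements, into the order
`r` on `X`: it reflects the order. -/
def IsQuasiEmbedding {X : Type u} (r : X → X → Prop) (β : Ordinal.{u}) (f : β.ToType → X) : Prop :=
  ∀ a b, r (f a) (f b) → a ≤ b

/-- The maximal order type `o(X)`: the supremum of all ordinals that quasi-embed into `X`. -/
noncomputable def maxOrderType {X : Type u} (r : X → X → Prop) : Ordinal.{u} :=
  sSup {β : Ordinal.{u} | ∃ f : β.ToType → X, IsQuasiEmbedding r β f}

/-- The supremum in `maxOrderType` is never a junk value: for a reflexive relation, the set of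
ordinals that quasi-embed is bounded. -/
theorem bddAbove_quasiEmbedding {X : Type u} (r : X → X → Prop) (hr : ∀ x, r x x) :
    BddAbove {β : Ordinal.{u} | ∃ f : β.ToType → X, IsQuasiEmbedding r β f} := by
  refine ⟨(Order.succ (Cardinal.mk X)).ord, ?_⟩
  rintro β ⟨f, hf⟩
  have hinj : Function.Injective f := fun a b hab =>
    le_antisymm (hf a b (hab ▸ hr (f a))) (hf b a (hab ▸ hr (f a)))
  have hc := Cardinal.mk_le_of_injective hinj
  rw [Cardinal.mk_toType] at hc
  exact (Cardinal.lt_ord.2 (Order.lt_succ_of_le hc)).le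

/-! ### Sequences with gap condition -/

section Sequences

variable {A : Type u} [LE A]

/-- Gordeev's symmetric gap condition on finite sequences. -/
def GordeevLE (s t : List A) : Prop :=
  ∃ f : Fin s.length → Fin t.length, StrictMono f ∧
    (∀ i, s.get i ≤ t.get (f i)) ∧
    (∀ (i : ℕ) (hi : i + 1 < s.length) (j : Fin t.length),
      f ⟨i, Nat.lt_of_succ_lt hi⟩ < j → j < f ⟨i + 1, hi⟩ →
        s.get ⟨i, Nat.lt_of_succ_lt hi⟩ ≤ t.get j ∨ s.get ⟨i + 1, hi⟩ ≤ t.get j)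

/-- The weak gap condition on finite sequences. -/
def WeakLE (s t : List A) : Prop :=
  ∃ f : Fin s.length → Fin t.length, StrictMono f ∧
    (∀ i, s.get i ≤ t.get (f i)) ∧
    (∀ (i : ℕ) (hi : i + 1 < s.length) (j : Fin t.length),
      f ⟨i, Nat.lt_of_succ_lt hi⟩ < j → j < f ⟨i + 1, hi⟩ → s.get ⟨i + 1, hi⟩ ≤ t.get j)

/-- The strong gap condition on finite sequences: the weak one together with a condition on the
members of `t` to the left of everything that is mapped to. -/
def StrongLE (s t : List A) : Prop :=
  ∃ f : Fin s.length → Fin t.length, StrictMono f ∧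
    (∀ i, s.get i ≤ t.get (f i)) ∧
    (∀ (i : ℕ) (hi : i + 1 < s.length) (j : Fin t.length),
      f ⟨i, Nat.lt_of_succ_lt hi⟩ < j → j < f ⟨i + 1, hi⟩ → s.get ⟨i + 1, hi⟩ ≤ t.get j) ∧
    (∀ (h0 : 0 < s.length) (j : Fin t.length), j < f ⟨0, h0⟩ → s.get ⟨0, h0⟩ ≤ t.get j)

end Sequences

/-! ### Binary trees with ascending labels -/

/-- Binary trees with inner labels in `A` and leaf labels in `X` (no condition on the labels). -/
inductive BinTree (A : Type u) (X : Type v) : Type (max u v)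
  | leaf (x : X) : BinTree A X
  | node (b : A) (l r : BinTree A X) : BinTree A X

namespace BinTree

variable {A : Type u} {X : Type v}

/-- The set of inner labels of a tree. -/
def innerLabels : BinTree A X → Set A
  | leaf _ => ∅
  | node b l r => {b} ∪ (l.innerLabels ∪ r.innerLabels)

/-- Weakly ascending inner labels. -/
def Ascending [LE A] : BinTree A X → Prop
  | leaf _ => True
  | node b l r => l.Ascending ∧ r.Ascending ∧
      (∀ c ∈ l.innerLabels, b ≤ c) ∧ (∀ c ∈ r.innerLabels, b ≤ c)

/-- Inner labels that ascend weakly, and strictly on left subtrees. -/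
def LeftStrictAscending [LE A] [LT A] : BinTree A X → Prop
  | leaf _ => True
  | node b l r => l.LeftStrictAscending ∧ r.LeftStrictAscending ∧
      (∀ c ∈ l.innerLabels, b < c) ∧ (∀ c ∈ r.innerLabels, b ≤ c)

/-- Embeddability of trees, the smallest relation closed under the three clauses. As the sets of
trees with ascending labels are closed under subtrees, the smallest such relation on one of these
sets is the restriction of this one. -/
inductive Embeds [LE A] [LE X] : BinTree A X → BinTree A X → Prop
  | leaf {x y : X} : x ≤ y → Embeds (.leaf x) (.leaf y)
  | left {s l r : BinTree A X} {b : A} : Embeds s l → Embeds s (.node b l r)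
  | right {s l r : BinTree A X} {b : A} : Embeds s r → Embeds s (.node b l r)
  | node {b c : A} {sl sr tl tr : BinTree A X} :
      b ≤ c → Embeds sl tl → Embeds sr tr → Embeds (.node b sl sr) (.node c tl tr)

end BinTree

/-! ### The orders for an ordinal `α` -/

/-- The order on `S^g_α`, with underlying set the finite sequences of elements of `α`. -/
def SgLE (α : Ordinal.{u}) : List α.ToType → List α.ToType → Prop := GordeevLE

/-- The order on `S^w_α`. -/
def SwLE (α : Ordinal.{u}) : List α.ToType → List α.ToType → Prop := WeakLE

/-- The order on `S^s_α`. -/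
def SsLE (α : Ordinal.{u}) : List α.ToType → List α.ToType → Prop := StrongLE

/-- The underlying set of `B_{α,X}`. -/
def B (α : Ordinal.{u}) (X : Type u) : Type u :=
  {t : BinTree α.ToType X // t.Ascending}

/-- The order on `B_{α,X}`. -/
def BLE (α : Ordinal.{u}) (X : Type u) [LE X] (s t : B α X) : Prop := s.1.Embeds t.1

/-- The underlying set of `B^l_{α,X}`. -/
def Bl (α : Ordinal.{u}) (X : Type u) : Type u :=
  {t : BinTree α.ToType X // t.LeftStrictAscending}

/-- The order on `B^l_{α,X}`. -/
def BlLE (α : Ordinal.{u}) (X : Type u) [LE X] (s t : Bl α X) : Prop := s.1.Embeds t.1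

/-! ### The ordinal functions `F`, `G`, `H`

Every ordinal `α ≠ 0` is `ω ^ γ + δ` for unique `γ` and `δ < ω ^ (γ + 1)`; here `γ = log ω α`, and
`δ` is what remains after subtracting `ω ^ γ` from the left. Mathlib's `veblen` is `φ`, with
`φ_0(x) = ω ^ x`. -/

/-- The exponent `γ` in `α = ω ^ γ + δ`. -/
noncomputable def cnfExp (α : Ordinal.{u}) : Ordinal.{u} := log ω α

/-- The remainder `δ` in `α = ω ^ γ + δ`. -/
noncomputable def cnfRest (α : Ordinal.{u}) : Ordinal.{u} := α - ω ^ log ω α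

theorem cnfRest_lt {α : Ordinal.{u}} (h : α ≠ 0) : cnfRest α < α :=
  sub_omega0_opow_log_lt h

theorem pred_lt_of_lt_omega0 {α : Ordinal.{u}} (h : α ≠ 0) (hω : α < ω) : α.pred < α := by
  obtain ⟨n, rfl⟩ := lt_omega0.1 hω
  cases n with
  | zero => exact absurd Nat.cast_zero h
  | succ n =>
    rw [Nat.cast_succ, pred_add_one]
    exact lt_add_of_pos_right _ zero_lt_one

open Classical in
/-- `F(0) = 1`; `F(ω ^ γ) = φ_{1+γ}(0)` if `γ < φ_γ(0)`; otherwise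
`F(ω ^ γ + δ) = φ_{1+γ}(F(δ))`. -/
noncomputable def F (α : Ordinal.{u}) : Ordinal.{u} :=
  if h : α = 0 then 1
  else if cnfRest α = 0 ∧ cnfExp α < veblen (cnfExp α) 0 then veblen (1 + cnfExp α) 0
  else veblen (1 + cnfExp α) (F (cnfRest α))
termination_by α
decreasing_by exact cnfRest_lt h

open Classical in
/-- `G(0) = 1`; `G(1) = ω`; `G(n + 1) = ω ^ ω ^ G(n)` if `0 < n < ω`; for infinite arguments,
`G(ω ^ γ) = φ_γ(0)` if `γ < φ_γ(0)`, and otherwise `G(ω ^ γ + δ) = φ_γ(G(δ))`. -/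
noncomputable def G (α : Ordinal.{u}) : Ordinal.{u} :=
  if h : α = 0 then 1
  else if α = 1 then ω
  else if hω : α < ω then ω ^ (ω ^ G α.pred)
  else if cnfRest α = 0 ∧ cnfExp α < veblen (cnfExp α) 0 then veblen (cnfExp α) 0
  else veblen (cnfExp α) (G (cnfRest α))
termination_by α
decreasing_by
  · exact pred_lt_of_lt_omega0 h hω
  · exact cnfRest_lt h

open Classical in
/-- `H(0) = 1`; `H(ω ^ γ + δ) = G(ω ^ γ + δ) ^ (ω ^ γ) * H(δ)`. -/
noncomputable def H (α : Ordinal.{u}) : Ordinal.{u} :=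
  if h : α = 0 then 1
  else G α ^ (ω ^ cnfExp α) * H (cnfRest α)
termination_by α
decreasing_by exact cnfRest_lt h

end GapOrder

-- Upper bounds rest on the de Jongh–Parikh principle: `o(X) ≤ θ` once every residual `{y | ¬ x ≤
-- y}` has type below `θ`. `TypeLE` iterates this. It gives the well partial order property and
-- bounds `maxOrderType`, it passes along order-reflecting maps, and it is controlled on unions
-- (natural sums), products and Higman's lists.
--
-- The main objects are the left-strict trees `lsTrees α P` with leaf labels in `P`. Cutting at a
-- label turns `lsTrees (α + β) P` into `lsTrees α (lsTrees β P)`, and trees with a single label are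
-- combs, hence lists. For labels below `ω ^ γ`, a tree that avoids `β ⋆ [tl, tr]` is collapsed:
-- each maximal subtree with labels from `β` on becomes a list of side trees avoiding `tl` or `tr`,
-- recorded along a path. What remains has labels below `β < ω ^ γ`, a finite sum of powers `ω ^ e`
-- with `e < γ`, so all bounds stay below a value of `φ_γ` (`TypeLE.lsTrees_veblen`). This yields
-- the bound `G α` (`typeLE_lsTrees`).
--
-- A sequence is the inorder reading of a left-strict tree, and tree embeddings induce embeddings
-- with weak gap condition. Hence `o(S^g) ≤ o(S^w) ≤ o(B^l) ≤ G α`, and a single quasi-embedding of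
-- `G α` into `S^g` closes the circle (`attains_G`). It follows Veblen normal forms: `φ_e(x)`
-- becomes the word for `x` shifted by `ω ^ e`, and products become concatenations separated by `0`.
-- The absorption `ω ^ e + z = z` for `z ≥ ω ^ c`, `e < c`, mirrors `φ_e(φ_c(x)) = φ_c(x)`. When `γ
-- = φ_γ(0)`, the value `φ_γ(1)` is reached as the supremum of `φ_c(γ + 1)` over `c < γ`.
--
-- For weakly ascending trees, `F α = G (ω * α)` if `α ≠ 0`. Replacing each label by an interval of
-- length `ω` makes left subtrees strict and gives the upper bound; for the lower bound, `ω ^ a + b`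
-- becomes `0 ⋆ [a, b]`.
--
-- Under the strong gap condition a sequence is governed by its left-to-right minima. Splitting
-- there gives `H` as an upper bound, and expansions in base `G α` realize it (`exists_strongLE_H`).

universe w

namespace GapOrder

open Ordinal Order

/-! ### Natural sums -/

/-- The natural (Hessenberg) sum of two ordinals. -/
noncomputable def natSum (a b : Ordinal.{u}) : Ordinal.{u} :=
  max (⨆ x : Set.Iio a, natSum x.1 b + 1) (⨆ x : Set.Iio b, natSum a x.1 + 1)
termination_by (a, b)
decreasing_by all_goals cases x; decreasing_tactic

theorem natSum_lt_left {a a' : Ordinal.{u}} (h : a' < a) (b : Ordinal.{u}) :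
    natSum a' b < natSum a b := by
  rw [natSum.eq_def a b, ← Order.add_one_le_iff]
  exact le_max_of_le_left
    (Ordinal.le_iSup (fun x : Set.Iio a => natSum x.1 b + 1) ⟨a', h⟩)

theorem natSum_lt_right (a : Ordinal.{u}) {b b' : Ordinal.{u}} (h : b' < b) :
    natSum a b' < natSum a b := by
  rw [natSum.eq_def a b, ← Order.add_one_le_iff]
  exact le_max_of_le_right
    (Ordinal.le_iSup (fun x : Set.Iio b => natSum a x.1 + 1) ⟨b', h⟩)

theorem natSum_le {a b c : Ordinal.{u}} (h₁ : ∀ a' < a, natSum a' b < c)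
    (h₂ : ∀ b' < b, natSum a b' < c) : natSum a b ≤ c := by
  rw [natSum.eq_def a b]
  refine max_le (Ordinal.iSup_le fun x => ?_) (Ordinal.iSup_le fun x => ?_)
  · exact Order.add_one_le_of_lt (h₁ _ x.2)
  · exact Order.add_one_le_of_lt (h₂ _ x.2)

theorem natSum_zero (a : Ordinal.{u}) : natSum a 0 ≤ a := by
  induction a using WellFoundedLT.induction with
  | ind a ih =>
    exact natSum_le (fun a' h => (ih a' h).trans_lt h) fun b' h => absurd h not_lt_zero

theorem zero_natSum (a : Ordinal.{u}) : natSum 0 a ≤ a := by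
  induction a using WellFoundedLT.induction with
  | ind a ih =>
    exact natSum_le (fun b' h => absurd h not_lt_zero) fun a' h => (ih a' h).trans_lt h

theorem natSum_natCast_le (m n : ℕ) : natSum (m : Ordinal.{u}) n ≤ (m + n : ℕ) := by
  induction hk : m + n using Nat.strong_induction_on generalizing m n with
  | _ k ih =>
    subst hk
    refine natSum_le (fun a h => ?_) (fun b h => ?_)
    · obtain ⟨m', rfl⟩ := lt_omega0.1 (h.trans (natCast_lt_omega0 m))
      have h' : m' < m := by exact_mod_cast h
      exact (ih (m' + n) (by omega) m' n rfl).trans_lt (by exact_mod_cast (by omega))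
    · obtain ⟨n', rfl⟩ := lt_omega0.1 (h.trans (natCast_lt_omega0 n))
      have h' : n' < n := by exact_mod_cast h
      exact (ih (m + n') (by omega) m n' rfl).trans_lt (by exact_mod_cast (by omega))

/-- Compatibility of the natural sum with division by a power of `ω` below which it is closed. -/
theorem natSum_mul_add_le {e : Ordinal.{u}}
    (he : ∀ a < ω ^ e, ∀ b < ω ^ e, natSum a b < ω ^ e)
    (m n r s : Ordinal.{u}) (hr : r < ω ^ e) (hs : s < ω ^ e) :
    natSum (ω ^ e * m + r) (ω ^ e * n + s) ≤ ω ^ e * natSum m n + natSum r s := by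
  have hpos : (0 : Ordinal.{u}) < ω ^ e := opow_pos _ omega0_pos
  -- The induction runs on the two summands themselves, with quotients and remainders free. A
  -- smaller summand has either a smaller quotient, where `he` controls the remainders, or the same
  -- quotient and a smaller remainder.
  have key : ∀ x y : Ordinal.{u}, ∀ m n r s : Ordinal.{u}, r < ω ^ e → s < ω ^ e →
      x = ω ^ e * m + r → y = ω ^ e * n + s →
      natSum x y ≤ ω ^ e * natSum m n + natSum r s := by
    intro x
    induction x using WellFoundedLT.induction with
    | ind x ihx =>
    intro y
    induction y using WellFoundedLT.induction with
    | ind y ihy =>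
    intro m n r s hr hs hx hy
    have split : ∀ z m r : Ordinal.{u}, z < ω ^ e * m + r → r < ω ^ e →
        ∃ m' r', z = ω ^ e * m' + r' ∧ r' < ω ^ e ∧ (m' < m ∨ m' = m ∧ r' < r) := by
      intro z m r hz hr
      refine ⟨z / ω ^ e, z % ω ^ e, (div_add_mod _ _).symm, mod_lt _ hpos.ne', ?_⟩
      have h1 : z / ω ^ e ≤ m := by
        rw [← Order.lt_add_one_iff, ← lt_mul_iff_div_lt hpos.ne', mul_add_one]
        exact hz.trans (add_lt_add_right hr _)
      rcases h1.lt_or_eq with h | h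
      · exact Or.inl h
      · refine Or.inr ⟨h, ?_⟩
        rw [← div_add_mod z (ω ^ e), h] at hz
        exact lt_of_add_lt_add_left hz
    have step : ∀ p q : Ordinal.{u}, ∀ t < ω ^ e, p < q → ∀ w,
        ω ^ e * p + t < ω ^ e * q + w := by
      intro p q t ht hpq w
      calc ω ^ e * p + t < ω ^ e * p + ω ^ e := add_lt_add_right ht _
        _ = ω ^ e * (p + 1) := (mul_add_one _ _).symm
        _ ≤ ω ^ e * q := mul_le_mul_right (Order.add_one_le_of_lt hpq) _
        _ ≤ _ := le_self_add
    refine natSum_le (fun x' hx' => ?_) (fun y' hy' => ?_)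
    · obtain ⟨m', r', h1, h2, h3⟩ := split x' m r (hx ▸ hx') hr
      refine (ihx x' hx' y m' n r' s h2 hs h1 hy).trans_lt ?_
      rcases h3 with h3 | ⟨rfl, h3⟩
      · exact step _ _ _ (he _ h2 _ hs) (natSum_lt_left h3 _) _
      · exact add_lt_add_right (natSum_lt_left h3 _) _
    · obtain ⟨n', s', h1, h2, h3⟩ := split y' n s (hy ▸ hy') hs
      refine (ihy y' hy' m n' r s' hr h2 hx h1).trans_lt ?_
      rcases h3 with h3 | ⟨rfl, h3⟩
      · exact step _ _ _ (he _ hr _ h2) (natSum_lt_right _ h3) _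
      · exact add_lt_add_right (natSum_lt_right _ h3) _
  exact key _ _ m n r s hr hs rfl rfl

/-- In the successor step both summands have finite quotients by `ω ^ e`. These add up to a finite
quotient, and the remainders stay below `ω ^ e` by induction. -/
theorem natSum_lt_opow {c a b : Ordinal.{u}} (ha : a < ω ^ c) (hb : b < ω ^ c) :
    natSum a b < ω ^ c := by
  induction c using Ordinal.limitRecOn generalizing a b with
  | zero =>
    rw [opow_zero, lt_one_iff] at ha hb
    subst ha hb
    exact (natSum_zero 0).trans_lt (opow_pos _ omega0_pos)
  | add_one e ih =>
    have he := fun a (h : a < ω ^ e) b (h' : b < ω ^ e) => ih h h'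
    have hpos : (0 : Ordinal.{u}) < ω ^ e := opow_pos _ omega0_pos
    rw [opow_add_one] at ha hb
    obtain ⟨m, hm⟩ := lt_omega0.1 ((lt_mul_iff_div_lt hpos.ne').1 ha)
    obtain ⟨n, hn⟩ := lt_omega0.1 ((lt_mul_iff_div_lt hpos.ne').1 hb)
    rw [← div_add_mod a (ω ^ e), ← div_add_mod b (ω ^ e), hm, hn]
    have hr := mod_lt a hpos.ne'
    have hs := mod_lt b hpos.ne'
    refine (natSum_mul_add_le he _ _ _ _ hr hs).trans_lt ?_
    calc _ < ω ^ e * natSum m n + ω ^ e := add_lt_add_right (ih hr hs) _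
      _ = ω ^ e * (natSum m n + 1) := (mul_add_one _ _).symm
      _ ≤ ω ^ e * ((m + n : ℕ) + 1) :=
        mul_le_mul_right (add_le_add_left (natSum_natCast_le m n) 1) _
      _ < ω ^ e * ω := mul_lt_mul_of_pos_left (by exact_mod_cast natCast_lt_omega0 (m + n + 1)) hpos
      _ = _ := (opow_add_one _ _).symm
  | limit c hc ih =>
    obtain ⟨c₁, h₁, h₁'⟩ := (lt_opow_of_isSuccLimit omega0_ne_zero hc).1 ha
    obtain ⟨c₂, h₂, h₂'⟩ := (lt_opow_of_isSuccLimit omega0_ne_zero hc).1 hb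
    refine (ih (max c₁ c₂) (max_lt h₁ h₂)
      (h₁'.trans_le (opow_le_opow_right omega0_pos (le_max_left _ _)))
      (h₂'.trans_le (opow_le_opow_right omega0_pos (le_max_right _ _)))).trans_le ?_
    exact opow_le_opow_right omega0_pos (max_lt h₁ h₂).le

/-- The natural sum is here no larger than an ordinary sum. This is what makes the product bounds
for `H` sharp. -/
theorem natSum_mul_le {g a b : Ordinal.{u}} (ha : a < ω ^ g) :
    natSum a (ω ^ g * b) ≤ ω ^ g * b + a := by
  have hpos : (0 : Ordinal.{u}) < ω ^ g := opow_pos _ omega0_pos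
  have h := natSum_mul_add_le (fun a h b h' => natSum_lt_opow h h') 0 b a 0 ha hpos
  rw [mul_zero, zero_add, add_zero] at h
  refine h.trans (add_le_add (mul_le_mul_right (zero_natSum b) _) (natSum_zero a))

/-! ### Bounds on maximal order types -/

/-- The part of `P` that is not above `x`. -/
def residual {X : Type v} (r : X → X → Prop) (P : Set X) (x : X) : Set X := {y ∈ P | ¬ r x y}

/-- The ordinal `θ` bounds the length of bad sequences of elements of `P`. -/
inductive TypeLE {X : Type v} (r : X → X → Prop) : Set X → Ordinal.{u} → Prop
  | intro {P : Set X} {θ : Ordinal.{u}} (g : X → Ordinal.{u}) (hlt : ∀ x ∈ P, g x < θ)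
      (h : ∀ x ∈ P, TypeLE r (residual r P x) (g x)) : TypeLE r P θ

namespace TypeLE

variable {X : Type v} {Y : Type w} {r : X → X → Prop} {s : Y → Y → Prop} {P Q : Set X}
  {θ η : Ordinal.{u}}

theorem exists_lt (h : TypeLE r P θ) {x : X} (hx : x ∈ P) :
    ∃ η < θ, TypeLE r (residual r P x) η := by
  obtain ⟨g, hlt, h⟩ := h
  exact ⟨g x, hlt x hx, h x hx⟩

theorem of_forall (h : ∀ x ∈ P, ∃ η < θ, TypeLE r (residual r P x) η) : TypeLE r P θ := by
  classical
  choose! g hg using h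
  exact ⟨g, fun x hx => (hg x hx).1, fun x hx => (hg x hx).2⟩

theorem mono (h : TypeLE r P θ) (hle : θ ≤ η) : TypeLE r P η :=
  of_forall fun _ hx => let ⟨ζ, hζ, h'⟩ := h.exists_lt hx; ⟨ζ, hζ.trans_le hle, h'⟩

/-- Bounds transfer along maps that reflect the order. -/
theorem comap (h : TypeLE r P θ) {S : Set Y} (f : Y → X) (hf : ∀ y ∈ S, f y ∈ P)
    (hr : ∀ y ∈ S, ∀ z ∈ S, r (f y) (f z) → s y z) : TypeLE s S θ := by
  induction h generalizing S with
  | @intro P θ g hlt h ih =>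
    refine of_forall fun y hy => ⟨g (f y), hlt _ (hf y hy), ih _ (hf y hy) (fun z hz => ?_) ?_⟩
    · exact ⟨hf z hz.1, fun hyz => hz.2 (hr y hy z hz.1 hyz)⟩
    · exact fun z hz t ht => hr z hz.1 t ht.1

theorem subset (h : TypeLE r P θ) (hQ : Q ⊆ P) : TypeLE r Q θ :=
  h.comap id (fun _ hx => hQ hx) fun _ _ _ _ h => h

theorem empty : TypeLE r (∅ : Set X) θ :=
  of_forall fun _ hx => absurd hx (Set.notMem_empty _)

theorem eq_empty (h : TypeLE r P (0 : Ordinal.{u})) : P = ∅ := by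
  rw [Set.eq_empty_iff_forall_notMem]
  intro x hx
  obtain ⟨η, hη, -⟩ := h.exists_lt hx
  exact not_lt_zero hη

theorem exists_rel (h : TypeLE r P θ) (f : ℕ → X) (hf : ∀ n, f n ∈ P) :
    ∃ i j, i < j ∧ r (f i) (f j) := by
  induction h generalizing f with
  | @intro P θ g hlt h ih =>
    by_cases h0 : ∃ j, r (f 0) (f (j + 1))
    · obtain ⟨j, hj⟩ := h0
      exact ⟨0, j + 1, Nat.succ_pos _, hj⟩
    · obtain ⟨i, j, hij, hr⟩ := ih (f 0) (hf 0) (fun n => f (n + 1))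
        fun n => ⟨hf _, fun hn => h0 ⟨n, hn⟩⟩
      exact ⟨i + 1, j + 1, by omega, hr⟩

theorem wellQuasiOrdered (h : TypeLE r Set.univ θ) : WellQuasiOrdered r :=
  fun f => h.exists_rel f fun _ => Set.mem_univ _

/-- For `τ < σ` the value `f τ` lies in the residual at `f σ`, since `f σ ≤ f τ` would give `σ ≤ τ`.
By induction `σ` is at most the type of that residual, which is below `θ`. -/
theorem le_of_reflecting (h : TypeLE r P θ) {β : Ordinal.{u}} (f : Ordinal.{u} → X)
    (hf : ∀ σ < β, f σ ∈ P) (hr : ∀ σ < β, ∀ τ < β, r (f σ) (f τ) → σ ≤ τ) : β ≤ θ := by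
  induction h generalizing β with
  | @intro P θ g hlt h ih =>
    refine le_of_forall_lt fun σ hσ => ?_
    refine (ih (f σ) (hf σ hσ) (fun τ hτ => ⟨hf τ (hτ.trans hσ), fun hn => ?_⟩) ?_).trans_lt
      (hlt _ (hf σ hσ))
    · exact (hr σ hσ τ (hτ.trans hσ) hn).not_gt hτ
    · exact fun τ hτ τ' hτ' => hr τ (hτ.trans hσ) τ' (hτ'.trans hσ)

theorem maxOrderType_le {X : Type u} {r : X → X → Prop} (h : TypeLE r Set.univ θ) :
    maxOrderType r ≤ θ := by
  classical
  refine csSup_le' ?_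
  rintro β ⟨f, hf⟩
  by_cases hX : Nonempty X
  · refine h.le_of_reflecting
      (fun σ => if hσ : σ < β then f (ToType.mk ⟨σ, hσ⟩) else Classical.choice hX)
      (fun _ _ => Set.mem_univ _) fun σ hσ τ hτ hr => ?_
    rw [dif_pos hσ, dif_pos hτ] at hr
    exact Subtype.mk_le_mk.1 (by simpa using hf _ _ hr)
  · rcases eq_or_ne β 0 with rfl | h0
    · exact zero_le
    · exact absurd ⟨f (ToType.mk ⟨0, pos_iff_ne_zero.2 h0⟩)⟩ hX

theorem union (hP : TypeLE r P θ) (hQ : TypeLE r Q η) : TypeLE r (P ∪ Q) (natSum θ η) := by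
  induction hP generalizing Q η with
  | @intro P θ g hlt h ih =>
  have hP : TypeLE r P θ := ⟨g, hlt, h⟩
  induction hQ with
  | @intro Q η k klt h' ih' =>
  refine of_forall fun x hx => ?_
  rcases hx with hx | hx
  · refine ⟨_, natSum_lt_left (hlt x hx) η, (ih x hx ⟨k, klt, h'⟩).subset ?_⟩
    rintro y ⟨hy | hy, hn⟩
    · exact Or.inl ⟨hy, hn⟩
    · exact Or.inr hy
  · refine ⟨_, natSum_lt_right θ (klt x hx), (ih' x hx).subset ?_⟩
    rintro y ⟨hy | hy, hn⟩
    · exact Or.inl hy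
    · exact Or.inr ⟨hy, hn⟩

/-- Bounds on the part outside of a downward closed set whose type is at least `d`. -/
theorem sdiff (hP : TypeLE r P θ) {D : Set X} {d : Ordinal.{u}} (hD : D ⊆ P)
    (hdown : ∀ x ∈ P, x ∉ D → ∀ y ∈ D, ¬ r x y) (hd : ∀ e < d, ¬ TypeLE r D e) :
    TypeLE r (P \ D) (θ - d) := by
  induction hP with
  | @intro P θ g hlt h ih =>
    refine of_forall fun x hx => ?_
    have hsub : D ⊆ residual r P x := fun y hy => ⟨hD hy, hdown x hx.1 hx.2 y hy⟩
    -- The residual at `x` still contains `D`, so its bound is at least `d`, and subtracting `d`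
    -- preserves strict inequality.
    refine ⟨g x - d, ?_, ((ih x hx.1 hsub fun y hy => hdown y hy.1)).subset ?_⟩
    · have hdx : d ≤ g x := not_lt.1 fun hlt' => hd _ hlt' ((h x hx.1).subset hsub)
      rw [← add_lt_add_iff_left d, Ordinal.add_sub_cancel_of_le hdx,
        Ordinal.add_sub_cancel_of_le (hdx.trans (hlt x hx.1).le)]
      exact hlt x hx.1
    · exact fun y hy => ⟨⟨hy.1.1, hy.2⟩, hy.1.2⟩

/-- If `P` is not of type at most `d`, some residual of `P` also has no bound below `d`, and the
search continues there. Residuals are downward closed by transitivity, so the set found is downward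
closed in `P`. -/
theorem exists_downset [IsTrans X r] (hP : TypeLE r P θ) (d : Ordinal.{u})
    (hd : ∀ e < d, ¬ TypeLE r P e) :
    ∃ D ⊆ P, (∀ x ∈ P, x ∉ D → ∀ y ∈ D, ¬ r x y) ∧ TypeLE r D d ∧ ∀ e < d, ¬ TypeLE r D e := by
  induction hP with
  | @intro P θ g hlt h ih =>
    by_cases hPd : TypeLE r P d
    · exact ⟨P, subset_rfl, fun x hx hn => absurd hx hn, hPd, hd⟩
    · have : ∃ x ∈ P, ∀ e < d, ¬ TypeLE r (residual r P x) e := by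
        by_contra! hcon
        exact hPd (of_forall hcon)
      obtain ⟨x, hx, hxd⟩ := this
      obtain ⟨D, hDP, hdown, hD⟩ := ih x hx hxd
      refine ⟨D, fun y hy => (hDP hy).1, fun z hz hzD y hy hzy => ?_, hD⟩
      by_cases hxz : r x z
      · exact (hDP hy).2 (_root_.trans hxz hzy)
      · exact hdown z ⟨hz, hxz⟩ hzD y hy hzy

/-- A set of type at most `d + e` is covered by sets of types at most `d` and `e`. -/
theorem exists_cover [IsTrans X r] {d e : Ordinal.{u}} (hP : TypeLE r P (d + e)) :
    ∃ D E : Set X, P ⊆ D ∪ E ∧ TypeLE r D d ∧ TypeLE r E e := by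
  by_cases h : ∃ c < d, TypeLE r P c
  · obtain ⟨c, hc, h⟩ := h
    exact ⟨P, ∅, Set.subset_union_left, h.mono hc.le, empty⟩
  · push Not at h
    obtain ⟨D, hDP, hdown, hD, hDd⟩ := hP.exists_downset d h
    refine ⟨D, P \ D, fun x hx => ?_, hD, ?_⟩
    · by_cases hxD : x ∈ D
      · exact Or.inl hxD
      · exact Or.inr ⟨hx, hxD⟩
    · simpa using hP.sdiff hDP hdown hDd

end TypeLE

/-! ### Products -/

/-- The componentwise order on a product. -/
def ProdRel {X : Type v} {Y : Type w} (r : X → X → Prop) (s : Y → Y → Prop) (p q : X × Y) : Prop :=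
  r p.1 q.1 ∧ s p.2 q.2

instance {X : Type v} {Y : Type w} (r : X → X → Prop) (s : Y → Y → Prop) [IsTrans X r]
    [IsTrans Y s] : IsTrans (X × Y) (ProdRel r s) :=
  ⟨fun _ _ _ h h' => ⟨_root_.trans h.1 h'.1, _root_.trans h.2 h'.2⟩⟩

theorem exists_log_rest {a : Ordinal.{u}} (h : a ≠ 0) :
    ω ^ log ω a + (a - ω ^ log ω a) = a ∧ a - ω ^ log ω a < a :=
  ⟨Ordinal.add_sub_cancel_of_le (opow_log_le_self _ h), sub_omega0_opow_log_lt h⟩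

namespace TypeLE

variable {X : Type v} {Y : Type w} {r : X → X → Prop} {s : Y → Y → Prop} {P Q : Set X}
  {S : Set Y} {θ η : Ordinal.{u}}

/-- By the Cantor normal form of `a`, repeated use of `exists_cover` covers `P` by finitely many
sets whose types are bounded by powers `ω ^ e` with `e < B`. -/
theorem bound_of_indecomposable [IsTrans X r] (Φ : Set X → Prop) {B : Ordinal.{u}} (hΦ : Φ ∅)
    (hmono : ∀ P Q, P ⊆ Q → Φ Q → Φ P)
    (hunion : ∀ P Q, Φ P → Φ Q → Φ (P ∪ Q)) (h : ∀ e < B, ∀ P, TypeLE r P (ω ^ e) → Φ P)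
    {a : Ordinal.{u}} (ha : a < ω ^ B) (hP : TypeLE r P a) : Φ P := by
  induction a using WellFoundedLT.induction generalizing P with
  | ind a ih =>
    rcases eq_or_ne a 0 with rfl | h0
    · rw [hP.eq_empty]; exact hΦ
    · obtain ⟨h1, h2⟩ := exists_log_rest h0
      rw [← h1] at hP
      obtain ⟨D, E, hPDE, hD, hE⟩ := hP.exists_cover
      refine hmono _ _ hPDE (hunion _ _ (h _ ?_ D hD) (ih _ h2 (h2.trans ha) hE))
      exact (lt_opow_iff_log_lt one_lt_omega0 h0).1 ha

/-- A pair that is not above `(x, y)` lies in `P_x × S` or in `P × S_y`. One factor is then a finite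
union of sets of types bounded by smaller powers of `ω`, and `ω ^ natSum a b` is closed under
natural sums. -/
theorem prod_opow [IsTrans X r] [IsTrans Y s] {a b : Ordinal.{u}} (hP : TypeLE r P (ω ^ a))
    (hS : TypeLE s S (ω ^ b)) : TypeLE (ProdRel r s) (P ×ˢ S) (ω ^ natSum a b) := by
  induction a using WellFoundedLT.induction generalizing b P S with
  | ind a iha =>
  induction b using WellFoundedLT.induction generalizing P S with
  | ind b ihb =>
  refine of_forall fun p hp => ?_
  obtain ⟨c, hc, hPc⟩ := hP.exists_lt hp.1
  obtain ⟨d, hd, hSd⟩ := hS.exists_lt hp.2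
  have hleft : ∃ e < ω ^ natSum a b, TypeLE (ProdRel r s) (residual r P p.1 ×ˢ S) e := by
    refine bound_of_indecomposable (fun P => ∃ e < ω ^ natSum a b, TypeLE (ProdRel r s) (P ×ˢ S) e)
      ⟨0, opow_pos _ omega0_pos, ?_⟩ ?_ ?_ ?_ hc hPc
    · rw [Set.empty_prod]; exact empty
    · rintro P Q hPQ ⟨e, he, h⟩
      exact ⟨e, he, h.subset (Set.prod_mono_left hPQ)⟩
    · rintro P Q ⟨e, he, h⟩ ⟨e', he', h'⟩
      exact ⟨_, natSum_lt_opow he he', by rw [Set.union_prod]; exact h.union h'⟩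
    · intro e he P hPe
      exact ⟨_, (opow_lt_opow_iff_right one_lt_omega0).2 (natSum_lt_left he b), iha e he hPe hS⟩
  have hright : ∃ e < ω ^ natSum a b, TypeLE (ProdRel r s) (P ×ˢ residual s S p.2) e := by
    refine bound_of_indecomposable (fun S => ∃ e < ω ^ natSum a b, TypeLE (ProdRel r s) (P ×ˢ S) e)
      ⟨0, opow_pos _ omega0_pos, ?_⟩ ?_ ?_ ?_ hd hSd
    · rw [Set.prod_empty]; exact empty
    · rintro S T hST ⟨e, he, h⟩
      exact ⟨e, he, h.subset (Set.prod_mono_right hST)⟩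
    · rintro S T ⟨e, he, h⟩ ⟨e', he', h'⟩
      exact ⟨_, natSum_lt_opow he he', by rw [Set.prod_union]; exact h.union h'⟩
    · intro e he S hSe
      exact ⟨_, (opow_lt_opow_iff_right one_lt_omega0).2 (natSum_lt_right a he), ihb e he hP hSe⟩
  obtain ⟨e, he, h⟩ := hleft
  obtain ⟨e', he', h'⟩ := hright
  refine ⟨_, natSum_lt_opow he he', (h.union h').subset ?_⟩
  rintro q ⟨hq, hn⟩
  by_cases hq1 : r p.1 q.1
  · exact Or.inr ⟨hq.1, hq.2, fun hq2 => hn ⟨hq1, hq2⟩⟩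
  · exact Or.inl ⟨⟨hq.1, hq1⟩, hq.2⟩

end TypeLE

/-! ### Finite sequences -/

/-- The finite sequences of elements of `P`. -/
def listsOf {X : Type v} (P : Set X) : Set (List X) := {l | ∀ x ∈ l, x ∈ P}

open List in
theorem sublistForall₂_append {X : Type v} {r : X → X → Prop} {l l' m m' : List X}
    (h : SublistForall₂ r l l') (h' : SublistForall₂ r m m') :
    SublistForall₂ r (l ++ m) (l' ++ m') := by
  induction h with
  | @nil l =>
    induction l with
    | nil => exact h'
    | cons a l ih => exact .cons_right ih
  | cons h _ ih => exact .cons h ih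
  | cons_right _ ih => exact .cons_right ih

theorem exists_le_opow_of_lt {L c : Ordinal.{u}} (hL : IsSuccLimit L) (hc : c < ω ^ L) :
    ∃ e < L, c ≤ ω ^ e := by
  obtain ⟨e, he, h⟩ := (lt_opow_of_isSuccLimit omega0_ne_zero hL).1 hc
  exact ⟨e, he, h.le⟩

theorem isSuccLimit_omega0_opow {c : Ordinal.{u}} (hc : c ≠ 0) : IsSuccLimit (ω ^ c) :=
  isSuccLimit_opow_left isSuccLimit_omega0 hc

open List in
-- Higman's argument: a list that avoids `x :: w` either has no member above `x`, or splits at its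
-- first such member `z` into a list over the residual at `x`, the member `z`, and a tail that
-- avoids `w`. The function `h` is a parameter because `ξ ↦ ξ` suffices below the first epsilon
-- number, while `ξ ↦ ξ + 1` always works.
theorem TypeLE.lists {X : Type v} {r : X → X → Prop} [IsTrans X r] {h : Ordinal.{u} → Ordinal.{u}}
    (hmono : StrictMono h) {P : Set X} {ξ : Ordinal.{u}} (hξ : ∀ ζ ≤ ξ, ζ < ω ^ ω ^ h ζ)
    (hP : TypeLE r P ξ) : TypeLE (SublistForall₂ r) (listsOf P) (ω ^ ω ^ h ξ) := by
  classical
  induction ξ using WellFoundedLT.induction generalizing P with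
  | ind ξ ih =>
  have key : ∀ w ∈ listsOf P, ∃ e < ω ^ h ξ,
      TypeLE (SublistForall₂ r) (residual (SublistForall₂ r) (listsOf P) w) (ω ^ e) := by
    intro w
    induction w with
    | nil =>
      refine fun _ => ⟨0, opow_pos _ omega0_pos, ?_⟩
      have : residual (SublistForall₂ r) (listsOf P) [] = ∅ :=
        Set.eq_empty_iff_forall_notMem.2 fun l hl => hl.2 .nil
      rw [this]
      exact TypeLE.empty
    | cons x w ihw =>
      intro hw
      have hx : x ∈ P := hw x (by simp)
      obtain ⟨E, hE, hEw⟩ := ihw fun y hy => hw y (by simp [hy])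
      obtain ⟨ξ', hξ', hPx⟩ := hP.exists_lt hx
      have h0 : h ξ ≠ 0 := (hmono hξ').ne_bot
      have hlim := isSuccLimit_omega0_opow h0
      have hA := ih ξ' hξ' (fun ζ hζ => hξ ζ (hζ.trans hξ'.le)) hPx
      -- The splitting member ranges over all of `P`; the condition on `h` keeps the exponent of a
      -- bound for `P` below `ω ^ h ξ`.
      obtain ⟨EP, hEP, hEP'⟩ := exists_le_opow_of_lt hlim (hξ ξ le_rfl)
      have hlt : ω ^ h ξ' < ω ^ h ξ := (opow_lt_opow_iff_right one_lt_omega0).2 (hmono hξ')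
      have hB := hA.prod_opow ((hP.mono hEP').prod_opow hEw)
      have hB' : TypeLE (SublistForall₂ r)
          {l ∈ residual (SublistForall₂ r) (listsOf P) (x :: w) | ∃ y ∈ l, r x y}
          (ω ^ natSum (ω ^ h ξ') (natSum EP E)) := by
        -- The default `x` in `headD` is never used, since the lists considered have a member above
        -- `x`.
        refine hB.comap (fun l => (l.takeWhile (fun y => ¬ r x y),
          (l.dropWhile (fun y => ¬ r x y)).headD x, (l.dropWhile (fun y => ¬ r x y)).tail)) ?_ ?_
        · rintro l ⟨⟨hl, hn⟩, y, hy, hxy⟩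
          have hne : l.dropWhile (fun y => ¬ r x y) ≠ [] := by
            rw [Ne, List.dropWhile_eq_nil_iff]
            push Not
            exact ⟨y, hy, by simpa using hxy⟩
          obtain ⟨z, t, hzt⟩ := List.exists_cons_of_ne_nil hne
          have hz : r x z := by
            have h1 := List.head_dropWhile_not (fun y => ¬ r x y) hne
            have h2 : (l.dropWhile (fun y => ¬ r x y)).head hne = z := by simp only [hzt, List.head_cons]
            rw [h2] at h1
            simpa using h1
          have hlsplit : l.takeWhile (fun y => ¬ r x y) ++ z :: t = l := by
            rw [← hzt, List.takeWhile_append_dropWhile]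
          refine ⟨fun y hy => ⟨?_, ?_⟩, ?_, ?_, ?_⟩
          · exact hl y (List.takeWhile_subset _ hy)
          · simpa using List.mem_takeWhile_imp hy
          · simp only [hzt, List.headD_cons]
            exact hl z (by rw [← hlsplit]; simp)
          · simp only [hzt, List.tail_cons]
            exact fun y hy => hl y (by rw [← hlsplit]; simp [hy])
          · simp only [hzt, List.tail_cons]
            intro hwt
            refine hn ?_
            rw [← hlsplit]
            exact sublistForall₂_append (l := []) .nil (.cons hz hwt)
        · rintro l ⟨⟨hl, hn⟩, y, hy, hxy⟩ m ⟨⟨hm, hn'⟩, y', hy', hxy'⟩ ⟨h1, h2, h3⟩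
          have hne : l.dropWhile (fun y => ¬ r x y) ≠ [] := by
            rw [Ne, List.dropWhile_eq_nil_iff]
            push Not
            exact ⟨y, hy, by simpa using hxy⟩
          have hne' : m.dropWhile (fun y => ¬ r x y) ≠ [] := by
            rw [Ne, List.dropWhile_eq_nil_iff]
            push Not
            exact ⟨y', hy', by simpa using hxy'⟩
          obtain ⟨z, t, hzt⟩ := List.exists_cons_of_ne_nil hne
          obtain ⟨z', t', hzt'⟩ := List.exists_cons_of_ne_nil hne'
          rw [← List.takeWhile_append_dropWhile (p := fun y => ¬ r x y) (l := l),
            ← List.takeWhile_append_dropWhile (p := fun y => ¬ r x y) (l := m), hzt, hzt']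
          simp only [hzt, hzt', List.headD_cons, List.tail_cons] at h2 h3
          exact sublistForall₂_append h1 (.cons h2 h3)
      have hsum : natSum (ω ^ ω ^ h ξ') (ω ^ natSum (ω ^ h ξ') (natSum EP E)) < ω ^ ω ^ h ξ := by
        refine natSum_lt_opow ((opow_lt_opow_iff_right one_lt_omega0).2 hlt)
          ((opow_lt_opow_iff_right one_lt_omega0).2 ?_)
        exact natSum_lt_opow hlt (natSum_lt_opow hEP hE)
      obtain ⟨e, he, hle⟩ := exists_le_opow_of_lt hlim hsum
      refine ⟨e, he, ((hA.union hB').mono hle).subset ?_⟩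
      intro l hl
      by_cases hy : ∃ y ∈ l, r x y
      · exact Or.inr ⟨hl, hy⟩
      · push Not at hy
        exact Or.inl fun y hyl => ⟨hl.1 y hyl, hy y hyl⟩
  refine TypeLE.of_forall fun w hw => ?_
  obtain ⟨e, he, hb⟩ := key w hw
  exact ⟨_, (opow_lt_opow_iff_right one_lt_omega0).2 he, hb⟩

theorem lt_opow_opow_add_one (a : Ordinal.{u}) : a < ω ^ ω ^ (a + 1) :=
  ((lt_add_one a).trans_le (right_le_opow _ one_lt_omega0)).trans_le
    (right_le_opow _ one_lt_omega0)

open List in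
theorem TypeLE.lists_add_one {X : Type v} {r : X → X → Prop} [IsTrans X r] {P : Set X}
    {ξ : Ordinal.{u}} (hP : TypeLE r P ξ) :
    TypeLE (SublistForall₂ r) (listsOf P) (ω ^ ω ^ (ξ + 1)) :=
  hP.lists (h := fun a => a + 1) (fun _ _ h => by simpa using h)
    fun ζ _ => lt_opow_opow_add_one ζ

open List in
theorem TypeLE.lists_of_lt_epsilon {X : Type v} {r : X → X → Prop} [IsTrans X r] {P : Set X}
    {ξ : Ordinal.{u}} (hP : TypeLE r P ξ) (hξ : ξ < veblen 1 0) :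
    TypeLE (SublistForall₂ r) (listsOf P) (ω ^ ω ^ ξ) := by
  refine hP.lists strictMono_id fun ζ hζ => ?_
  by_contra! hcon
  have h1 : ω ^ ζ ≤ ζ := (right_le_opow _ one_lt_omega0).trans hcon
  have h2 : veblen 1 0 ≤ ζ := epsilon_zero_le_of_omega0_opow_le h1
  exact (hζ.trans_lt hξ).not_ge h2

/-! ### Closure properties of values of the Veblen functions -/

theorem opow_veblen {γ : Ordinal.{u}} (hγ : γ ≠ 0) (η : Ordinal.{u}) :
    ω ^ veblen γ η = veblen γ η := by
  rw [← veblen_zero_apply]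
  exact veblen_veblen_of_lt (pos_iff_ne_zero.2 hγ) η

theorem veblen_lt_veblen {γ e x η : Ordinal.{u}} (he : e < γ) (hx : x < veblen γ η) :
    veblen e x < veblen γ η := by
  rw [← veblen_veblen_of_lt he]
  exact veblen_right_strictMono e hx

theorem opow_lt_veblen {γ x η : Ordinal.{u}} (hγ : γ ≠ 0) (hx : x < veblen γ η) :
    ω ^ x < veblen γ η := by
  rw [← veblen_zero_apply]
  exact veblen_lt_veblen (pos_iff_ne_zero.2 hγ) hx

theorem isSuccLimit_veblen {γ : Ordinal.{u}} (hγ : γ ≠ 0) (η : Ordinal.{u}) :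
    IsSuccLimit (veblen γ η) := by
  rw [← opow_veblen hγ]
  exact isSuccLimit_omega0_opow veblen_pos.ne'

theorem add_one_lt_veblen {γ x η : Ordinal.{u}} (hγ : γ ≠ 0) (hx : x < veblen γ η) :
    x + 1 < veblen γ η :=
  (isSuccLimit_veblen hγ η).add_one_lt hx

theorem natSum_lt_veblen {γ x y η : Ordinal.{u}} (hγ : γ ≠ 0) (hx : x < veblen γ η)
    (hy : y < veblen γ η) : natSum x y < veblen γ η := by
  rw [← opow_veblen hγ] at *
  exact natSum_lt_opow hx hy

theorem omega0_lt_veblen {γ : Ordinal.{u}} (hγ : γ ≠ 0) (η : Ordinal.{u}) : ω < veblen γ η := by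
  have h1 := add_one_lt_veblen hγ (veblen_pos (o := γ) (a := η))
  simpa using opow_lt_veblen hγ h1

theorem TypeLE.Iio (a : Ordinal.{u}) : TypeLE (· ≤ ·) (Set.Iio a) a := by
  induction a using WellFoundedLT.induction with
  | ind a ih =>
    refine TypeLE.of_forall fun x hx => ⟨x, hx, (ih x hx).subset ?_⟩
    exact fun y hy => not_le.1 hy.2

theorem TypeLE.prod_lt_veblen {X : Type v} {Y : Type w} {r : X → X → Prop} {s : Y → Y → Prop}
    [IsTrans X r] [IsTrans Y s] {P : Set X} {S : Set Y} {γ η a b : Ordinal.{u}} (hγ : γ ≠ 0)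
    (hP : TypeLE r P a) (hS : TypeLE s S b) (ha : a < veblen γ η) (hb : b < veblen γ η) :
    ∃ c < veblen γ η, TypeLE (ProdRel r s) (P ×ˢ S) c :=
  ⟨_, opow_lt_veblen hγ (natSum_lt_veblen hγ ha hb),
    (hP.mono (right_le_opow _ one_lt_omega0)).prod_opow
      (hS.mono (right_le_opow _ one_lt_omega0))⟩

open List in
theorem TypeLE.lists_lt_veblen {X : Type v} {r : X → X → Prop} [IsTrans X r] {P : Set X}
    {γ η a : Ordinal.{u}} (hγ : γ ≠ 0) (hP : TypeLE r P a) (ha : a < veblen γ η) :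
    ∃ c < veblen γ η, TypeLE (SublistForall₂ r) (listsOf P) c :=
  ⟨_, opow_lt_veblen hγ (opow_lt_veblen hγ (add_one_lt_veblen hγ ha)), hP.lists_add_one⟩

/-! ### Trees with ordinal labels -/

/-- Embeddability of trees with ordinals as inner labels, relative to a relation on the leaf
labels. -/
inductive Emb {X : Type v} (r : X → X → Prop) :
    BinTree Ordinal.{u} X → BinTree Ordinal.{u} X → Prop
  | leaf {x y : X} : r x y → Emb r (.leaf x) (.leaf y)
  | left {s t₁ t₂ : BinTree Ordinal.{u} X} {b : Ordinal.{u}} :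
      Emb r s t₁ → Emb r s (.node b t₁ t₂)
  | right {s t₁ t₂ : BinTree Ordinal.{u} X} {b : Ordinal.{u}} :
      Emb r s t₂ → Emb r s (.node b t₁ t₂)
  | node {b c : Ordinal.{u}} {s₁ s₂ t₁ t₂ : BinTree Ordinal.{u} X} :
      b ≤ c → Emb r s₁ t₁ → Emb r s₂ t₂ → Emb r (.node b s₁ s₂) (.node c t₁ t₂)

theorem Emb.trans {X : Type v} {r : X → X → Prop} [IsTrans X r] {s t u : BinTree Ordinal.{u} X}
    (h : Emb r s t) (h' : Emb r t u) : Emb r s u := by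
  induction h' generalizing s with
  | leaf hxy =>
    cases h with
    | leaf hx => exact .leaf (_root_.trans hx hxy)
  | left _ ih => exact .left (ih h)
  | right _ ih => exact .right (ih h)
  | node hbc h₁ h₂ ih₁ ih₂ =>
    cases h with
    | left h => exact .left (ih₁ h)
    | right h => exact .right (ih₂ h)
    | node hab h h' => exact .node (hab.trans hbc) (ih₁ h) (ih₂ h')

instance {X : Type v} (r : X → X → Prop) [IsTrans X r] : IsTrans (BinTree Ordinal.{u} X) (Emb r) :=
  ⟨fun _ _ _ => Emb.trans⟩

/-- The trees with inner labels below `α` that ascend weakly, and strictly on left subtrees, and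
with leaf labels in `P`. -/
def lsTrees {X : Type v} (α : Ordinal.{u}) (P : Set X) : Set (BinTree Ordinal.{u} X)
  | .leaf x => x ∈ P
  | .node b l r => b < α ∧ lsTrees α P l ∧ lsTrees α P r ∧
      (∀ c ∈ l.innerLabels, b < c) ∧ (∀ c ∈ r.innerLabels, b ≤ c)

/-! ### Collapsing, cutting and flattening trees. -/

section Decomposition

variable {X : Type v} {r : X → X → Prop} {α : Ordinal.{u}} {P : Set X}

theorem node_mem_lsTrees {b : Ordinal.{u}} {s t : BinTree Ordinal.{u} X} :
    BinTree.node b s t ∈ lsTrees α P ↔ b < α ∧ s ∈ lsTrees α P ∧ t ∈ lsTrees α P ∧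
      (∀ c ∈ s.innerLabels, b < c) ∧ (∀ c ∈ t.innerLabels, b ≤ c) := Iff.rfl

theorem innerLabels_node {b : Ordinal.{u}} {s t : BinTree Ordinal.{u} X} {c : Ordinal.{u}} :
    c ∈ (BinTree.node b s t).innerLabels ↔ c = b ∨ c ∈ s.innerLabels ∨ c ∈ t.innerLabels := Iff.rfl

theorem residual_leaf_subset {x : X} :
    residual (Emb r) (lsTrees α P) (.leaf x) ⊆ lsTrees α (residual r P x) := by
  rintro t ⟨ht, hn⟩
  induction t with
  | leaf y => exact ⟨ht, fun h => hn (.leaf h)⟩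
  | node b t₁ t₂ ih₁ ih₂ =>
    exact ⟨ht.1, ih₁ ht.2.1 fun h => hn (.left h), ih₂ ht.2.2.1 fun h => hn (.right h), ht.2.2.2⟩

/-- The order on the members of a path: labels, sides and trees on the respective other side. -/
def PathRel (r : X → X → Prop) :
    Ordinal.{u} × Bool × BinTree Ordinal.{u} X → Ordinal.{u} × Bool × BinTree Ordinal.{u} X → Prop :=
  ProdRel (· ≤ ·) (ProdRel Eq (Emb r))

open Classical in
/-- Follow a path through a tree that turns right when `tl` does not embed on the left and that
turns left otherwise; record the subtrees on the other side, and the leaf. -/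
noncomputable def path (r : X → X → Prop) (tl : BinTree Ordinal.{u} X) : BinTree Ordinal.{u} X →
    List (Ordinal.{u} × Bool × BinTree Ordinal.{u} X) × X
  | .leaf x => ([], x)
  | .node b s t => if Emb r tl s then ((b, false, t) :: (path r tl s).1, (path r tl s).2)
      else ((b, true, s) :: (path r tl t).1, (path r tl t).2)

open List in
-- A matched pair of entries has the same side, so it yields a node clause: the recorded trees embed
-- by `PathRel` and the trees along the path by induction. A skipped entry of `t` is a node that is
-- passed on the way to the subtree on the path.
theorem emb_of_path {tl : BinTree Ordinal.{u} X} {s t : BinTree Ordinal.{u} X}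
    (h : SublistForall₂ (PathRel r) (path r tl s).1 (path r tl t).1)
    (hx : r (path r tl s).2 (path r tl t).2) : Emb r s t := by
  induction t generalizing s with
  | leaf y =>
    cases s with
    | leaf x => exact .leaf hx
    | node b s₁ s₂ =>
      by_cases hs : Emb r tl s₁
      · simp only [path, if_pos hs] at h
        cases h
      · simp only [path, if_neg hs] at h
        cases h
  | node c t₁ t₂ ih₁ ih₂ =>
    by_cases ht : Emb r tl t₁
    · simp only [path, if_pos ht] at h hx
      cases s with
      | leaf x => exact .left (ih₁ .nil hx)
      | node b s₁ s₂ =>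
        by_cases hs : Emb r tl s₁
        · have key : SublistForall₂ (PathRel r) (path r tl (.node b s₁ s₂)).1 (path r tl t₁).1 →
              Emb r (.node b s₁ s₂) (.node c t₁ t₂) := fun h => .left (ih₁ h hx)
          simp only [path, if_pos hs] at h hx key
          cases h with
          | cons hab h => exact .node hab.1 (ih₁ h hx) hab.2.2
          | cons_right h => exact key h
        · have key : SublistForall₂ (PathRel r) (path r tl (.node b s₁ s₂)).1 (path r tl t₁).1 →
              Emb r (.node b s₁ s₂) (.node c t₁ t₂) := fun h => .left (ih₁ h hx)
          simp only [path, if_neg hs] at h hx key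
          cases h with
          | cons hab h => exact absurd hab.2.1 (by simp)
          | cons_right h => exact key h
    · simp only [path, if_neg ht] at h hx
      cases s with
      | leaf x => exact .right (ih₂ .nil hx)
      | node b s₁ s₂ =>
        have key : SublistForall₂ (PathRel r) (path r tl (.node b s₁ s₂)).1 (path r tl t₂).1 →
              Emb r (.node b s₁ s₂) (.node c t₁ t₂) := fun h => .right (ih₂ h hx)
        by_cases hs : Emb r tl s₁
        · simp only [path, if_pos hs] at h hx key
          cases h with
          | cons hab h => exact absurd hab.2.1 (by simp)
          | cons_right h => exact key h
        · simp only [path, if_neg hs] at h hx key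
          cases h with
          | cons hab h => exact .node hab.1 hab.2.2 (ih₂ h hx)
          | cons_right h => exact key h

open Classical in
/-- Replace all maximal subtrees with labels from `β` on by a leaf that records a path. -/
noncomputable def collapse (r : X → X → Prop) (tl : BinTree Ordinal.{u} X) (β : Ordinal.{u}) :
    BinTree Ordinal.{u} X →
      BinTree Ordinal.{u} (List (Ordinal.{u} × Bool × BinTree Ordinal.{u} X) × X)
  | .leaf x => .leaf (path r tl (.leaf x))
  | .node b s t => if b < β then .node b (collapse r tl β s) (collapse r tl β t)
      else .leaf (path r tl (.node b s t))

open List in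
theorem emb_of_collapse {tl : BinTree Ordinal.{u} X} {β : Ordinal.{u}}
    {s t : BinTree Ordinal.{u} X}
    (h : Emb (ProdRel (SublistForall₂ (PathRel r)) r) (collapse r tl β s) (collapse r tl β t)) :
    Emb r s t := by
  induction t generalizing s with
  | leaf y =>
    cases s with
    | leaf x =>
      simp only [collapse] at h
      cases h with
      | leaf h => exact emb_of_path h.1 h.2
    | node b s₁ s₂ =>
      by_cases hb : b < β
      · simp only [collapse, if_pos hb] at h
        cases h
      · simp only [collapse, if_neg hb] at h
        cases h with
        | leaf h => exact emb_of_path h.1 h.2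
  | node c t₁ t₂ ih₁ ih₂ =>
    by_cases hc : c < β
    · simp only [collapse, if_pos hc] at h
      cases s with
      | leaf x =>
        simp only [collapse] at h
        cases h with
        | left h => exact .left (ih₁ (by simpa only [collapse] using h))
        | right h => exact .right (ih₂ (by simpa only [collapse] using h))
      | node b s₁ s₂ =>
        by_cases hb : b < β
        · have key := fun h => (ih₁ (s := .node b s₁ s₂) h)
          have key' := fun h => (ih₂ (s := .node b s₁ s₂) h)
          simp only [collapse, if_pos hb] at h key key'
          cases h with
          | left h => exact .left (key h)
          | right h => exact .right (key' h)
          | node hbc h h' => exact .node hbc (ih₁ h) (ih₂ h')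
        · have key := fun h => (ih₁ (s := .node b s₁ s₂) h)
          have key' := fun h => (ih₂ (s := .node b s₁ s₂) h)
          simp only [collapse, if_neg hb] at h key key'
          cases h with
          | left h => exact .left (key h)
          | right h => exact .right (key' h)
    · simp only [collapse, if_neg hc] at h
      cases s with
      | leaf x =>
        simp only [collapse] at h
        cases h with
        | leaf h => exact emb_of_path h.1 h.2
      | node b s₁ s₂ =>
        by_cases hb : b < β
        · simp only [collapse, if_pos hb] at h
          cases h
        · simp only [collapse, if_neg hb] at h
          cases h with
          | leaf h => exact emb_of_path h.1 h.2

theorem innerLabels_collapse {tl : BinTree Ordinal.{u} X} {β : Ordinal.{u}}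
    {s : BinTree Ordinal.{u} X} {c : Ordinal.{u}}
    (h : c ∈ (collapse r tl β s).innerLabels) : c ∈ s.innerLabels := by
  induction s with
  | leaf x => exact h
  | node b s t ih₁ ih₂ =>
    by_cases hb : b < β
    · simp only [collapse, if_pos hb] at h
      rw [innerLabels_node] at h ⊢
      exact h.imp id (Or.imp ih₁ ih₂)
    · simp only [collapse, if_neg hb] at h
      exact h.elim

/-- The possible members of paths that avoid a tree with immediate subtrees `tl` and `tr`. -/
def pathSet (r : X → X → Prop) (α : Ordinal.{u}) (P : Set X) (tl tr : BinTree Ordinal.{u} X) :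
    Set (Ordinal.{u} × Bool × BinTree Ordinal.{u} X) :=
  Set.Iio α ×ˢ ({true} ×ˢ residual (Emb r) (lsTrees α P) tl ∪
    {false} ×ˢ residual (Emb r) (lsTrees α P) tr)

/-- All labels are at least `β`. At any node, `tl` embedding on the left and `tr` on the right would
thus embed the forbidden tree; so the tree on the side not taken avoids `tl` or `tr`, as its tag
says. -/
theorem path_mem {β : Ordinal.{u}} {tl tr s : BinTree Ordinal.{u} X} (hs : s ∈ lsTrees α P)
    (hβ : ∀ c ∈ s.innerLabels, β ≤ c) (hn : ¬ Emb r (.node β tl tr) s) :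
    path r tl s ∈ listsOf (pathSet r α P tl tr) ×ˢ P := by
  induction s with
  | leaf x => exact ⟨fun y hy => absurd hy (by simp [path]), hs⟩
  | node b s t ih₁ ih₂ =>
    rw [node_mem_lsTrees] at hs
    have h₁ := ih₁ hs.2.1 (fun c hc => hβ c (Or.inr (Or.inl hc))) fun h => hn (.left h)
    have h₂ := ih₂ hs.2.2.1 (fun c hc => hβ c (Or.inr (Or.inr hc))) fun h => hn (.right h)
    have hb : β ≤ b := hβ b (Or.inl rfl)
    by_cases htl : Emb r tl s
    · simp only [path, if_pos htl]
      refine ⟨fun y hy => ?_, h₁.2⟩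
      rcases List.mem_cons.1 hy with rfl | hy
      · exact ⟨hs.1, Or.inr ⟨rfl, hs.2.2.1, fun h => hn (.node hb htl h)⟩⟩
      · exact h₁.1 y hy
    · simp only [path, if_neg htl]
      refine ⟨fun y hy => ?_, h₂.2⟩
      rcases List.mem_cons.1 hy with rfl | hy
      · exact ⟨hs.1, Or.inl ⟨rfl, hs.2.1, htl⟩⟩
      · exact h₂.1 y hy

theorem collapse_mem {β : Ordinal.{u}} {tl tr s : BinTree Ordinal.{u} X} (hs : s ∈ lsTrees α P)
    (hn : ¬ Emb r (.node β tl tr) s) :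
    collapse r tl β s ∈ lsTrees β (listsOf (pathSet r α P tl tr) ×ˢ P) := by
  induction s with
  | leaf x => exact path_mem hs (fun c hc => absurd hc (Set.notMem_empty _)) hn
  | node b s t ih₁ ih₂ =>
    have hs' := node_mem_lsTrees.1 hs
    by_cases hb : b < β
    · simp only [collapse, if_pos hb]
      refine ⟨hb, ih₁ hs'.2.1 fun h => hn (.left h), ih₂ hs'.2.2.1 fun h => hn (.right h), ?_, ?_⟩
      · exact fun c hc => hs'.2.2.2.1 c (innerLabels_collapse hc)
      · exact fun c hc => hs'.2.2.2.2 c (innerLabels_collapse hc)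
    -- Labels ascend, so every label of this subtree is at least `β`, as `path_mem` requires.
    · simp only [collapse, if_neg hb]
      refine path_mem hs (fun c hc => ?_) hn
      rcases hc with rfl | hc | hc
      · exact not_lt.1 hb
      · exact (not_lt.1 hb).trans (hs'.2.2.2.1 c hc).le
      · exact (not_lt.1 hb).trans (hs'.2.2.2.2 c hc)

/-- Change the inner labels of a tree. -/
def mapLabels {A B : Type*} (f : A → B) : BinTree A X → BinTree B X
  | .leaf x => .leaf x
  | .node b s t => .node (f b) (mapLabels f s) (mapLabels f t)

theorem innerLabels_mapLabels {A B : Type*} (f : A → B) (s : BinTree A X) :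
    (mapLabels f s).innerLabels = f '' s.innerLabels := by
  induction s with
  | leaf x => simp [mapLabels, BinTree.innerLabels]
  | node b s t ih₁ ih₂ =>
    simp [mapLabels, BinTree.innerLabels, ih₁, ih₂, Set.image_union, Set.image_insert_eq]

theorem emb_of_mapLabels {f : Ordinal.{u} → Ordinal.{w}} {s t : BinTree Ordinal.{u} X}
    (hf : ∀ b ∈ s.innerLabels, ∀ c ∈ t.innerLabels, f b ≤ f c → b ≤ c)
    (h : Emb r (mapLabels f s) (mapLabels f t)) : Emb r s t := by
  induction t generalizing s with
  | leaf y =>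
    cases s with
    | leaf x => cases h with | leaf h => exact .leaf h
    | node b s₁ s₂ => cases h
  | node c t₁ t₂ ih₁ ih₂ =>
    have hl : ∀ s, (∀ b ∈ s.innerLabels, ∀ d ∈ (BinTree.node c t₁ t₂).innerLabels,
        f b ≤ f d → b ≤ d) → Emb r (mapLabels f s) (mapLabels f t₁) → Emb r s t₁ :=
      fun s hs h => ih₁ (fun b hb d hd => hs b hb d (Or.inr (Or.inl hd))) h
    have hr : ∀ s, (∀ b ∈ s.innerLabels, ∀ d ∈ (BinTree.node c t₁ t₂).innerLabels,
        f b ≤ f d → b ≤ d) → Emb r (mapLabels f s) (mapLabels f t₂) → Emb r s t₂ :=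
      fun s hs h => ih₂ (fun b hb d hd => hs b hb d (Or.inr (Or.inr hd))) h
    cases s with
    | leaf x =>
      cases h with
      | left h => exact .left (hl (.leaf x) hf h)
      | right h => exact .right (hr (.leaf x) hf h)
    | node b s₁ s₂ =>
      cases h with
      | left h => exact .left (hl (.node b s₁ s₂) hf h)
      | right h => exact .right (hr (.node b s₁ s₂) hf h)
      | node hbc h h' =>
        refine .node (hf b (Or.inl rfl) c (Or.inl rfl) hbc) (hl _ ?_ h) (hr _ ?_ h')
        · exact fun b hb => hf b (Or.inr (Or.inl hb))
        · exact fun b hb => hf b (Or.inr (Or.inr hb))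

open Classical in
/-- Replace all maximal subtrees with labels from `κ` on by leaves. -/
noncomputable def cut (κ : Ordinal.{u}) :
    BinTree Ordinal.{u} X → BinTree Ordinal.{u} (BinTree Ordinal.{u} X)
  | .leaf x => .leaf (.leaf x)
  | .node b s t => if b < κ then .node b (cut κ s) (cut κ t)
      else .leaf (mapLabels (· - κ) (.node b s t))

theorem innerLabels_cut {κ : Ordinal.{u}} {s : BinTree Ordinal.{u} X} {c : Ordinal.{u}}
    (h : c ∈ (cut κ s).innerLabels) : c ∈ s.innerLabels := by
  induction s with
  | leaf x => exact h
  | node b s t ih₁ ih₂ =>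
    by_cases hb : b < κ
    · simp only [cut, if_pos hb] at h
      rw [innerLabels_node] at h ⊢
      exact h.imp id (Or.imp ih₁ ih₂)
    · simp only [cut, if_neg hb] at h
      exact h.elim

theorem innerLabels_ge {b κ : Ordinal.{u}} {s t : BinTree Ordinal.{u} X}
    (hs : BinTree.node b s t ∈ lsTrees α P) (hb : κ ≤ b) :
    ∀ c ∈ (BinTree.node b s t).innerLabels, κ ≤ c := by
  rintro c (rfl | hc | hc)
  · exact hb
  · exact hb.trans (hs.2.2.2.1 c hc).le
  · exact hb.trans (hs.2.2.2.2 c hc)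

/-- A subtree with root label at least `κ` has all its labels there, and on such labels the
subtraction of `κ` reflects the order. -/
theorem emb_of_cut {κ : Ordinal.{u}} {s t : BinTree Ordinal.{u} X} (hs : s ∈ lsTrees α P)
    (ht : t ∈ lsTrees α P) (h : Emb (Emb r) (cut κ s) (cut κ t)) : Emb r s t := by
  have sub : ∀ b c : Ordinal.{u}, κ ≤ b → κ ≤ c → b - κ ≤ c - κ → b ≤ c := by
    intro b c hb hc hbc
    rw [← Ordinal.add_sub_cancel_of_le hb, ← Ordinal.add_sub_cancel_of_le hc]
    exact add_le_add_right hbc κ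
  induction t generalizing s with
  | leaf y =>
    cases s with
    | leaf x => cases h with | leaf h => exact h
    | node b s₁ s₂ =>
      by_cases hb : b < κ
      · simp only [cut, if_pos hb] at h
        cases h
      · simp only [cut, if_neg hb] at h
        cases h with
        | leaf h => cases h
  | node c t₁ t₂ ih₁ ih₂ =>
    by_cases hc : c < κ
    · simp only [cut, if_pos hc] at h
      cases s with
      | leaf x =>
        cases h with
        | left h => exact .left (ih₁ hs ht.2.1 h)
        | right h => exact .right (ih₂ hs ht.2.2.1 h)
      | node b s₁ s₂ =>
        have key := fun h => ih₁ hs ht.2.1 h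
        have key' := fun h => ih₂ hs ht.2.2.1 h
        by_cases hb : b < κ
        · simp only [cut, if_pos hb] at h key key'
          cases h with
          | left h => exact .left (key h)
          | right h => exact .right (key' h)
          | node hbc h h' =>
            exact .node hbc (ih₁ hs.2.1 ht.2.1 h) (ih₂ hs.2.2.1 ht.2.2.1 h')
        · simp only [cut, if_neg hb] at h key key'
          cases h with
          | left h => exact .left (key h)
          | right h => exact .right (key' h)
    · simp only [cut, if_neg hc] at h
      have htc := innerLabels_ge ht (not_lt.1 hc)
      cases s with
      | leaf x =>
        cases h with
        | leaf h =>
          refine emb_of_mapLabels (f := (· - κ)) (fun b hb => absurd hb (Set.notMem_empty _)) h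
      | node b s₁ s₂ =>
        by_cases hb : b < κ
        · simp only [cut, if_pos hb] at h
          cases h
        · simp only [cut, if_neg hb] at h
          have hsb := innerLabels_ge hs (not_lt.1 hb)
          cases h with
          | leaf h => exact emb_of_mapLabels (fun b hb c hc => sub b c (hsb b hb) (htc c hc)) h

theorem mapLabels_sub_mem {κ β : Ordinal.{u}} {s : BinTree Ordinal.{u} X}
    (hs : s ∈ lsTrees (κ + β) P) (hκ : ∀ c ∈ s.innerLabels, κ ≤ c) :
    mapLabels (· - κ) s ∈ lsTrees β P := by
  have sub : ∀ b c : Ordinal.{u}, κ ≤ b → b < c → b - κ < c - κ := by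
    intro b c hb hbc
    rw [← add_lt_add_iff_left κ, Ordinal.add_sub_cancel_of_le hb,
      Ordinal.add_sub_cancel_of_le (hb.trans hbc.le)]
    exact hbc
  induction s with
  | leaf x => exact hs
  | node b s t ih₁ ih₂ =>
    refine ⟨?_, ih₁ hs.2.1 fun c hc => hκ c (Or.inr (Or.inl hc)),
      ih₂ hs.2.2.1 fun c hc => hκ c (Or.inr (Or.inr hc)), ?_, ?_⟩
    · rw [← add_lt_add_iff_left κ, Ordinal.add_sub_cancel_of_le (hκ b (Or.inl rfl))]
      exact hs.1
    · rw [innerLabels_mapLabels]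
      rintro _ ⟨c, hc, rfl⟩
      exact sub b c (hκ b (Or.inl rfl)) (hs.2.2.2.1 c hc)
    · rw [innerLabels_mapLabels]
      rintro _ ⟨c, hc, rfl⟩
      rw [Ordinal.sub_le, Ordinal.add_sub_cancel_of_le
        ((hκ b (Or.inl rfl)).trans (hs.2.2.2.2 c hc))]
      exact hs.2.2.2.2 c hc

theorem cut_mem {κ β : Ordinal.{u}} {s : BinTree Ordinal.{u} X} (hs : s ∈ lsTrees (κ + β) P) :
    cut κ s ∈ lsTrees κ (lsTrees β P) := by
  induction s with
  | leaf x => exact hs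
  | node b s t ih₁ ih₂ =>
    by_cases hb : b < κ
    · simp only [cut, if_pos hb]
      exact ⟨hb, ih₁ hs.2.1, ih₂ hs.2.2.1, fun c hc => hs.2.2.2.1 c (innerLabels_cut hc),
        fun c hc => hs.2.2.2.2 c (innerLabels_cut hc)⟩
    · simp only [cut, if_neg hb]
      exact mapLabels_sub_mem hs (innerLabels_ge hs (not_lt.1 hb))

/-- The leaf labels of a tree, from left to right. -/
def leaves : BinTree Ordinal.{u} X → List X
  | .leaf x => [x]
  | .node _ s t => leaves s ++ leaves t

theorem leaves_ne_nil (s : BinTree Ordinal.{u} X) : leaves s ≠ [] := by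
  induction s with
  | leaf x => simp [leaves]
  | node b s t ih₁ ih₂ => simp [leaves, ih₁]

theorem leaves_mem {s : BinTree Ordinal.{u} X} (hs : s ∈ lsTrees α P) : leaves s ∈ listsOf P := by
  induction s with
  | leaf x => intro y hy; rw [leaves, List.mem_singleton] at hy; exact hy ▸ hs
  | node b s t ih₁ ih₂ =>
    intro y hy
    rcases List.mem_append.1 hy with hy | hy
    · exact ih₁ hs.2.1 y hy
    · exact ih₂ hs.2.2.1 y hy

/-- With `0` as the only label, strictness to the left leaves no room for a node there. The trees
are therefore right combs, determined by their list of leaves. -/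
theorem exists_of_node_mem_lsTrees_one {b : Ordinal.{u}} {s t : BinTree Ordinal.{u} X}
    (h : BinTree.node b s t ∈ lsTrees 1 P) : b = 0 ∧ ∃ x, s = .leaf x := by
  refine ⟨lt_one_iff.1 h.1, ?_⟩
  cases s with
  | leaf x => exact ⟨x, rfl⟩
  | node c s₁ s₂ =>
    have h1 := h.2.2.2.1 c (Or.inl rfl)
    rw [lt_one_iff.1 h.2.1.1] at h1
    exact absurd h1 not_lt_zero

open List in
theorem emb_of_leaves {s t : BinTree Ordinal.{u} X} (hs : s ∈ lsTrees 1 P)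
    (ht : t ∈ lsTrees 1 P) (h : SublistForall₂ r (leaves s) (leaves t)) : Emb r s t := by
  induction t generalizing s with
  | leaf y =>
    cases s with
    | leaf x =>
      cases h with
      | cons h _ => exact .leaf h
      | cons_right h => cases h
    | node b s₁ s₂ =>
      obtain ⟨-, x, rfl⟩ := exists_of_node_mem_lsTrees_one hs
      obtain ⟨y', l, hl⟩ := List.exists_cons_of_ne_nil (leaves_ne_nil s₂)
      simp only [leaves, hl, List.cons_append, List.nil_append] at h
      cases h with
      | cons _ h => cases h
      | cons_right h => cases h
  | node c t₁ t₂ ih₁ ih₂ =>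
    obtain ⟨rfl, y, rfl⟩ := exists_of_node_mem_lsTrees_one ht
    have key := fun h => ih₂ hs ht.2.2.1 h
    cases s with
    | leaf x =>
      cases h with
      | cons h _ => exact .left (.leaf h)
      | cons_right h => exact .right (key h)
    | node b s₁ s₂ =>
      obtain ⟨rfl, x, rfl⟩ := exists_of_node_mem_lsTrees_one hs
      cases h with
      | cons h h' => exact .node le_rfl (.leaf h) (ih₂ hs.2.2.1 ht.2.2.1 h')
      | cons_right h => exact .right (key h)

end Decomposition

/-! ### Bounds for trees with labels below a power of `ω`. -/

section TreeBounds

variable {X : Type (u + 1)} {r : X → X → Prop} {P : Set X}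

theorem lsTrees_empty (α : Ordinal.{u}) : lsTrees α (∅ : Set X) = ∅ := by
  refine Set.eq_empty_iff_forall_notMem.2 fun s => ?_
  induction s with
  | leaf x => exact fun h => h
  | node b s t ih₁ ih₂ => exact fun h => ih₁ h.2.1

theorem TypeLE.lsTrees_zero {ξ : Ordinal.{u}} (h : TypeLE r P ξ) :
    TypeLE (Emb r) (lsTrees (0 : Ordinal.{u}) P) ξ := by
  by_cases hne : Nonempty X
  · refine h.comap (fun s => match s with | .leaf x => x | .node _ _ _ => Classical.choice hne)
      ?_ ?_
    · intro s hs
      cases s with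
      | leaf x => exact hs
      | node b s t => exact absurd hs.1 not_lt_zero
    · intro s hs t ht hst
      cases s with
      | leaf x =>
        cases t with
        | leaf y => exact .leaf hst
        | node b s t => exact absurd ht.1 not_lt_zero
      | node b s t => exact absurd hs.1 not_lt_zero
  · have : lsTrees (0 : Ordinal.{u}) P = ∅ := by
      have := not_nonempty_iff.1 hne
      rw [Set.eq_empty_of_isEmpty P, lsTrees_empty]
    rw [this]
    exact TypeLE.empty

theorem TypeLE.lsTrees_add {α β ξ : Ordinal.{u}} (h : TypeLE (Emb (Emb r)) (lsTrees α (lsTrees β P)) ξ) :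
    TypeLE (Emb r) (lsTrees (α + β) P) ξ :=
  h.comap (cut α) (fun _ hs => cut_mem hs) fun _ hs _ ht => emb_of_cut hs ht

open List in
theorem TypeLE.lsTrees_one {ξ : Ordinal.{u}} (h : TypeLE (SublistForall₂ r) (listsOf P) ξ) :
    TypeLE (Emb r) (lsTrees (1 : Ordinal.{u}) P) ξ :=
  h.comap leaves (fun _ hs => leaves_mem hs) fun _ hs _ ht => emb_of_leaves hs ht

/-- A bound for the type of the trees with inner labels below `ω ^ γ` in terms of a bound for the
leaf labels. -/
noncomputable def treeBound (γ ξ : Ordinal.{u}) : Ordinal.{u} :=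
  open Classical in if γ = 0 then ω ^ ω ^ (ξ + 1) else veblen γ (ξ + 1)

theorem treeBound_lt_veblen {e γ ξ η : Ordinal.{u}} (he : e < γ) (hξ : ξ < veblen γ η) :
    treeBound e ξ < veblen γ η := by
  have hγ : γ ≠ 0 := he.ne_bot
  have h1 := add_one_lt_veblen hγ hξ
  rw [treeBound]
  split_ifs with h
  · exact opow_lt_veblen hγ (opow_lt_veblen hγ h1)
  · exact veblen_lt_veblen he h1

/-- The leading powers `ω ^ e` of `β` are peeled off one at a time, each with `e < γ`. The
assumption quantifies over all `X` in `Type (u + 1)` because the leaf labels become trees, which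
live in that universe again. -/
theorem TypeLE.lsTrees_lt_veblen {γ η β : Ordinal.{u}}
    (hU : ∀ e < γ, ∀ (X : Type (u + 1)) (r : X → X → Prop) (_ : IsTrans X r) (P : Set X)
      (ξ : Ordinal.{u}), TypeLE r P ξ → TypeLE (Emb r) (lsTrees (ω ^ e) P) (treeBound e ξ))
    (hβ : β < ω ^ γ) [IsTrans X r] {ξ : Ordinal.{u}} (hP : TypeLE r P ξ) (hξ : ξ < veblen γ η) :
    ∃ ζ < veblen γ η, TypeLE (Emb r) (lsTrees β P) ζ := by
  induction β using WellFoundedLT.induction with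
  | ind β ih =>
    rcases eq_or_ne β 0 with rfl | h0
    · exact ⟨ξ, hξ, hP.lsTrees_zero⟩
    · obtain ⟨h1, h2⟩ := exists_log_rest h0
      obtain ⟨ζ, hζ, hb⟩ := ih _ h2 (h2.trans hβ)
      have he : log ω β < γ := (lt_opow_iff_log_lt one_lt_omega0 h0).1 hβ
      refine ⟨_, treeBound_lt_veblen he hζ, ?_⟩
      have h3 := (hU _ he _ (Emb r) inferInstance _ ζ hb).lsTrees_add
      rwa [h1] at h3

/-- The central bound, by induction on the avoided tree. For a leaf it is `hres`. For a node, the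
induction hypotheses bound the trees avoiding `tl` or `tr` below `veblen γ η`; so are the labels, of
type `ω ^ γ`, thanks to `γ < veblen γ η`. Lists and products of these stay below, and after
collapsing only the labels below `β` are left. -/
theorem TypeLE.lsTrees_veblen {γ η : Ordinal.{u}} (hγ : γ ≠ 0)
    (hU : ∀ e < γ, ∀ (X : Type (u + 1)) (r : X → X → Prop) (_ : IsTrans X r) (P : Set X)
      (ξ : Ordinal.{u}), TypeLE r P ξ → TypeLE (Emb r) (lsTrees (ω ^ e) P) (treeBound e ξ))
    [IsTrans X r] (hγη : γ < veblen γ η) {ξ : Ordinal.{u}} (hP : TypeLE r P ξ)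
    (hξ : ξ < veblen γ η)
    (hres : ∀ x ∈ P, ∃ ζ < veblen γ η, TypeLE (Emb r) (lsTrees (ω ^ γ) (residual r P x)) ζ) :
    TypeLE (Emb r) (lsTrees (ω ^ γ) P) (veblen γ η) := by
  refine TypeLE.of_forall fun t ht => ?_
  induction t with
  | leaf x =>
    obtain ⟨ζ, hζ, h⟩ := hres x ht
    exact ⟨ζ, hζ, h.subset residual_leaf_subset⟩
  | node β tl tr ih₁ ih₂ =>
    obtain ⟨a, ha, hl⟩ := ih₁ ht.2.1
    obtain ⟨b, hb, hr⟩ := ih₂ ht.2.2.1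
    -- The side is constant on each half, so recording it does not increase the type.
    have tag : ∀ (c : Bool) (S : Set (BinTree Ordinal.{u} X)) (ζ : Ordinal.{u}),
        TypeLE (Emb r) S ζ → TypeLE (ProdRel Eq (Emb r)) ({c} ×ˢ S) ζ := by
      intro c S ζ h
      refine h.comap Prod.snd (fun y hy => hy.2) fun y hy z hz hyz => ⟨?_, hyz⟩
      rw [hy.1, hz.1]
    have hsum := (tag true _ _ hl).union (tag false _ _ hr)
    obtain ⟨c, hc, hY⟩ := (TypeLE.Iio (ω ^ γ)).prod_lt_veblen hγ hsum (opow_lt_veblen hγ hγη)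
      (natSum_lt_veblen hγ ha hb)
    obtain ⟨d, hd, hY⟩ := hY.lists_lt_veblen hγ hc
    obtain ⟨e, he, hZ⟩ := hY.prod_lt_veblen hγ hP hd hξ
    obtain ⟨ζ, hζ, h⟩ := TypeLE.lsTrees_lt_veblen hU ht.1 hZ he
    exact ⟨ζ, hζ, h.comap (collapse r tl β) (fun s hs => collapse_mem hs.1 hs.2)
      fun s _ t _ => emb_of_collapse⟩

/-- A coarse bound that only serves for residuals. The `+ 1` in the argument of `veblen γ`
guarantees that both `γ` and `ξ` lie below the value, so that no distinction of fixed points is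
needed. -/
theorem TypeLE.lsTrees_treeBound (γ : Ordinal.{u}) : ∀ (X : Type (u + 1)) (r : X → X → Prop)
    (_ : IsTrans X r) (P : Set X) (ξ : Ordinal.{u}), TypeLE r P ξ →
      TypeLE (Emb r) (lsTrees (ω ^ γ) P) (treeBound γ ξ) := by
  induction γ using WellFoundedLT.induction with
  | ind γ ih =>
    intro X r hr P ξ hP
    rcases eq_or_ne γ 0 with rfl | hγ
    · rw [treeBound, if_pos rfl, opow_zero]
      exact hP.lists_add_one.lsTrees_one
    · rw [treeBound, if_neg hγ]
      induction ξ using WellFoundedLT.induction generalizing P with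
      | ind ξ ihξ =>
        refine TypeLE.lsTrees_veblen hγ ih ?_ hP ?_ ?_
        · exact (left_le_veblen γ 0).trans_lt (veblen_right_strictMono γ (by simp))
        · exact (lt_add_one ξ).trans_le (right_le_veblen _ _)
        · intro x hx
          obtain ⟨ζ, hζ, h⟩ := hP.exists_lt hx
          exact ⟨_, veblen_right_strictMono γ (by simpa using hζ), ihξ ζ hζ _ h⟩

end TreeBounds

/-! ### The function `G` -/

theorem omega0_opow_cnfExp_add {α : Ordinal.{u}} (h : α ≠ 0) : ω ^ cnfExp α + cnfRest α = α :=
  (exists_log_rest h).1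

theorem G_zero : G (0 : Ordinal.{u}) = 1 := by rw [G, dif_pos rfl]

theorem G_one : G (1 : Ordinal.{u}) = ω := by rw [G, dif_neg one_ne_zero, if_pos rfl]

theorem G_natCast_add_two (n : ℕ) :
    G ((n + 2 : ℕ) : Ordinal.{u}) = ω ^ ω ^ G ((n + 1 : ℕ) : Ordinal.{u}) := by
  have h : ((n + 2 : ℕ) : Ordinal.{u}).pred = ((n + 1 : ℕ) : Ordinal.{u}) := by
    rw [show n + 2 = (n + 1) + 1 from rfl, Nat.cast_succ (n + 1), pred_add_one]
  rw [G, dif_neg (by exact_mod_cast (by omega : n + 2 ≠ 0)),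
    if_neg (by exact_mod_cast (by omega : n + 2 ≠ 1)), dif_pos (natCast_lt_omega0 _), h]

theorem G_of_lt {α : Ordinal.{u}} (hα : ω ≤ α) (h0 : cnfRest α = 0)
    (h : cnfExp α < veblen (cnfExp α) 0) : G α = veblen (cnfExp α) 0 := by
  rw [G, dif_neg (omega0_pos.trans_le hα).ne', if_neg (one_lt_omega0.trans_le hα).ne',
    dif_neg hα.not_gt, if_pos ⟨h0, h⟩]

theorem G_of_not {α : Ordinal.{u}} (hα : ω ≤ α)
    (h : ¬ (cnfRest α = 0 ∧ cnfExp α < veblen (cnfExp α) 0)) :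
    G α = veblen (cnfExp α) (G (cnfRest α)) := by
  rw [G, dif_neg (omega0_pos.trans_le hα).ne', if_neg (one_lt_omega0.trans_le hα).ne',
    dif_neg hα.not_gt, if_neg h]

theorem cnfExp_ne_zero {α : Ordinal.{u}} (hα : ω ≤ α) : cnfExp α ≠ 0 :=
  (log_pos one_lt_omega0 (omega0_pos.trans_le hα).ne' hα).ne'

theorem exists_G_eq_veblen {α : Ordinal.{u}} (hα : ω ≤ α) : ∃ η, G α = veblen (cnfExp α) η := by
  by_cases h : cnfRest α = 0 ∧ cnfExp α < veblen (cnfExp α) 0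
  · exact ⟨_, G_of_lt hα h.1 h.2⟩
  · exact ⟨_, G_of_not hα h⟩

theorem one_le_G_natCast (n : ℕ) : 1 ≤ G (n : Ordinal.{u}) := by
  match n with
  | 0 => rw [Nat.cast_zero, G_zero]
  | 1 => rw [Nat.cast_one, G_one]; exact one_lt_omega0.le
  | n + 2 => rw [G_natCast_add_two]; exact Order.one_le_iff_pos.2 (opow_pos _ omega0_pos)

theorem G_natCast_lt (n : ℕ) : G (n : Ordinal.{u}) < veblen 1 0 := by
  match n with
  | 0 =>
    rw [Nat.cast_zero, G_zero]
    exact one_lt_omega0.trans (omega0_lt_veblen one_ne_zero 0)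
  | 1 =>
    rw [Nat.cast_one, G_one]
    exact omega0_lt_veblen one_ne_zero 0
  | n + 2 =>
    rw [G_natCast_add_two]
    exact opow_lt_veblen one_ne_zero (opow_lt_veblen one_ne_zero (G_natCast_lt (n + 1)))

theorem G_pos (α : Ordinal.{u}) : 0 < G α := by
  rcases lt_or_ge α ω with hα | hα
  · obtain ⟨n, rfl⟩ := lt_omega0.1 hα
    exact zero_lt_one.trans_le (one_le_G_natCast n)
  · obtain ⟨η, h⟩ := exists_G_eq_veblen hα
    rw [h]
    exact veblen_pos

theorem isSuccLimit_G {α : Ordinal.{u}} (h0 : α ≠ 0) : IsSuccLimit (G α) := by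
  rcases lt_or_ge α ω with hα | hα
  · obtain ⟨n, rfl⟩ := lt_omega0.1 hα
    match n with
    | 0 => exact absurd Nat.cast_zero h0
    | 1 => rw [Nat.cast_one, G_one]; exact isSuccLimit_omega0
    | n + 2 =>
      rw [G_natCast_add_two]
      exact isSuccLimit_omega0_opow (opow_pos _ omega0_pos).ne'
  · obtain ⟨η, h⟩ := exists_G_eq_veblen hα
    rw [h]
    exact isSuccLimit_veblen (cnfExp_ne_zero hα) η

theorem G_lt_veblen {α c : Ordinal.{u}} (hc : c ≠ 0) (hα : α < ω ^ c) : G α < veblen c 0 := by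
  induction α using WellFoundedLT.induction with
  | ind α ih =>
    rcases lt_or_ge α ω with hω | hω
    · obtain ⟨n, rfl⟩ := lt_omega0.1 hω
      exact (G_natCast_lt n).trans_le (veblen_left_monotone 0 (Order.one_le_iff_ne_zero.2 hc))
    · have h0 : α ≠ 0 := (omega0_pos.trans_le hω).ne'
      have hlt : cnfExp α < c := (lt_opow_iff_log_lt one_lt_omega0 h0).1 hα
      by_cases h : cnfRest α = 0 ∧ cnfExp α < veblen (cnfExp α) 0
      · rw [G_of_lt hω h.1 h.2]
        exact veblen_lt_veblen hlt veblen_pos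
      · rw [G_of_not hω h]
        exact veblen_lt_veblen hlt (ih _ (cnfRest_lt h0) ((cnfRest_lt h0).trans hα))

/-- The least fixed point of `φ_γ` is `φ_{γ+1}(0)`. Applied to `G (cnfRest α)`, this shows that
`φ_γ` strictly increases the bound for the leaf labels. -/
theorem lt_veblen_of_lt_veblen_add_one {γ x : Ordinal.{u}} (h : x < veblen (γ + 1) 0) :
    x < veblen γ x := by
  refine (right_le_veblen γ x).lt_of_ne fun heq => ?_
  have h1 : x ∈ Set.range (veblen (γ + 1)) := by
    rw [mem_range_veblen (by simp)]
    exact fun b hb => veblen_eq_self_of_le (Order.lt_add_one_iff.1 hb) heq.symm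
  obtain ⟨y, rfl⟩ := h1
  exact absurd (veblen_lt_veblen_iff_right.1 h) not_lt_zero

theorem G_cnfRest_lt {α : Ordinal.{u}} (h : α ≠ 0) :
    G (cnfRest α) < veblen (cnfExp α) (G (cnfRest α)) := by
  refine lt_veblen_of_lt_veblen_add_one (G_lt_veblen (by simp) ?_)
  exact (cnfRest_lt h).trans (lt_opow_succ_log_self one_lt_omega0 α)

open List in
theorem sublistForall₂_of_length_le {X : Type v} {l m : List X} (h : l.length ≤ m.length) :
    SublistForall₂ (fun _ _ => True) l m := by
  induction l generalizing m with
  | nil => exact .nil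
  | cons x l ih =>
    cases m with
    | nil => simp at h
    | cons y m => exact .cons trivial (ih (by simpa using h))

instance : IsTrans PUnit.{v + 1} (fun _ _ => True) := ⟨fun _ _ _ _ _ => trivial⟩

/-- The order type bound for trees that ascend strictly to the left. -/
theorem typeLE_lsTrees (α : Ordinal.{u}) :
    TypeLE (Emb fun _ _ => True) (lsTrees α (Set.univ : Set PUnit.{u + 2})) (G α) := by
  have hpoint : TypeLE (fun _ _ => True) (Set.univ : Set PUnit.{u + 2}) (1 : Ordinal.{u}) := by
    refine TypeLE.of_forall fun x _ => ⟨0, zero_lt_one, TypeLE.empty.subset ?_⟩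
    exact fun y hy => hy.2 trivial
  induction α using WellFoundedLT.induction with
  | ind α ih =>
    rcases lt_or_ge α ω with hω | hω
    · obtain ⟨n, rfl⟩ := lt_omega0.1 hω
      match n with
      | 0 =>
        rw [Nat.cast_zero, G_zero]
        exact hpoint.lsTrees_zero
      | 1 =>
        rw [Nat.cast_one, G_one]
        -- Combs with a single leaf label are compared by their number of leaves.
        refine (TypeLE.Iio ω).comap (fun s => ((leaves s).length : Ordinal.{u}))
          (fun _ _ => natCast_lt_omega0 _) fun s hs t ht h => emb_of_leaves hs ht ?_
        exact sublistForall₂_of_length_le (by exact_mod_cast h)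
      | n + 2 =>
        -- The summand `1` stands on the left because cutting separates the lowest label from the
        -- others. All finite bounds are below the first epsilon number, where Higman's bound needs
        -- no `+ 1`.
        rw [G_natCast_add_two, show n + 2 = 1 + (n + 1) by omega, Nat.cast_add, Nat.cast_one]
        refine ((ih _ ?_).lists_of_lt_epsilon (G_natCast_lt _)).lsTrees_one.lsTrees_add
        exact_mod_cast (by omega : n + 1 < n + 2)
    · have h0 : α ≠ 0 := (omega0_pos.trans_le hω).ne'
      have hγ := cnfExp_ne_zero hω
      have hrest := ih _ (cnfRest_lt h0)
      suffices h : TypeLE (Emb (Emb fun _ _ => True))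
          (lsTrees (ω ^ cnfExp α) (lsTrees (cnfRest α) (Set.univ : Set PUnit.{u + 2}))) (G α) by
        have h1 := h.lsTrees_add
        rwa [omega0_opow_cnfExp_add h0] at h1
      have hU := fun e (_ : e < cnfExp α) => TypeLE.lsTrees_treeBound.{u} e
      -- If the leaf labels have type at most `1`, their residuals are empty, and so are the sets of
      -- trees over them.
      have hempty : ∀ x ∈ lsTrees (cnfRest α) (Set.univ : Set PUnit.{u + 2}), ∀ ζ < (1 : Ordinal.{u}),
          TypeLE (Emb fun _ _ => True)
            (residual (Emb fun _ _ => True) (lsTrees (cnfRest α) Set.univ) x) ζ →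
          TypeLE (Emb (Emb fun _ _ => True)) (lsTrees (ω ^ cnfExp α)
            (residual (Emb fun _ _ => True) (lsTrees (cnfRest α) Set.univ) x)) (0 : Ordinal.{u}) := by
        intro x _ ζ hζ h
        rw [lt_one_iff.1 hζ] at h
        rw [h.eq_empty, lsTrees_empty]
        exact TypeLE.empty
      by_cases h : cnfRest α = 0 ∧ cnfExp α < veblen (cnfExp α) 0
      · rw [G_of_lt hω h.1 h.2]
        have hrest' := hrest
        rw [h.1, G_zero, ← h.1] at hrest'
        refine TypeLE.lsTrees_veblen hγ hU h.2 hrest' ?_ fun x hx => ?_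
        · exact one_lt_omega0.trans (omega0_lt_veblen hγ 0)
        · obtain ⟨ζ, hζ, hb⟩ := hrest'.exists_lt hx
          exact ⟨0, veblen_pos, hempty x hx ζ hζ hb⟩
      · rw [G_of_not hω h]
        refine TypeLE.lsTrees_veblen hγ hU ?_ hrest (G_cnfRest_lt h0) fun x hx => ?_
        · exact (left_le_veblen _ 0).trans_lt (veblen_right_strictMono _ (G_pos _))
        · obtain ⟨ζ, hζ, hb⟩ := hrest.exists_lt hx
          by_cases hδ : cnfRest α = 0
          · rw [hδ, G_zero] at hζ
            exact ⟨0, veblen_pos, hempty x hx ζ hζ hb⟩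
          -- As `G (cnfRest α)` is a limit, the `+ 1` in the coarse bound for the residuals does no
          -- harm.
          · refine ⟨_, ?_, TypeLE.lsTrees_treeBound.{u} (cnfExp α) _ _ inferInstance _ ζ hb⟩
            rw [treeBound, if_neg hγ]
            exact veblen_right_strictMono _ ((isSuccLimit_G hδ).add_one_lt hζ)

/-! ### Gap conditions, inductively -/

section GapRelations

variable {A : Type v} [LE A] {g : A → A → A → Prop}

/-- The embeddings of `s` into `t` with a gap condition `g` on the left neighbour in `s`, the right
neighbour in `s` and the skipped member of `t`, where `a` plays the role of the left neighbour of the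
first member of `s`. -/
inductive ChainLE (g : A → A → A → Prop) : A → List A → List A → Prop
  | nil {a : A} {t : List A} : ChainLE g a [] t
  | cons {a b d : A} {s t : List A} : b ≤ d → ChainLE g b s t → ChainLE g a (b :: s) (d :: t)
  | skip {a b d : A} {s t : List A} : g a b d → ChainLE g a (b :: s) t →
      ChainLE g a (b :: s) (d :: t)

/-- The embeddings with a gap condition that puts no restriction on initial gaps. -/
inductive GapLE (g : A → A → A → Prop) : List A → List A → Prop
  | nil {t : List A} : GapLE g [] t
  | cons {a d : A} {s t : List A} : a ≤ d → ChainLE g a s t → GapLE g (a :: s) (d :: t)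
  | skip {d : A} {s t : List A} : GapLE g s t → GapLE g s (d :: t)

/-- Positions `f` that realize an embedding with gap condition. -/
def IsGapMap (g : A → A → A → Prop) (s t : List A) (f : ℕ → ℕ) : Prop :=
  (∀ i, i + 1 < s.length → f i < f (i + 1)) ∧
  (∀ i x, s[i]? = some x → ∃ y, t[f i]? = some y ∧ x ≤ y) ∧
  ∀ i x x', s[i]? = some x → s[i + 1]? = some x' → ∀ j y, f i < j → j < f (i + 1) →
    t[j]? = some y → g x x' y

/-- The gap condition for the initial gap of `f`, relative to a left neighbour `a`. -/
def InitialGap (g : A → A → A → Prop) (a : A) (s t : List A) (f : ℕ → ℕ) : Prop :=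
  ∀ b, s[0]? = some b → ∀ j y, j < f 0 → t[j]? = some y → g a b y

theorem IsGapMap.skip {s t : List A} {f : ℕ → ℕ} (h : IsGapMap g s t f) (d : A) :
    IsGapMap g s (d :: t) (fun i => f i + 1) := by
  refine ⟨fun i hi => by simpa using h.1 i hi, fun i x hx => by simpa using h.2.1 i x hx, ?_⟩
  intro i x x' hx hx' j y h1 h2 hy
  obtain ⟨j, rfl⟩ : ∃ k, j = k + 1 := ⟨j - 1, by omega⟩
  simp only at h1 h2
  exact h.2.2 i x x' hx hx' j y (by omega) (by omega) (by simpa using hy)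

theorem IsGapMap.cons {a d : A} {s t : List A} {f : ℕ → ℕ} (h : IsGapMap g s t f)
    (hi : InitialGap g a s t f) (had : a ≤ d) :
    IsGapMap g (a :: s) (d :: t) (fun i => i.casesOn 0 fun i => f i + 1) := by
  refine ⟨fun i hi => ?_, fun i x hx => ?_, fun i x x' hx hx' j y h1 h2 hy => ?_⟩
  · cases i with
    | zero => simp
    | succ i => simpa using h.1 i (by simpa using hi)
  · cases i with
    | zero => exact ⟨d, by simp, by simp at hx; exact hx ▸ had⟩
    | succ i => simpa using h.2.1 i x (by simpa using hx)
  · cases i with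
    | zero =>
      obtain ⟨j, rfl⟩ : ∃ k, j = k + 1 := ⟨j - 1, by simp at h1; omega⟩
      simp at hx hx' hy h2
      exact hx ▸ hi x' (by simpa using hx') j y h2 hy
    | succ i =>
      simp at h1
      obtain ⟨j, rfl⟩ : ∃ k, j = k + 1 := ⟨j - 1, by omega⟩
      simp at hx hx' hy h1 h2
      exact h.2.2 i x x' hx hx' j y h1 h2 hy

theorem IsGapMap.of_skip {d : A} {s t : List A} {f : ℕ → ℕ} (h : IsGapMap g s (d :: t) f)
    (h0 : f 0 ≠ 0) : IsGapMap g s t (fun i => f i - 1) := by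
  -- On the positions of `s` all values of `f` are positive, so the truncated subtraction is exact
  -- there; other values do not matter.
  have pos : ∀ i, i < s.length → 0 < f i := by
    intro i
    induction i with
    | zero => intro _; omega
    | succ i ih => intro hi; have := h.1 i hi; omega
  have lt : ∀ i x, s[i]? = some x → i < s.length := fun i x hx => by
    by_contra hcon
    rw [List.getElem?_eq_none (by omega)] at hx
    cases hx
  refine ⟨fun i hi => ?_, fun i x hx => ?_, fun i x x' hx hx' j y h1 h2 hy => ?_⟩
  · have := h.1 i hi
    have := pos i (by omega)
    simp only
    omega
  · obtain ⟨y, hy, hxy⟩ := h.2.1 i x hx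
    obtain ⟨k, hk⟩ : ∃ k, f i = k + 1 := ⟨f i - 1, by have := pos i (lt i x hx); omega⟩
    rw [hk, List.getElem?_cons_succ] at hy
    exact ⟨y, by simpa [hk] using hy, hxy⟩
  · have h3 := pos i (lt i x hx)
    simp only at h1 h2
    exact h.2.2 i x x' hx hx' (j + 1) y (by omega) (by omega) (by simpa using hy)

theorem IsGapMap.of_cons {a d : A} {s t : List A} {f : ℕ → ℕ}
    (h : IsGapMap g (a :: s) (d :: t) f) (h0 : f 0 = 0) :
    a ≤ d ∧ IsGapMap g s t (fun i => f (i + 1) - 1) ∧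
      InitialGap g a s t (fun i => f (i + 1) - 1) := by
  have pos : ∀ i, i < s.length → 0 < f (i + 1) := by
    intro i hi
    have := h.1 i (by simpa using hi)
    omega
  have lt : ∀ i x, s[i]? = some x → i < s.length := fun i x hx => by
    by_contra hcon
    rw [List.getElem?_eq_none (by omega)] at hx
    cases hx
  refine ⟨?_, ⟨fun i hi => ?_, fun i x hx => ?_, fun i x x' hx hx' j y h1 h2 hy => ?_⟩, ?_⟩
  · obtain ⟨y, hy, hay⟩ := h.2.1 0 a (by simp)
    rw [h0, List.getElem?_cons_zero] at hy
    cases hy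
    exact hay
  · have := h.1 (i + 1) (by simpa using hi)
    have := pos i (by omega)
    simp only
    omega
  · obtain ⟨y, hy, hxy⟩ := h.2.1 (i + 1) x (by simpa using hx)
    obtain ⟨k, hk⟩ : ∃ k, f (i + 1) = k + 1 :=
      ⟨f (i + 1) - 1, by have := pos i (lt i x hx); omega⟩
    rw [hk, List.getElem?_cons_succ] at hy
    exact ⟨y, by simpa [hk] using hy, hxy⟩
  · have h3 := pos i (lt i x hx)
    simp only at h1 h2
    exact h.2.2 (i + 1) x x' (by simpa using hx) (by simpa using hx') (j + 1) y (by omega)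
      (by omega) (by simpa using hy)
  · intro b hb j y hj hy
    have h3 := pos 0 (lt 0 b hb)
    simp only at hj
    exact h.2.2 0 a b (by simp) (by simpa using hb) (j + 1) y (by omega) (by omega)
      (by simpa using hy)

theorem chainLE_iff {a : A} {s t : List A} :
    ChainLE g a s t ↔ ∃ f, IsGapMap g s t f ∧ InitialGap g a s t f := by
  constructor
  · intro h
    induction h with
    | nil => exact ⟨id, ⟨by simp, by simp, by simp⟩, by simp [InitialGap]⟩
    | cons hbd _ ih =>
      obtain ⟨f, hf, hi⟩ := ih
      exact ⟨_, hf.cons hi hbd, fun b hb j y hj => absurd hj (by simp)⟩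
    | @skip a b d s t hg _ ih =>
      obtain ⟨f, hf, hi⟩ := ih
      refine ⟨_, hf.skip d, fun b' hb' j y hj hy => ?_⟩
      cases j with
      | zero => simp at hb' hy; exact hb' ▸ hy ▸ hg
      | succ j => exact hi b' hb' j y (by simpa using hj) (by simpa using hy)
  · rintro ⟨f, hf, hi⟩
    induction t generalizing a s f with
    | nil =>
      cases s with
      | nil => exact .nil
      | cons b s => obtain ⟨y, hy, -⟩ := hf.2.1 0 b (by simp); simp at hy
    | cons d t ih =>
      cases s with
      | nil => exact .nil
      | cons b s =>
        by_cases h0 : f 0 = 0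
        · obtain ⟨h1, h2, h3⟩ := hf.of_cons h0
          exact .cons h1 (ih _ h2 h3)
        · refine .skip (hi b (by simp) 0 d (by omega) (by simp)) (ih _ (hf.of_skip h0) ?_)
          exact fun b' hb' j y hj hy => hi b' hb' (j + 1) y (by omega) (by simpa using hy)

theorem gapLE_iff {s t : List A} : GapLE g s t ↔ ∃ f, IsGapMap g s t f := by
  constructor
  · intro h
    induction h with
    | nil => exact ⟨id, by simp, by simp, by simp⟩
    | cons had h =>
      obtain ⟨f, hf, hi⟩ := chainLE_iff.1 h
      exact ⟨_, hf.cons hi had⟩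
    | skip _ ih =>
      obtain ⟨f, hf⟩ := ih
      exact ⟨_, hf.skip _⟩
  · rintro ⟨f, hf⟩
    induction t generalizing s f with
    | nil =>
      cases s with
      | nil => exact .nil
      | cons b s => obtain ⟨y, hy, -⟩ := hf.2.1 0 b (by simp); simp at hy
    | cons d t ih =>
      cases s with
      | nil => exact .nil
      | cons b s =>
        by_cases h0 : f 0 = 0
        · obtain ⟨h1, h2, h3⟩ := hf.of_cons h0
          exact .cons h1 (chainLE_iff.2 ⟨_, h2, h3⟩)
        · exact .skip (ih _ (hf.of_skip h0))

theorem IsGapMap.strictMono {s t : List A} {f : ℕ → ℕ} (h : IsGapMap g s t f) {i j : ℕ}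
    (hij : i < j) (hj : j < s.length) : f i < f j := by
  induction j with
  | zero => omega
  | succ j ih =>
    have h1 := h.1 j hj
    rcases Nat.lt_succ_iff_lt_or_eq.1 hij with hlt | rfl
    · exact (ih hlt (by omega)).trans h1
    · exact h1

theorem isGapMap_fin {s t : List A} {f : ℕ → ℕ} (h : IsGapMap g s t f) :
    ∃ F : Fin s.length → Fin t.length, (∀ i, (F i).1 = f i) ∧ StrictMono F ∧
      (∀ i, s.get i ≤ t.get (F i)) ∧
      ∀ (i : ℕ) (hi : i + 1 < s.length) (j : Fin t.length), F ⟨i, Nat.lt_of_succ_lt hi⟩ < j →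
        j < F ⟨i + 1, hi⟩ → g (s.get ⟨i, Nat.lt_of_succ_lt hi⟩) (s.get ⟨i + 1, hi⟩) (t.get j) := by
  have key : ∀ i : Fin s.length, ∃ h : f i < t.length, s[i] ≤ t[f i] := by
    intro i
    obtain ⟨y, hy, hle⟩ := h.2.1 i s[i] (by simp)
    obtain ⟨h', rfl⟩ := List.getElem?_eq_some_iff.1 hy
    exact ⟨h', hle⟩
  refine ⟨fun i => ⟨f i, (key i).1⟩, fun _ => rfl, fun i j hij => h.strictMono hij j.2,
    fun i => (key i).2, fun i hi j h1 h2 => ?_⟩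
  exact h.2.2 i _ _ (List.getElem?_eq_getElem (Nat.lt_of_succ_lt hi))
    (List.getElem?_eq_getElem hi) j _ h1 h2 (List.getElem?_eq_getElem j.2)

theorem isGapMap_of_fin {s t : List A} (F : Fin s.length → Fin t.length) (hF : StrictMono F)
    (hle : ∀ i, s.get i ≤ t.get (F i))
    (hg : ∀ (i : ℕ) (hi : i + 1 < s.length) (j : Fin t.length), F ⟨i, Nat.lt_of_succ_lt hi⟩ < j →
      j < F ⟨i + 1, hi⟩ → g (s.get ⟨i, Nat.lt_of_succ_lt hi⟩) (s.get ⟨i + 1, hi⟩) (t.get j)) :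
    ∃ f, (∀ i : Fin s.length, f i = (F i).1) ∧ IsGapMap g s t f := by
  have hf : ∀ i (hi : i < s.length),
      (fun i => if h : i < s.length then (F ⟨i, h⟩).1 else 0) i = (F ⟨i, hi⟩).1 :=
    fun i hi => dif_pos hi
  refine ⟨fun i => if h : i < s.length then (F ⟨i, h⟩).1 else 0, fun i => hf i i.2,
    fun i hi => ?_, fun i x hx => ?_, fun i x x' hx hx' j y h1 h2 hy => ?_⟩
  · rw [hf i (by omega), hf (i + 1) hi]
    exact hF (by simp)
  · obtain ⟨hi, rfl⟩ := List.getElem?_eq_some_iff.1 hx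
    exact ⟨_, by rw [hf i hi]; exact List.getElem?_eq_getElem (F ⟨i, hi⟩).2, hle ⟨i, hi⟩⟩
  · obtain ⟨hi, rfl⟩ := List.getElem?_eq_some_iff.1 hx
    obtain ⟨hi', rfl⟩ := List.getElem?_eq_some_iff.1 hx'
    obtain ⟨hj, rfl⟩ := List.getElem?_eq_some_iff.1 hy
    rw [hf i hi] at h1
    rw [hf (i + 1) hi'] at h2
    exact hg i hi' ⟨j, hj⟩ h1 h2

/-- The gap condition of `GordeevLE`. -/
def symGap (a b d : A) : Prop := a ≤ d ∨ b ≤ d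

/-- The gap condition of `WeakLE` and `StrongLE`. -/
def rightGap (_ b d : A) : Prop := b ≤ d

theorem gordeevLE_iff {s t : List A} : GordeevLE s t ↔ GapLE symGap s t := by
  rw [gapLE_iff]
  constructor
  · rintro ⟨F, h1, h2, h3⟩
    obtain ⟨f, -, hf⟩ := isGapMap_of_fin (g := symGap) F h1 h2 h3
    exact ⟨f, hf⟩
  · rintro ⟨f, hf⟩
    obtain ⟨F, -, h1, h2, h3⟩ := isGapMap_fin hf
    exact ⟨F, h1, h2, h3⟩

theorem weakLE_iff {s t : List A} : WeakLE s t ↔ GapLE rightGap s t := by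
  rw [gapLE_iff]
  constructor
  · rintro ⟨F, h1, h2, h3⟩
    obtain ⟨f, -, hf⟩ := isGapMap_of_fin (g := rightGap) F h1 h2 h3
    exact ⟨f, hf⟩
  · rintro ⟨f, hf⟩
    obtain ⟨F, -, h1, h2, h3⟩ := isGapMap_fin hf
    exact ⟨F, h1, h2, h3⟩

/-- The condition on the initial gap is the gap condition after a fictitious left neighbour, and
`rightGap` ignores which one it is. -/
theorem strongLE_iff {s t : List A} (a : A) : StrongLE s t ↔ ChainLE rightGap a s t := by
  rw [chainLE_iff]
  constructor
  · rintro ⟨F, h1, h2, h3, h4⟩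
    obtain ⟨f, hfF, hf⟩ := isGapMap_of_fin (g := rightGap) F h1 h2 h3
    refine ⟨f, hf, fun b hb j y hj hy => ?_⟩
    obtain ⟨h0, rfl⟩ := List.getElem?_eq_some_iff.1 hb
    obtain ⟨hj', rfl⟩ := List.getElem?_eq_some_iff.1 hy
    exact h4 h0 ⟨j, hj'⟩ (by rw [hfF ⟨0, h0⟩] at hj; exact hj)
  · rintro ⟨f, hf, hi⟩
    obtain ⟨F, hFf, h1, h2, h3⟩ := isGapMap_fin hf
    refine ⟨F, h1, h2, h3, fun h0 j hj => ?_⟩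
    exact hi _ (List.getElem?_eq_getElem h0) j _ (by rw [← hFf ⟨0, h0⟩]; exact hj)
      (List.getElem?_eq_getElem j.2)

theorem ChainLE.length_le {a : A} {s t : List A} (h : ChainLE g a s t) : s.length ≤ t.length := by
  induction h with
  | nil => simp
  | cons _ _ ih => simpa using ih
  | skip _ _ ih => exact ih.trans (by simp)

theorem GapLE.length_le {s t : List A} (h : GapLE g s t) : s.length ≤ t.length := by
  induction h with
  | nil => simp
  | cons _ h => simpa using h.length_le
  | skip _ ih => exact ih.trans (by simp)

theorem ChainLE.gapLE {a : A} {s t : List A} (h : ChainLE g a s t) : GapLE g s t := by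
  induction h with
  | nil => exact .nil
  | cons hbd h _ => exact .cons hbd h
  | skip _ _ ih => exact .skip ih

theorem ChainLE.forall₂ {a : A} {s t : List A} (h : ChainLE g a s t) (hl : s.length = t.length) :
    List.Forall₂ (· ≤ ·) s t := by
  induction h with
  | nil => rw [List.length_eq_zero_iff.1 hl.symm]; exact .nil
  | cons hbd _ ih => exact .cons hbd (ih (by simpa using hl))
  | skip _ h _ => have := h.length_le; simp at hl this; omega

/-- Equal lengths leave no room for skipping. Antisymmetry is thereby reduced to comparison member
by member. -/
theorem GapLE.forall₂ {s t : List A} (h : GapLE g s t) (hl : s.length = t.length) :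
    List.Forall₂ (· ≤ ·) s t := by
  induction h with
  | nil => rw [List.length_eq_zero_iff.1 hl.symm]; exact .nil
  | cons had h => exact .cons had (h.forall₂ (by simpa using hl))
  | skip h _ => have := h.length_le; simp at hl this; omega

theorem GapLE.append_right {s t : List A} (h : GapLE g s t) (u : List A) : GapLE g s (t ++ u) := by
  have key : ∀ {a s t}, ChainLE g a s t → ChainLE g a s (t ++ u) := by
    intro a s t h
    induction h with
    | nil => exact .nil
    | cons h _ ih => exact .cons h ih
    | skip h _ ih => exact .skip h ih
  induction h with
  | nil => exact .nil
  | cons h h' => exact .cons h (key h')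
  | skip _ ih => exact .skip ih

theorem GapLE.append_left {s t : List A} (h : GapLE g s t) (u : List A) : GapLE g s (u ++ t) := by
  induction u with
  | nil => exact h
  | cons d u ih => exact .skip ih

end GapRelations

/-! ### The gap relations are partial orders. -/

section GapOrders

variable {A : Type v} [PartialOrder A] {g : A → A → A → Prop}

theorem ChainLE.refl (a : A) (s : List A) : ChainLE g a s s := by
  induction s generalizing a with
  | nil => exact .nil
  | cons b s ih => exact .cons le_rfl (ih b)

theorem GapLE.refl (s : List A) : GapLE g s s := by
  cases s with
  | nil => exact .nil
  | cons b s => exact .cons le_rfl (.refl b s)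

theorem GapLE.antisymm {s t : List A} (h : GapLE g s t) (h' : GapLE g t s) : s = t := by
  have hl := le_antisymm h.length_le h'.length_le
  have h1 := h.forall₂ hl
  have h2 := h'.forall₂ hl.symm
  clear h h' hl
  induction h1 with
  | nil => rfl
  | cons hab _ ih =>
    cases h2 with
    | cons hba h2 => rw [le_antisymm hab hba, ih h2]

theorem ChainLE.trans_rightGap {a a' : A} {s t u : List A} (h : ChainLE rightGap a s t)
    (h' : ChainLE rightGap a' t u) : ChainLE rightGap a s u := by
  have head : ∀ {a b d : A} {s t : List A}, ChainLE rightGap a (b :: s) (d :: t) → b ≤ d := by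
    intro a b d s t h
    cases h with
    | cons h _ => exact h
    | skip h _ => exact h
  induction h' generalizing a s with
  | nil => cases h; exact .nil
  | cons hbd _ ih =>
    cases h with
    | nil => exact .nil
    | cons hab h => exact .cons (hab.trans hbd) (ih h)
    | skip hg h => exact .skip (le_trans hg hbd) (ih h)
  | skip hg _ ih =>
    cases s with
    | nil => exact .nil
    | cons x s => exact .skip (le_trans (head h) hg) (ih h)

/-- A member of `u` skipped by the second embedding is above one of the two neighbours in `t`, and
each neighbour is above one of the current neighbours in `s`, whether it is an image or was itself
skipped. The assumption `ha` records this for the left neighbour `a'`. -/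
theorem ChainLE.trans_symGap {a a' : A} {s t u : List A} (h : ChainLE symGap a s t)
    (h' : ChainLE symGap a' t u) (ha : ∀ b, s.head? = some b → a ≤ a' ∨ b ≤ a') :
    ChainLE symGap a s u := by
  have head : ∀ {a b d : A} {s t : List A}, ChainLE symGap a (b :: s) (d :: t) → a ≤ d ∨ b ≤ d := by
    intro a b d s t h
    cases h with
    | cons h _ => exact Or.inr h
    | skip h _ => exact h
  induction h' generalizing a s with
  | nil => cases h; exact .nil
  | @cons a' b d t u hbd _ ih =>
    cases h with
    | nil => exact .nil
    | cons hab h => exact .cons (hab.trans hbd) (ih h fun _ _ => Or.inl hab)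
    | skip hg h =>
      refine .skip (hg.imp (·.trans hbd) (·.trans hbd)) (ih h fun c hc => ?_)
      simp at hc
      exact hc ▸ hg
  | @skip a' b d t u hg _ ih =>
    cases s with
    | nil => exact .nil
    | cons x s =>
      refine .skip ?_ (ih h ha)
      rcases hg with hg | hg
      · exact (ha x rfl).imp (·.trans hg) (·.trans hg)
      · exact (head h).imp (·.trans hg) (·.trans hg)

theorem GapLE.trans_chain (hg : ∀ {a a' : A} {s t u : List A}, ChainLE g a s t →
      ChainLE g a' t u → a ≤ a' → ChainLE g a s u)
    {b : A} {s t u : List A} (h : GapLE g s t) (h' : ChainLE g b t u) : GapLE g s u := by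
  induction h' generalizing s with
  | nil => cases h; exact .nil
  | cons had h' ih =>
    cases h with
    | nil => exact .nil
    | cons hab h => exact .cons (hab.trans had) (hg h h' hab)
    | skip h => exact .skip (ih h)
  | skip _ _ ih => exact .skip (ih h)

theorem GapLE.trans (hg : ∀ {a a' : A} {s t u : List A}, ChainLE g a s t →
      ChainLE g a' t u → a ≤ a' → ChainLE g a s u)
    {s t u : List A} (h : GapLE g s t) (h' : GapLE g t u) : GapLE g s u := by
  induction h' generalizing s with
  | nil => cases h; exact .nil
  | cons had h' =>
    cases h with
    | nil => exact .nil
    | cons hab h => exact .cons (hab.trans had) (hg h h' hab)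
    | skip h => exact .skip (h.trans_chain hg h')
  | skip _ ih => exact .skip (ih h)

theorem GapLE.trans_rightGap {s t u : List A} (h : GapLE rightGap s t) (h' : GapLE rightGap t u) :
    GapLE rightGap s u :=
  h.trans (fun h h' _ => h.trans_rightGap h') h'

theorem GapLE.trans_symGap {s t u : List A} (h : GapLE symGap s t) (h' : GapLE symGap t u) :
    GapLE symGap s u :=
  h.trans (fun h h' ha => h.trans_symGap h' fun _ _ => Or.inl ha) h'

instance : IsPartialOrder (List A) (GordeevLE (A := A)) where
  refl s := gordeevLE_iff.2 (.refl s)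
  trans _ _ _ h h' := gordeevLE_iff.2 ((gordeevLE_iff.1 h).trans_symGap (gordeevLE_iff.1 h'))
  antisymm _ _ h h' := (gordeevLE_iff.1 h).antisymm (gordeevLE_iff.1 h')

instance : IsPartialOrder (List A) (WeakLE (A := A)) where
  refl s := weakLE_iff.2 (.refl s)
  trans _ _ _ h h' := weakLE_iff.2 ((weakLE_iff.1 h).trans_rightGap (weakLE_iff.1 h'))
  antisymm _ _ h h' := (weakLE_iff.1 h).antisymm (weakLE_iff.1 h')

theorem StrongLE.weakLE {s t : List A} (h : StrongLE s t) : WeakLE s t := by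
  obtain ⟨f, h1, h2, h3, -⟩ := h
  exact ⟨f, h1, h2, h3⟩

theorem WeakLE.gordeevLE {s t : List A} (h : WeakLE s t) : GordeevLE s t := by
  obtain ⟨f, h1, h2, h3⟩ := h
  exact ⟨f, h1, h2, fun i hi j hj hj' => Or.inr (h3 i hi j hj hj')⟩

instance : IsPartialOrder (List A) (StrongLE (A := A)) where
  refl s := by
    cases s with
    | nil => exact ⟨Fin.elim0, fun i => i.elim0, fun i => i.elim0, by simp, by simp⟩
    | cons a s => exact (strongLE_iff a).2 (.refl a _)
  trans s t u h h' := by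
    cases s with
    | nil => exact ⟨fun i => i.elim0, fun i => i.elim0, fun i => i.elim0, by simp, by simp⟩
    | cons a s =>
      exact (strongLE_iff a).2 (((strongLE_iff a).1 h).trans_rightGap ((strongLE_iff a).1 h'))
  antisymm _ _ h h' := antisymm (r := WeakLE) h.weakLE h'.weakLE

end GapOrders

/-! ### Concatenation of embeddings with the one-sided gap condition. -/

section Concatenation

variable {A : Type v} [PartialOrder A]

theorem ChainLE.congr_left {a a' : A} {s t : List A} (h : ChainLE rightGap a s t) :
    ChainLE rightGap a' s t := by
  induction h generalizing a' with
  | nil => exact .nil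
  | cons h h' _ => exact .cons h h'
  | skip h _ ih => exact .skip h ih

/-- The gap before the image of the head of `q` is enlarged by the unused end of `p'`; `hgap` covers
exactly these members. -/
theorem ChainLE.append {a : A} {p p' q q' : List A} (hp : ChainLE rightGap a p p')
    (hq : ChainLE rightGap a q q') (hgap : ∀ b, q.head? = some b → ∀ d ∈ p', b ≤ d) :
    ChainLE rightGap a (p ++ q) (p' ++ q') := by
  induction hp with
  | @nil a p' =>
    cases q with
    | nil => exact .nil
    | cons b q =>
      induction p' with
      | nil => exact hq
      | cons d p' ih =>
        exact .skip (hgap b rfl d (by simp)) (ih fun b hb d hd => hgap b hb d (by simp [hd]))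
  | cons h _ ih =>
    exact .cons h (ih hq.congr_left fun b hb d hd => hgap b hb d (by simp [hd]))
  | skip h _ ih =>
    exact .skip h (ih hq.congr_left fun b hb d hd => hgap b hb d (by simp [hd]))

theorem GapLE.append {a : A} {p p' q q' : List A} (hp : GapLE rightGap p p')
    (hq : ChainLE rightGap a q q') (hgap : ∀ b, q.head? = some b → ∀ d ∈ p', b ≤ d) :
    GapLE rightGap (p ++ q) (p' ++ q') := by
  induction hp with
  | @nil p' => exact hq.gapLE.append_left p'
  | cons h hp =>
    exact .cons h (hp.append hq.congr_left fun b hb d hd => hgap b hb d (by simp [hd]))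
  | skip _ ih => exact .skip (ih fun b hb d hd => hgap b hb d (by simp [hd]))

theorem GapLE.chainLE {a b : A} {s t : List A} (h : GapLE rightGap (b :: s) t)
    (ht : ∀ d ∈ t, b ≤ d) : ChainLE rightGap a (b :: s) t := by
  induction t with
  | nil => cases h
  | cons d t ih =>
    cases h with
    | cons h h' => exact .cons h h'
    | skip h => exact .skip (ht d (by simp)) (ih h fun d hd => ht d (by simp [hd]))

/-- If the embedding of `s` skips an initial part of `t`, then `b` is sent to the last skipped
member instead of `c`, so that no gap follows it. -/
theorem GapLE.cons_cons {b c : A} {s t : List A} (h : GapLE rightGap s t) (hbc : b ≤ c)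
    (ht : ∀ d ∈ t, b ≤ d) : GapLE rightGap (b :: s) (c :: t) := by
  induction h generalizing c with
  | nil => exact .cons hbc .nil
  | cons had h => exact .cons hbc (.cons had h)
  | skip _ ih => exact .skip (ih (ht _ (by simp)) fun d hd => ht d (by simp [hd]))

theorem ChainLE.prepend {a : A} {s t : List A} (h : ChainLE rightGap a s t) (p : List A)
    (hp : ∀ b, t.head? = some b → ∀ d ∈ p, b ≤ d) : ChainLE rightGap a s (p ++ t) := by
  cases s with
  | nil => exact .nil
  | cons x s =>
    cases t with
    | nil => cases h
    | cons y t =>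
      have hxy : x ≤ y := by
        cases h with
        | cons h _ => exact h
        | skip h _ => exact h
      refine ChainLE.append (p := []) .nil h fun b hb d hd => ?_
      simp at hb
      exact hb ▸ hxy.trans (hp y rfl d hd)

theorem ChainLE.append_right {a : A} {s t : List A} (h : ChainLE rightGap a s t) (u : List A) :
    ChainLE rightGap a s (t ++ u) := by
  simpa using h.append (q := []) (q' := u) .nil (by simp)

end Concatenation

/-! ### Sequences as trees -/

/-- The inner labels of a tree in the order from left to right. -/
def inorder {A X : Type*} : BinTree A X → List A
  | .leaf _ => []
  | .node b s t => inorder s ++ b :: inorder t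

theorem mem_inorder {A X : Type*} {s : BinTree A X} {c : A} :
    c ∈ inorder s ↔ c ∈ s.innerLabels := by
  induction s with
  | leaf x => simp [inorder, BinTree.innerLabels]
  | node b s t ih₁ ih₂ =>
    simp only [inorder, BinTree.innerLabels, List.mem_append, List.mem_cons, ih₁, ih₂,
      Set.mem_union, Set.mem_singleton_iff]
    tauto

open Classical in
/-- Add a new label on the left of all others. -/
noncomputable def insertLeft (a : Ordinal.{u}) :
    BinTree Ordinal.{u} PUnit.{v + 1} → BinTree Ordinal.{u} PUnit.{v + 1}
  | .leaf x => .node a (.leaf x) (.leaf x)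
  | .node b s t => if a ≤ b then .node a (.leaf PUnit.unit) (.node b s t)
      else .node b (insertLeft a s) t

theorem inorder_insertLeft (a : Ordinal.{u}) (s : BinTree Ordinal.{u} PUnit.{v + 1}) :
    inorder (insertLeft a s) = a :: inorder s := by
  induction s with
  | leaf x => rfl
  | node b s t ih₁ _ =>
    by_cases h : a ≤ b
    · simp [insertLeft, if_pos h, inorder]
    · simp [insertLeft, if_neg h, inorder, ih₁]

theorem insertLeft_mem {α a : Ordinal.{u}} (ha : a < α) {s : BinTree Ordinal.{u} PUnit.{v + 1}}
    (hs : s ∈ lsTrees α Set.univ) : insertLeft a s ∈ lsTrees α Set.univ := by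
  induction s with
  | leaf x => exact ⟨ha, hs, hs, by simp [BinTree.innerLabels], by simp [BinTree.innerLabels]⟩
  | node b s t ih₁ _ =>
    by_cases h : a ≤ b
    · simp only [insertLeft, if_pos h]
      refine ⟨ha, Set.mem_univ _, hs, by simp [BinTree.innerLabels], ?_⟩
      exact innerLabels_ge hs h
    · simp only [insertLeft, if_neg h]
      refine ⟨hs.1, ih₁ hs.2.1, hs.2.2.1, fun c hc => ?_, hs.2.2.2.2⟩
      rw [← mem_inorder, inorder_insertLeft, List.mem_cons] at hc
      rcases hc with rfl | hc
      · exact not_le.1 h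
      · exact hs.2.2.2.1 c (mem_inorder.1 hc)

/-- The tree that has the members of a sequence as its labels. -/
noncomputable def treeOf (s : List Ordinal.{u}) : BinTree Ordinal.{u} PUnit.{v + 1} :=
  s.foldr insertLeft (.leaf PUnit.unit)

theorem inorder_treeOf (s : List Ordinal.{u}) : inorder (treeOf.{u, v} s) = s := by
  induction s with
  | nil => rfl
  | cons a s ih => rw [treeOf, List.foldr_cons, inorder_insertLeft]; exact congrArg _ ih

theorem treeOf_mem {α : Ordinal.{u}} {s : List Ordinal.{u}} (hs : s ∈ listsOf (Set.Iio α)) :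
    treeOf.{u, v} s ∈ lsTrees α Set.univ := by
  induction s with
  | nil => exact Set.mem_univ (PUnit.unit : PUnit.{v + 1})
  | cons a s ih => exact insertLeft_mem (hs a (by simp)) (ih fun x hx => hs x (by simp [hx]))

/-- At a matched node, what is skipped between the images of `inorder s₁` and of the root label `b`
belongs to `t₁`, to the root or to `t₂`. Ascending labels make all of it at least `b`.
`GapLE.cons_cons` avoids a gap after `b`. -/
theorem Emb.gapLE_inorder {X : Type v} {r : X → X → Prop} {α : Ordinal.{u}} {P : Set X}
    {s t : BinTree Ordinal.{u} X} (h : Emb r s t) (ht : t ∈ lsTrees α P) :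
    GapLE rightGap (inorder s) (inorder t) := by
  induction h with
  | leaf _ => exact .nil
  | left _ ih => exact (ih ht.2.1).append_right _
  | right _ ih => exact (GapLE.skip (ih ht.2.2.1)).append_left _
  | @node b c s₁ s₂ t₁ t₂ hbc _ _ ih₁ ih₂ =>
    have h₂ : ∀ d ∈ inorder t₂, b ≤ d := fun d hd => hbc.trans (ht.2.2.2.2 d (mem_inorder.1 hd))
    have h₁ : ∀ d ∈ inorder t₁, b ≤ d :=
      fun d hd => hbc.trans (ht.2.2.2.1 d (mem_inorder.1 hd)).le
    have h := (ih₂ ht.2.2.1).cons_cons hbc h₂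
    refine (ih₁ ht.2.1).append (h.chainLE (a := b) fun d hd => ?_) fun x hx => ?_
    · rcases List.mem_cons.1 hd with rfl | hd
      · exact hbc
      · exact h₂ d hd
    · simp at hx
      exact hx ▸ h₁

theorem typeLE_weakLE (α : Ordinal.{u}) :
    TypeLE (WeakLE (A := Ordinal.{u})) (listsOf (Set.Iio α)) (G α) := by
  refine (typeLE_lsTrees α).comap treeOf (fun s hs => treeOf_mem hs) fun s _ t ht h => ?_
  have h1 := h.gapLE_inorder (treeOf_mem ht)
  rw [inorder_treeOf, inorder_treeOf] at h1
  exact weakLE_iff.2 h1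

/-! ### Sequences with the strong gap condition -/

open Classical in
/-- Divide a sequence at its left-to-right minima; record the minima and the blocks. -/
noncomputable def blocks : List Ordinal.{u} → List (Ordinal.{u} × List Ordinal.{u})
  | [] => []
  | b :: s => (b, b :: s.takeWhile (b ≤ ·)) :: blocks (s.dropWhile (b ≤ ·))
termination_by s => s.length
decreasing_by
  simp only [List.length_cons]
  exact Nat.lt_succ_of_le (List.length_dropWhile_le _ _)

open Classical in
theorem blocks_cons (b : Ordinal.{u}) (s : List Ordinal.{u}) :
    blocks (b :: s) = (b, b :: s.takeWhile (b ≤ ·)) :: blocks (s.dropWhile (b ≤ ·)) := by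
  rw [blocks]

open Classical in
theorem head?_dropWhile_lt {b x : Ordinal.{u}} {s : List Ordinal.{u}}
    (h : (s.dropWhile (b ≤ ·)).head? = some x) : x < b := by
  have := List.head?_dropWhile_not (fun y => decide (b ≤ y)) s
  rw [h] at this
  simpa using this

open Classical in
theorem takeWhile_ge {b : Ordinal.{u}} {s : List Ordinal.{u}} :
    ∀ x ∈ s.takeWhile (b ≤ ·), b ≤ x := fun x hx => by
  simpa using List.mem_takeWhile_imp hx

open List in
-- With `b ≤ c`, a weak embedding of the block of `b` into the block of `c` is strong, as all
-- members of the target are at least `b`. Later blocks of `s` start below `b`, so the unused end of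
-- the target may be skipped; whole skipped blocks of `t` lie above the start of the next block.
theorem strongLE_of_blocks {s t : List Ordinal.{u}}
    (h : SublistForall₂ (ProdRel (· ≤ ·) WeakLE) (blocks s) (blocks t)) : StrongLE s t := by
  classical
  rw [strongLE_iff 0]
  induction hn : t.length using Nat.strong_induction_on generalizing s t with
  | _ n ih =>
  subst hn
  cases s with
  | nil => exact .nil
  | cons b s =>
    cases t with
    | nil => rw [blocks_cons, blocks] at h; cases h
    | cons c t =>
      have hlen : (t.dropWhile (c ≤ ·)).length < (c :: t).length := by
        simp only [List.length_cons]
        exact Nat.lt_succ_of_le (List.length_dropWhile_le _ _)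
      have hc : ∀ d ∈ c :: t.takeWhile (c ≤ ·), c ≤ d := by
        intro d hd
        rcases List.mem_cons.1 hd with rfl | hd
        · exact le_rfl
        · exact takeWhile_ge d hd
      have ht : c :: t = (c :: t.takeWhile (c ≤ ·)) ++ t.dropWhile (c ≤ ·) := by
        rw [List.cons_append, List.takeWhile_append_dropWhile]
      rw [blocks_cons c t] at h
      rw [ht]
      by_cases hskip : SublistForall₂ (ProdRel (· ≤ ·) WeakLE) (blocks (b :: s))
          (blocks (t.dropWhile (c ≤ ·)))
      · refine (ih _ hlen hskip rfl).prepend _ fun x hx d hd => ?_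
        exact (head?_dropWhile_lt hx).le.trans (hc d hd)
      · rw [blocks_cons] at h hskip
        have hs : b :: s = (b :: s.takeWhile (b ≤ ·)) ++ s.dropWhile (b ≤ ·) := by
          rw [List.cons_append, List.takeWhile_append_dropWhile]
        rw [hs]
        cases h with
        | cons_right h => exact absurd h hskip
        | cons h h' =>
          have hbc : b ≤ c := h.1
          have hw := weakLE_iff.1 h.2
          refine (hw.chainLE fun d hd => hbc.trans (hc d hd)).append (ih _ hlen h' rfl) ?_
          exact fun x hx d hd => (head?_dropWhile_lt hx).le.trans (hbc.trans (hc d hd))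

theorem blocks_mem {κ α : Ordinal.{u}} {s t : List Ordinal.{u}} (hs : s ∈ listsOf (Set.Iio α))
    (hκ : ∀ x, s.head? = some x → x < κ) (hn : ¬ WeakLE t s) :
    blocks s ∈ listsOf (Set.Iio κ ×ˢ residual WeakLE (listsOf (Set.Iio α)) t) := by
  classical
  induction hl : s.length using Nat.strong_induction_on generalizing s with
  | _ n ih =>
  subst hl
  cases s with
  | nil => rw [blocks]; exact fun x hx => absurd hx (by simp)
  | cons b s =>
    have hb := hκ b rfl
    have hsplit := (List.takeWhile_append_dropWhile (p := fun x => decide (b ≤ x)) (l := s))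
    rw [blocks_cons]
    intro p hp
    rcases List.mem_cons.1 hp with rfl | hp
    · refine ⟨hb, fun x hx => ?_, fun h => hn ?_⟩
      · rcases List.mem_cons.1 hx with rfl | hx
        · exact hs _ (by simp)
        · exact hs x (List.mem_cons_of_mem _ (List.takeWhile_subset _ hx))
      · have h1 := (weakLE_iff.1 h).append_right (s.dropWhile (b ≤ ·))
        rw [List.cons_append, hsplit] at h1
        exact weakLE_iff.2 h1
    · refine ih _ ?_ ?_ ?_ ?_ rfl p hp
      · simp only [List.length_cons]
        exact Nat.lt_succ_of_le (List.length_dropWhile_le _ _)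
      · exact fun x hx => hs x (List.mem_cons_of_mem _ (List.dropWhile_subset _ hx))
      · exact fun x hx => (head?_dropWhile_lt hx).trans hb
      · intro h
        have h1 := (weakLE_iff.1 h).append_left (b :: s.takeWhile (b ≤ ·))
        rw [List.cons_append, hsplit] at h1
        exact hn (weakLE_iff.2 h1)

/-- The sequences with members below `α` whose first member, if any, is below `β`. -/
def headLT (α β : Ordinal.{u}) : Set (List Ordinal.{u}) :=
  {s ∈ listsOf (Set.Iio α) | ∀ x, s.head? = some x → x < β}

/-- If `t` is avoided in the weak order, then so it is by every block, since weak embeddings extend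
to both sides. The block minima are below `ω ^ γ`, so products and lists stay below `veblen γ η`. -/
theorem exists_typeLE_strongLE_avoiding {α γ η : Ordinal.{u}} (hγ : γ ≠ 0)
    (hw : TypeLE (WeakLE (A := Ordinal.{u})) (listsOf (Set.Iio α)) (veblen γ η))
    (hγη : γ < veblen γ η) {t : List Ordinal.{u}} (ht : t ∈ listsOf (Set.Iio α)) :
    ∃ ζ < veblen γ η, TypeLE StrongLE {s ∈ headLT α (ω ^ γ) | ¬ WeakLE t s} ζ := by
  obtain ⟨a, ha, hres⟩ := hw.exists_lt ht
  obtain ⟨b, hb, h1⟩ := (TypeLE.Iio (ω ^ γ)).prod_lt_veblen hγ hres (opow_lt_veblen hγ hγη) ha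
  obtain ⟨c, hc, h2⟩ := h1.lists_lt_veblen hγ hb
  exact ⟨c, hc, h2.comap blocks (fun s hs => blocks_mem hs.1.1 hs.1.2 hs.2)
    fun s _ u _ h => strongLE_of_blocks h⟩

open Classical in
theorem strongLE_of_split {b : Ordinal.{u}} {s t : List Ordinal.{u}}
    (h : ProdRel StrongLE StrongLE (s.takeWhile (b ≤ ·), s.dropWhile (b ≤ ·))
      (t.takeWhile (b ≤ ·), t.dropWhile (b ≤ ·))) : StrongLE s t := by
  rw [← List.takeWhile_append_dropWhile (p := fun x => decide (b ≤ x)) (l := s),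
    ← List.takeWhile_append_dropWhile (p := fun x => decide (b ≤ x)) (l := t), strongLE_iff 0]
  refine ((strongLE_iff 0).1 h.1).append ((strongLE_iff 0).1 h.2) fun x hx d hd => ?_
  exact (head?_dropWhile_lt hx).le.trans (takeWhile_ge d hd)

theorem typeLE_headLT_zero (α : Ordinal.{u}) :
    TypeLE StrongLE (headLT α 0) (1 : Ordinal.{u}) := by
  refine TypeLE.of_forall fun s hs => ⟨0, zero_lt_one, ?_⟩
  cases s with
  | nil =>
    refine TypeLE.empty.subset fun t ht => ht.2 ?_
    exact (strongLE_iff 0).2 .nil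
  | cons a s => exact absurd (hs.2 a rfl) not_lt_zero

/-- A sequence that starts with `0` satisfies the condition on the initial gap for free, so weak
embeddings of it are strong. -/
theorem typeLE_headLT_one {α θ : Ordinal.{u}}
    (hw : TypeLE (WeakLE (A := Ordinal.{u})) (listsOf (Set.Iio α)) θ) :
    TypeLE StrongLE (headLT α 1) θ := by
  refine hw.comap id (fun s hs => hs.1) fun s hs t _ h => ?_
  rw [strongLE_iff 0]
  cases s with
  | nil => exact .nil
  | cons a s =>
    refine (weakLE_iff.1 h).chainLE fun d _ => ?_
    rw [lt_one_iff.1 (hs.2 a rfl)]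
    exact zero_le

/-- To avoid `t` with head `b`, split `s` where it first drops below `b`. The initial part has
members at least `b` and therefore avoids `t` even weakly, which bounds its type by some `ζ < veblen
γ η`; the rest has its head below `b`. Each increase of `β` by one thus costs one factor `veblen γ
η`. -/
theorem typeLE_headLT {α γ η : Ordinal.{u}} (hγ : γ ≠ 0)
    (hw : TypeLE (WeakLE (A := Ordinal.{u})) (listsOf (Set.Iio α)) (veblen γ η))
    (hγη : γ < veblen γ η) {β : Ordinal.{u}} (hβ : β ≤ ω ^ γ) :
    TypeLE StrongLE (headLT α β) (veblen γ η ^ β) := by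
  classical
  induction β using WellFoundedLT.induction with
  | ind β ih =>
    refine TypeLE.of_forall fun t ht => ?_
    cases t with
    | nil =>
      refine ⟨0, opow_pos _ veblen_pos, TypeLE.empty.subset fun s hs => hs.2 ?_⟩
      exact (strongLE_iff 0).2 .nil
    | cons b t =>
      have hb : b < β := ht.2 b rfl
      obtain ⟨ζ, hζ, hR⟩ := exists_typeLE_strongLE_avoiding hγ hw hγη ht.1
      have hQ := ih b hb (hb.le.trans hβ)
      have hpow : ∀ c, veblen γ η ^ c = ω ^ (ω ^ veblen γ η * c) := fun c => by
        rw [opow_mul, opow_veblen hγ, opow_veblen hγ]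
      rw [hpow] at hQ
      have hprod := (hR.mono (right_le_opow _ one_lt_omega0)).prod_opow hQ
      have hζ' : ζ < ω ^ veblen γ η := by rwa [opow_veblen hγ]
      refine ⟨_, ?_, hprod.comap (fun s => (s.takeWhile (b ≤ ·), s.dropWhile (b ≤ ·))) ?_
        fun s _ u _ h => strongLE_of_split h⟩
      · rw [hpow, opow_lt_opow_iff_right one_lt_omega0]
        calc natSum ζ (ω ^ veblen γ η * b) ≤ ω ^ veblen γ η * b + ζ := natSum_mul_le hζ'
          _ < ω ^ veblen γ η * b + ω ^ veblen γ η := add_lt_add_right hζ' _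
          _ = ω ^ veblen γ η * (b + 1) := (mul_add_one _ _).symm
          _ ≤ _ := mul_le_mul_right (Order.add_one_le_of_lt hb) _
      · rintro s ⟨hs, hn⟩
        have hsplit := (List.takeWhile_append_dropWhile (p := fun x => decide (b ≤ x)) (l := s))
        refine ⟨⟨⟨fun x hx => hs.1 x (List.takeWhile_subset _ hx), fun x hx => ?_⟩, fun h => ?_⟩,
          fun x hx => hs.1 x (List.dropWhile_subset _ hx), fun x hx => head?_dropWhile_lt hx⟩
        · refine (hs.2 x ?_).trans_le hβ
          cases s with
          | nil => simp at hx
          | cons y s =>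
            by_cases hy : b ≤ y
            · simpa [hy] using hx
            · simp [hy] at hx
        · refine hn ((strongLE_iff 0).2 ?_)
          rw [← hsplit]
          exact ((weakLE_iff.1 h).chainLE takeWhile_ge).append_right _

/-- Split a sequence where it first drops below `κ`: the initial part is a shifted sequence over
`δ`, the rest starts below `κ`. -/
theorem typeLE_strongLE_add {κ δ : Ordinal.{u}} {h e : Ordinal.{u}}
    (hδ : TypeLE (StrongLE (A := Ordinal.{u})) (listsOf (Set.Iio δ)) (ω ^ h))
    (hκ : TypeLE StrongLE (headLT (κ + δ) κ) (ω ^ e)) :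
    TypeLE (StrongLE (A := Ordinal.{u})) (listsOf (Set.Iio (κ + δ))) (ω ^ natSum h e) := by
  classical
  have hδ' : TypeLE StrongLE {s ∈ listsOf (Set.Iio (κ + δ)) | ∀ x ∈ s, κ ≤ x} (ω ^ h) := by
    refine hδ.comap (List.map (· - κ)) ?_ ?_
    · rintro s ⟨hs, hs'⟩ x hx
      obtain ⟨y, hy, rfl⟩ := List.mem_map.1 hx
      change y - κ < δ
      rw [← add_lt_add_iff_left κ, Ordinal.add_sub_cancel_of_le (hs' y hy)]
      exact hs y hy
    · rintro s ⟨-, hs⟩ t ⟨-, ht⟩ h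
      have key : ∀ x y : Ordinal.{u}, κ ≤ x → κ ≤ y → x - κ ≤ y - κ → x ≤ y := by
        intro b c hb hc hbc
        rw [← Ordinal.add_sub_cancel_of_le hb, ← Ordinal.add_sub_cancel_of_le hc]
        exact add_le_add_right hbc κ
      rw [strongLE_iff 0] at h ⊢
      generalize (0 : Ordinal.{u}) = a at h ⊢
      induction t generalizing s a with
      | nil => cases s with
        | nil => exact .nil
        | cons x s => cases h
      | cons y t ih =>
        have ht' : ∀ x ∈ t, κ ≤ x := fun x hx => ht x (by simp [hx])
        cases s with
        | nil => exact .nil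
        | cons x s =>
          have ih' := fun b h => ih (x :: s) hs ht' b h
          cases h with
          | cons h h' =>
            refine .cons (key _ _ (hs x (by simp)) (ht y (by simp)) h) ?_
            exact ih s (fun z hz => hs z (by simp [hz])) ht' _ h'.congr_left
          | skip h h' =>
            exact .skip (key _ _ (hs x (by simp)) (ht y (by simp)) h) (ih' _ h')
  refine (hδ'.prod_opow hκ).comap (fun s => (s.takeWhile (κ ≤ ·), s.dropWhile (κ ≤ ·)))
    (fun s hs => ?_) fun s _ u _ h => strongLE_of_split h
  exact ⟨⟨fun x hx => hs x (List.takeWhile_subset _ hx), takeWhile_ge⟩,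
    fun x hx => hs x (List.dropWhile_subset _ hx), fun x hx => head?_dropWhile_lt hx⟩

/-! ### The function `H` -/

theorem H_zero : H (0 : Ordinal.{u}) = 1 := by rw [H, dif_pos rfl]

theorem H_of_ne_zero {α : Ordinal.{u}} (h : α ≠ 0) :
    H α = G α ^ (ω ^ cnfExp α) * H (cnfRest α) := by rw [H, dif_neg h]

theorem cnfExp_natCast (n : ℕ) : cnfExp (n : Ordinal.{u}) = 0 :=
  log_eq_zero (natCast_lt_omega0 n)

theorem cnfRest_natCast_add_one (n : ℕ) : cnfRest ((n + 1 : ℕ) : Ordinal.{u}) = n := by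
  have h := omega0_opow_cnfExp_add (α := ((n + 1 : ℕ) : Ordinal.{u}))
    (by exact_mod_cast Nat.succ_ne_zero n)
  rw [cnfExp_natCast, opow_zero, add_comm n 1, Nat.cast_add, Nat.cast_one] at h
  rw [add_comm n 1, Nat.cast_add, Nat.cast_one]
  exact (add_right_inj _).1 h

theorem H_natCast_add_one (n : ℕ) :
    H ((n + 1 : ℕ) : Ordinal.{u}) = G ((n + 1 : ℕ) : Ordinal.{u}) * H (n : Ordinal.{u}) := by
  rw [H_of_ne_zero (by exact_mod_cast Nat.succ_ne_zero n), cnfExp_natCast,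
    cnfRest_natCast_add_one, opow_zero, opow_one]

theorem add_lt_omega0_opow {a b c : Ordinal.{u}} (ha : a < ω ^ c) (hb : b < ω ^ c) :
    a + b < ω ^ c :=
  isPrincipal_add_omega0_opow c ha hb

/-- The inequality `h < ω ^ g` is the premise of `natSum_mul_le` under which the natural product in
the bound for `H` becomes an ordinary one. The infinite case is `exists_opow_cnfRest`. -/
theorem exists_GH_natCast (n : ℕ) : ∃ g h : Ordinal.{u}, G ((n + 1 : ℕ) : Ordinal.{u}) = ω ^ ω ^ g ∧
    g < G ((n + 1 : ℕ) : Ordinal.{u}) ∧ H (n : Ordinal.{u}) = ω ^ h ∧ h < ω ^ g := by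
  induction n with
  | zero =>
    refine ⟨0, 0, ?_, ?_, ?_, ?_⟩
    · rw [zero_add, Nat.cast_one, G_one, opow_zero, opow_one]
    · exact G_pos _
    · rw [Nat.cast_zero, H_zero, opow_zero]
    · rw [opow_zero]; exact zero_lt_one
  | succ n ih =>
    obtain ⟨g, h, h1, h2, h3, h4⟩ := ih
    have hlt : ω ^ g < ω ^ G ((n + 1 : ℕ) : Ordinal.{u}) :=
      (opow_lt_opow_iff_right one_lt_omega0).2 h2
    refine ⟨G ((n + 1 : ℕ) : Ordinal.{u}), ω ^ g + h, G_natCast_add_two n, ?_, ?_, ?_⟩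
    · rw [G_natCast_add_two]
      nth_rewrite 1 [h1]
      exact (opow_lt_opow_iff_right one_lt_omega0).2 hlt
    · rw [H_natCast_add_one, h1, h3, opow_add]
    · exact add_lt_omega0_opow hlt (h4.trans hlt)

theorem exists_G_eq_opow (α : Ordinal.{u}) : ∃ g : Ordinal.{u}, G α = ω ^ g := by
  rcases lt_or_ge α ω with hα | hα
  · obtain ⟨n, rfl⟩ := lt_omega0.1 hα
    cases n with
    | zero => exact ⟨0, by rw [Nat.cast_zero, G_zero, opow_zero]⟩
    | succ n =>
      obtain ⟨g, -, h, -⟩ := exists_GH_natCast.{u} n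
      exact ⟨_, h⟩
  · obtain ⟨η, h⟩ := exists_G_eq_veblen hα
    exact ⟨veblen (cnfExp α) η, by rw [h, opow_veblen (cnfExp_ne_zero hα)]⟩

theorem exists_H_eq_opow (α : Ordinal.{u}) : ∃ h : Ordinal.{u}, H α = ω ^ h := by
  induction α using WellFoundedLT.induction with
  | ind α ih =>
    rcases eq_or_ne α 0 with rfl | h0
    · exact ⟨0, by rw [H_zero, opow_zero]⟩
    · obtain ⟨g, hg⟩ := exists_G_eq_opow α
      obtain ⟨h, hh⟩ := ih _ (cnfRest_lt h0)
      exact ⟨g * ω ^ cnfExp α + h, by rw [H_of_ne_zero h0, hg, hh, opow_add, opow_mul]⟩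

theorem add_lt_veblen {γ η a b : Ordinal.{u}} (ha : a < veblen γ η)
    (hb : b < veblen γ η) : a + b < veblen γ η := by
  rcases eq_or_ne γ 0 with rfl | hγ
  · rw [veblen_zero_apply] at *
    exact add_lt_omega0_opow ha hb
  · rw [← opow_veblen hγ] at *
    exact add_lt_omega0_opow ha hb

theorem mul_lt_veblen {γ η a b : Ordinal.{u}} (hγ : γ ≠ 0) (ha : a < veblen γ η)
    (hb : b < veblen γ η) : a * b < veblen γ η := by
  refine lt_of_le_of_lt ?_ (opow_lt_veblen hγ (add_lt_veblen ha hb))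
  rw [opow_add]
  exact mul_le_mul' (right_le_opow a one_lt_omega0) (right_le_opow b one_lt_omega0)

theorem opow_lt_veblen' {γ η a b : Ordinal.{u}} (hγ : γ ≠ 0) (ha : a < veblen γ η)
    (hb : b < veblen γ η) : a ^ b < veblen γ η := by
  refine lt_of_le_of_lt ?_ (opow_lt_veblen hγ (mul_lt_veblen hγ ha hb))
  rw [opow_mul]
  exact opow_le_opow_left b (right_le_opow a one_lt_omega0)

theorem G_cnfRest_le {α : Ordinal.{u}} (h : α ≠ 0) : G (cnfRest α) ≤ G α := by
  rcases lt_or_ge α ω with hα | hα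
  · obtain ⟨n, rfl⟩ := lt_omega0.1 hα
    match n with
    | 0 => exact absurd Nat.cast_zero h
    | 1 =>
      rw [cnfRest_natCast_add_one, Nat.cast_zero, G_zero]
      exact Order.one_le_iff_pos.2 (G_pos _)
    | n + 2 =>
      rw [cnfRest_natCast_add_one (n + 1), G_natCast_add_two]
      exact (right_le_opow _ one_lt_omega0).trans (right_le_opow _ one_lt_omega0)
  · by_cases hc : cnfRest α = 0 ∧ cnfExp α < veblen (cnfExp α) 0
    · rw [hc.1, G_zero]
      exact Order.one_le_iff_pos.2 (G_pos _)
    · rw [G_of_not hα hc]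
      exact right_le_veblen _ _

theorem H_lt_veblen {γ η β : Ordinal.{u}} (hγ : γ ≠ 0) (hβ : β < veblen γ η)
    (hG : G β < veblen γ η) : H β < veblen γ η := by
  induction β using WellFoundedLT.induction with
  | ind β ih =>
    rcases eq_or_ne β 0 with rfl | h0
    · rw [H_zero, ← G_zero]
      exact hG
    · rw [H_of_ne_zero h0]
      refine mul_lt_veblen hγ (opow_lt_veblen' hγ hG (opow_lt_veblen hγ ?_))
        (ih _ (cnfRest_lt h0) ((cnfRest_lt h0).trans hβ) ((G_cnfRest_le h0).trans_lt hG))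
      exact (log_le_self _ _).trans_lt hβ

theorem exists_G_eq_veblen_lt {α : Ordinal.{u}} (hα : ω ≤ α) : ∃ η, G α = veblen (cnfExp α) η ∧
    cnfExp α < veblen (cnfExp α) η ∧ G (cnfRest α) < veblen (cnfExp α) η := by
  have h0 : α ≠ 0 := (omega0_pos.trans_le hα).ne'
  by_cases h : cnfRest α = 0 ∧ cnfExp α < veblen (cnfExp α) 0
  · refine ⟨_, G_of_lt hα h.1 h.2, h.2, ?_⟩
    rw [h.1, G_zero]
    exact one_lt_omega0.trans (omega0_lt_veblen (cnfExp_ne_zero hα) _)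
  · refine ⟨_, G_of_not hα h, ?_, G_cnfRest_lt h0⟩
    exact (left_le_veblen _ 0).trans_lt (veblen_right_strictMono _ (G_pos _))

theorem exists_opow_cnfRest {α γ η : Ordinal.{u}} (h0 : α ≠ 0) (hγ : γ ≠ 0) (hα : cnfExp α = γ)
    (h : γ < veblen γ η) (hG : G (cnfRest α) < veblen γ η) :
    ∃ h : Ordinal.{u}, H (cnfRest α) = ω ^ h ∧ h < ω ^ veblen γ η := by
  obtain ⟨e, he⟩ := exists_H_eq_opow (cnfRest α)
  refine ⟨e, he, (right_le_opow e one_lt_omega0).trans_lt ?_⟩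
  rw [opow_veblen hγ, ← he]
  refine H_lt_veblen hγ ?_ hG
  refine ((cnfRest_lt h0).trans (lt_opow_succ_log_self one_lt_omega0 α)).trans
    (opow_lt_veblen hγ ?_)
  exact (isSuccLimit_veblen hγ η).succ_lt (hα ▸ h)

theorem typeLE_strongLE (α : Ordinal.{u}) :
    TypeLE (StrongLE (A := Ordinal.{u})) (listsOf (Set.Iio α)) (H α) := by
  induction α using WellFoundedLT.induction with
  | ind α ih =>
    rcases eq_or_ne α 0 with rfl | h0
    · rw [H_zero]
      refine (typeLE_headLT_zero 0).subset fun s hs => ⟨hs, fun x hx => hs x ?_⟩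
      exact List.mem_of_mem_head? hx
    · have hrest := ih _ (cnfRest_lt h0)
      have key : ∀ g h : Ordinal.{u}, H (cnfRest α) = ω ^ h → h < ω ^ g →
          TypeLE StrongLE (headLT α (ω ^ cnfExp α)) (ω ^ (ω ^ g * ω ^ cnfExp α)) →
          TypeLE (StrongLE (A := Ordinal.{u})) (listsOf (Set.Iio α))
            ((ω ^ ω ^ g) ^ (ω ^ cnfExp α) * ω ^ h) := by
        intro g h hH hlt hκ
        have h1 := omega0_opow_cnfExp_add h0
        rw [hH] at hrest
        nth_rewrite 1 [← h1] at hκ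
        have h2 := typeLE_strongLE_add hrest hκ
        rw [h1] at h2
        refine h2.mono ?_
        rw [← opow_mul ω (ω ^ g), ← opow_add ω (ω ^ g * ω ^ cnfExp α)]
        exact opow_le_opow_right omega0_pos (natSum_mul_le hlt)
      rw [H_of_ne_zero h0]
      rcases lt_or_ge α ω with hα | hα
      · obtain ⟨n, rfl⟩ := lt_omega0.1 hα
        cases n with
        | zero => exact absurd Nat.cast_zero h0
        | succ n =>
          obtain ⟨g, h, h1, h2, h3, h4⟩ := exists_GH_natCast.{u} n
          rw [← cnfRest_natCast_add_one] at h3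
          have := key g h h3 h4 (by
            rw [cnfExp_natCast, opow_zero, mul_one, ← h1]
            exact typeLE_headLT_one (typeLE_weakLE _))
          rwa [← h1, ← h3] at this
      · obtain ⟨η, h1, h2, h3⟩ := exists_G_eq_veblen_lt hα
        have hγ := cnfExp_ne_zero hα
        obtain ⟨h, h4, h5⟩ := exists_opow_cnfRest h0 hγ rfl h2 h3
        have := key _ h h4 h5 (by
          have hw := typeLE_weakLE α
          rw [h1] at hw
          have := typeLE_headLT hγ hw h2 le_rfl
          rw [opow_mul, opow_veblen hγ, opow_veblen hγ]
          exact this)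
        rwa [← h4, opow_veblen hγ, opow_veblen hγ, ← h1] at this

/-! ### The function `F` -/

theorem cnfExp_omega0_mul {α : Ordinal.{u}} (h : α ≠ 0) : cnfExp (ω * α) = 1 + cnfExp α := by
  have := log_opow_mul_add (u := 1) (w := 0) one_lt_omega0 h (opow_pos _ omega0_pos)
  rwa [opow_one, add_zero] at this

theorem cnfRest_omega0_mul {α : Ordinal.{u}} (h : α ≠ 0) : cnfRest (ω * α) = ω * cnfRest α := by
  have := cnfExp_omega0_mul h
  rw [cnfExp] at this
  rw [cnfRest, this, opow_add, opow_one, ← mul_sub]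
  rfl

theorem one_add_lt_veblen_iff (γ : Ordinal.{u}) :
    1 + γ < veblen (1 + γ) 0 ↔ γ < veblen γ 0 := by
  rcases lt_or_ge γ ω with hγ | hγ
  · obtain ⟨n, rfl⟩ := lt_omega0.1 hγ
    have h1 : ∀ n : ℕ, ((n + 1 : ℕ) : Ordinal.{u}) < veblen ((n + 1 : ℕ) : Ordinal.{u}) 0 :=
      fun n => (natCast_lt_omega0 _).trans
        (omega0_lt_veblen (by exact_mod_cast Nat.succ_ne_zero n) 0)
    have h2 := h1 n
    rw [add_comm n 1, Nat.cast_add, Nat.cast_one] at h2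
    refine iff_of_true h2 ?_
    cases n with
    | zero => rw [Nat.cast_zero, veblen_zero_apply, opow_zero]; exact zero_lt_one
    | succ n => exact h1 n
  · rw [one_add_of_omega0_le hγ]

theorem F_zero : F (0 : Ordinal.{u}) = 1 := by rw [F, dif_pos rfl]

/-- Multiplication by `ω` turns the exponent `γ` into `1 + γ` and the rest `δ` into `ω * δ`, so the
recursion for `F` becomes that for `G` on infinite arguments. Both functions have the value `1` at
`0`. -/
theorem F_eq_G {α : Ordinal.{u}} (h : α ≠ 0) : F α = G (ω * α) := by
  induction α using WellFoundedLT.induction with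
  | ind α ih =>
    have hω : ω ≤ ω * α := le_mul_left _ (pos_iff_ne_zero.2 h)
    have hrest : F (cnfRest α) = G (ω * cnfRest α) := by
      by_cases h0 : cnfRest α = 0
      · rw [h0, mul_zero, F_zero, G_zero]
      · exact ih _ (cnfRest_lt h) h0
    have hiff : (cnfRest (ω * α) = 0 ∧ cnfExp (ω * α) < veblen (cnfExp (ω * α)) 0) ↔
        (cnfRest α = 0 ∧ cnfExp α < veblen (cnfExp α) 0) := by
      rw [cnfExp_omega0_mul h, cnfRest_omega0_mul h, one_add_lt_veblen_iff]
      simp [omega0_ne_zero]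
    by_cases hc : cnfRest α = 0 ∧ cnfExp α < veblen (cnfExp α) 0
    · have hc' := hiff.2 hc
      rw [G_of_lt hω hc'.1 hc'.2, F, dif_neg h, if_pos hc, cnfExp_omega0_mul h]
    · rw [G_of_not hω (mt hiff.1 hc), F, dif_neg h, if_neg hc, cnfExp_omega0_mul h,
        cnfRest_omega0_mul h, hrest]

/-- The trees with inner labels below `α` that ascend weakly. -/
def ascTrees {X : Type v} (α : Ordinal.{u}) : Set (BinTree Ordinal.{u} X)
  | .leaf _ => True
  | .node b l r => b < α ∧ ascTrees α l ∧ ascTrees α r ∧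
      (∀ c ∈ l.innerLabels, b ≤ c) ∧ (∀ c ∈ r.innerLabels, b ≤ c)

/-- Replace labels `b` by labels in the interval `[ω * b, ω * (b + 1))`, in such a way that they
become strictly ascending on left subtrees. -/
noncomputable def spread {X : Type v} (m : Ordinal.{u}) : BinTree Ordinal.{u} X → BinTree Ordinal.{u} X
  | .leaf x => .leaf x
  | .node b s t => .node (max m (ω * b)) (spread (max m (ω * b) + 1) s) (spread (max m (ω * b)) t)

/-- The lower bound `m` grows by one at each left turn. It remains below the limit `ω * (c + 1)` for
all labels `c` still to come, so division by `ω` recovers the original labels. -/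
theorem mapLabels_spread {X : Type v} {α m : Ordinal.{u}} {s : BinTree Ordinal.{u} X}
    (hs : s ∈ ascTrees α) (hm : ∀ c ∈ s.innerLabels, m < ω * (c + 1)) :
    mapLabels (· / ω) (spread m s) = s ∧ spread m s ∈ lsTrees (ω * α) Set.univ ∧
      ∀ c ∈ (spread m s).innerLabels, m ≤ c := by
  induction s generalizing m with
  | leaf x => exact ⟨rfl, Set.mem_univ x, fun c hc => hc.elim⟩
  | node b s t ih₁ ih₂ =>
    have hb : max m (ω * b) < ω * (b + 1) := by
      refine max_lt (hm b (Or.inl rfl)) ?_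
      exact (mul_lt_mul_iff_right₀ omega0_pos).2 (lt_add_one b)
    have hb' : max m (ω * b) + 1 < ω * (b + 1) := by
      rw [mul_add_one] at hb ⊢
      exact (isSuccLimit_add _ isSuccLimit_omega0).add_one_lt hb
    have hmono : ∀ c, b ≤ c → ω * (b + 1) ≤ ω * (c + 1) := fun c hc =>
      mul_le_mul_right (add_le_add_left hc 1) _
    obtain ⟨h1, h2, h3⟩ := ih₁ hs.2.1 fun c hc => hb'.trans_le (hmono c (hs.2.2.2.1 c hc))
    obtain ⟨h4, h5, h6⟩ := ih₂ hs.2.2.1 fun c hc => hb.trans_le (hmono c (hs.2.2.2.2 c hc))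
    have hdiv : max m (ω * b) / ω = b := by
      refine le_antisymm (Order.lt_add_one_iff.1 ?_) ?_
      · exact (lt_mul_iff_div_lt omega0_ne_zero).1 hb
      · exact (mul_le_iff_le_div omega0_ne_zero).1 (le_max_right _ _)
    refine ⟨?_, ⟨?_, h2, h5, fun c hc => ?_, h6⟩, fun c hc => ?_⟩
    · rw [spread, mapLabels, h1, h4, hdiv]
    · exact hb.trans_le (mul_le_mul_right (Order.add_one_le_of_lt hs.1) _)
    · exact (lt_add_one _).trans_le (h3 c hc)
    · rcases hc with rfl | hc | hc
      · exact le_max_left _ _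
      · exact (le_max_left _ _).trans ((lt_add_one _).le.trans (h3 c hc))
      · exact (le_max_left _ _).trans (h6 c hc)

theorem Emb.mapLabels {X : Type v} {r : X → X → Prop} {f : Ordinal.{u} → Ordinal.{u}}
    (hf : Monotone f) {s t : BinTree Ordinal.{u} X} (h : Emb r s t) :
    Emb r (mapLabels f s) (mapLabels f t) := by
  induction h with
  | leaf h => exact .leaf h
  | left _ ih => exact .left ih
  | right _ ih => exact .right ih
  | node h _ _ ih₁ ih₂ => exact .node (hf h) ih₁ ih₂

theorem typeLE_ascTrees (α : Ordinal.{u}) :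
    TypeLE (Emb fun _ _ => True) (ascTrees α : Set (BinTree Ordinal.{u} PUnit.{u + 2})) (F α) := by
  rcases eq_or_ne α 0 with rfl | h0
  · rw [F_zero, ← G_zero]
    refine (typeLE_lsTrees 0).subset fun s hs => ?_
    cases s with
    | leaf x => exact Set.mem_univ x
    | node b s t => exact absurd hs.1 not_lt_zero
  · rw [F_eq_G h0]
    have hm : ∀ s : BinTree Ordinal.{u} PUnit.{u + 2}, ∀ c ∈ s.innerLabels,
        (0 : Ordinal.{u}) < ω * (c + 1) :=
      fun _ c _ => mul_pos omega0_pos (by simp)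
    refine (typeLE_lsTrees (ω * α)).comap (spread 0)
      (fun s hs => (mapLabels_spread hs (hm s)).2.1) fun s hs t ht h => ?_
    have := h.mapLabels (f := (· / ω)) fun a b hab =>
      (mul_le_iff_le_div omega0_ne_zero).1 ((mul_div_le _ _).trans hab)
    rwa [(mapLabels_spread hs (hm s)).1, (mapLabels_spread ht (hm t)).1] at this

/-! ### Transfer to the well order of an ordinal -/

section Transfer

variable {α : Ordinal.{u}}

/-- The ordinal that corresponds to an element of the well order of `α`. -/
noncomputable def val (x : α.ToType) : Ordinal.{u} := (ToType.mk.symm x).1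

theorem val_lt (x : α.ToType) : val x < α := (ToType.mk.symm x).2

theorem val_le_val {x y : α.ToType} : val x ≤ val y ↔ x ≤ y :=
  Subtype.coe_le_coe.trans ToType.mk.symm.le_iff_le

theorem val_lt_val {x y : α.ToType} : val x < val y ↔ x < y :=
  Subtype.coe_lt_coe.trans ToType.mk.symm.lt_iff_lt

theorem exists_val_eq {a : Ordinal.{u}} (h : a < α) : ∃ x : α.ToType, val x = a :=
  ⟨ToType.mk ⟨a, h⟩, by simp [val]⟩

theorem map_val_mem (s : List α.ToType) : s.map val ∈ listsOf (Set.Iio α) := by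
  intro x hx
  obtain ⟨y, -, rfl⟩ := List.mem_map.1 hx
  exact val_lt y

theorem exists_map_val_eq {s : List Ordinal.{u}} (h : s ∈ listsOf (Set.Iio α)) :
    ∃ t : List α.ToType, t.map val = s := by
  induction s with
  | nil => exact ⟨[], rfl⟩
  | cons a s ih =>
    obtain ⟨t, ht⟩ := ih fun x hx => h x (by simp [hx])
    obtain ⟨x, hx⟩ := exists_val_eq (h a (by simp))
    exact ⟨x :: t, by simp [hx, ht]⟩

variable {A B : Type*} [PartialOrder A] [PartialOrder B]

theorem chainLE_map {g : A → A → A → Prop} {g' : B → B → B → Prop} {f : A → B}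
    (hf : ∀ x y, f x ≤ f y ↔ x ≤ y) (hg : ∀ a b c, g' (f a) (f b) (f c) ↔ g a b c)
    {a : A} {s t : List A} : ChainLE g' (f a) (s.map f) (t.map f) ↔ ChainLE g a s t := by
  induction t generalizing s a with
  | nil =>
    cases s with
    | nil => exact iff_of_true .nil .nil
    | cons x s => exact iff_of_false (fun h => by cases h) fun h => by cases h
  | cons y t ih =>
    cases s with
    | nil => exact iff_of_true .nil .nil
    | cons x s =>
      have ih' := ih (s := x :: s) (a := a)
      constructor
      · rintro (_ | ⟨h, h'⟩ | ⟨h, h'⟩)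
        · exact .cons ((hf _ _).1 h) (ih.1 h')
        · exact .skip ((hg _ _ _).1 h) (ih'.1 h')
      · rintro (_ | ⟨h, h'⟩ | ⟨h, h'⟩)
        · exact .cons ((hf _ _).2 h) (ih.2 h')
        · exact .skip ((hg _ _ _).2 h) (ih'.2 h')

theorem gapLE_map {g : A → A → A → Prop} {g' : B → B → B → Prop} {f : A → B}
    (hf : ∀ x y, f x ≤ f y ↔ x ≤ y) (hg : ∀ a b c, g' (f a) (f b) (f c) ↔ g a b c)
    {s t : List A} : GapLE g' (s.map f) (t.map f) ↔ GapLE g s t := by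
  induction t generalizing s with
  | nil =>
    cases s with
    | nil => exact iff_of_true .nil .nil
    | cons x s => exact iff_of_false (fun h => by cases h) fun h => by cases h
  | cons y t ih =>
    cases s with
    | nil => exact iff_of_true .nil .nil
    | cons x s =>
      have ih' := ih (s := x :: s)
      constructor
      · rintro (_ | ⟨h, h'⟩ | h')
        · exact .cons ((hf _ _).1 h) ((chainLE_map hf hg).1 h')
        · exact .skip (ih'.1 h')
      · rintro (_ | ⟨h, h'⟩ | h')
        · exact .cons ((hf _ _).2 h) ((chainLE_map hf hg).2 h')
        · exact .skip (ih'.2 h')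

theorem gordeevLE_map {f : A → B} (hf : ∀ x y, f x ≤ f y ↔ x ≤ y) {s t : List A} :
    GordeevLE (s.map f) (t.map f) ↔ GordeevLE s t := by
  rw [gordeevLE_iff, gordeevLE_iff]
  exact gapLE_map hf fun a b c => or_congr (hf _ _) (hf _ _)

theorem weakLE_map {f : A → B} (hf : ∀ x y, f x ≤ f y ↔ x ≤ y) {s t : List A} :
    WeakLE (s.map f) (t.map f) ↔ WeakLE s t := by
  rw [weakLE_iff, weakLE_iff]
  exact gapLE_map hf fun a b c => hf _ _

theorem strongLE_map [Nonempty A] {f : A → B} (hf : ∀ x y, f x ≤ f y ↔ x ≤ y) {s t : List A} :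
    StrongLE (s.map f) (t.map f) ↔ StrongLE s t := by
  let a : A := Classical.arbitrary A
  rw [strongLE_iff (f a), strongLE_iff a]
  exact chainLE_map hf fun a b c => hf _ _

theorem strongLE_map_val {s t : List α.ToType} :
    StrongLE (s.map val) (t.map val) ↔ StrongLE s t := by
  by_cases hα : Nonempty α.ToType
  · exact strongLE_map fun _ _ => val_le_val
  · have := not_nonempty_iff.1 hα
    cases s with
    | nil =>
      cases t with
      | nil => exact iff_of_true (refl_of StrongLE _) (refl_of StrongLE _)
      | cons a t => exact this.elim a
    | cons a s => exact this.elim a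

/-- Replace the labels of a tree by the corresponding ordinals. -/
noncomputable def valTree : BinTree α.ToType PUnit.{u + 1} → BinTree Ordinal.{u} PUnit.{v + 1}
  | .leaf _ => .leaf PUnit.unit
  | .node b s t => .node (val b) (valTree s) (valTree t)

theorem innerLabels_valTree (s : BinTree α.ToType PUnit.{u + 1}) :
    (valTree.{u, v} s).innerLabels = val '' s.innerLabels := by
  induction s with
  | leaf x => simp [valTree, BinTree.innerLabels]
  | node b s t ih₁ ih₂ =>
    simp [valTree, BinTree.innerLabels, ih₁, ih₂, Set.image_union, Set.image_insert_eq]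

theorem valTree_injective : Function.Injective (valTree.{u, v} (α := α)) := by
  intro s t h
  induction s generalizing t with
  | leaf x =>
    cases t with
    | leaf y => rfl
    | node c t₁ t₂ => exact absurd h (by simp [valTree])
  | node b s₁ s₂ ih₁ ih₂ =>
    cases t with
    | leaf y => exact absurd h (by simp [valTree])
    | node c t₁ t₂ =>
      simp only [valTree, BinTree.node.injEq] at h
      rw [ih₁ h.2.1, ih₂ h.2.2, le_antisymm (val_le_val.1 h.1.le) (val_le_val.1 h.1.ge)]

theorem emb_valTree {s t : BinTree α.ToType PUnit.{u + 1}} :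
    Emb (fun _ _ => True) (valTree.{u, v} s) (valTree.{u, v} t) ↔ s.Embeds t := by
  constructor
  · intro h
    induction t generalizing s with
    | leaf y =>
      cases s with
      | leaf x => exact .leaf le_rfl
      | node b s₁ s₂ => cases h
    | node c t₁ t₂ ih₁ ih₂ =>
      generalize hs : valTree.{u, v} s = s' at h
      rcases h with _ | h | h | ⟨h, h₁, h₂⟩
      · subst hs; exact .left (ih₁ h)
      · subst hs; exact .right (ih₂ h)
      · cases s with
        | leaf x => simp [valTree] at hs
        | node b s₁ s₂ =>
          simp only [valTree, BinTree.node.injEq] at hs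
          obtain ⟨rfl, rfl, rfl⟩ := hs
          exact .node (val_le_val.1 h) (ih₁ h₁) (ih₂ h₂)
  · intro h
    induction h with
    | leaf h => exact .leaf trivial
    | left _ ih => exact .left ih
    | right _ ih => exact .right ih
    | node h _ _ ih₁ ih₂ => exact .node (val_le_val.2 h) ih₁ ih₂

theorem valTree_mem_ascTrees {s : BinTree α.ToType PUnit.{u + 1}} (h : s.Ascending) :
    valTree.{u, v} s ∈ ascTrees α := by
  induction s with
  | leaf x => exact trivial
  | node b s t ih₁ ih₂ =>
    refine ⟨val_lt b, ih₁ h.1, ih₂ h.2.1, ?_, ?_⟩ <;> intro c hc <;>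
      rw [innerLabels_valTree] at hc <;> obtain ⟨c, hc, rfl⟩ := hc
    · exact val_le_val.2 (h.2.2.1 c hc)
    · exact val_le_val.2 (h.2.2.2 c hc)

theorem valTree_mem_lsTrees {s : BinTree α.ToType PUnit.{u + 1}} (h : s.LeftStrictAscending) :
    valTree.{u, v} s ∈ lsTrees α Set.univ := by
  induction s with
  | leaf x => exact Set.mem_univ PUnit.unit.{v + 1}
  | node b s t ih₁ ih₂ =>
    refine ⟨val_lt b, ih₁ h.1, ih₂ h.2.1, ?_, ?_⟩ <;> intro c hc <;>
      rw [innerLabels_valTree] at hc <;> obtain ⟨c, hc, rfl⟩ := hc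
    · exact val_lt_val.2 (h.2.2.1 c hc)
    · exact val_le_val.2 (h.2.2.2 c hc)

theorem exists_valTree_eq_of_mem_ascTrees {s : BinTree Ordinal.{u} PUnit.{v + 1}}
    (h : s ∈ ascTrees α) : ∃ t : BinTree α.ToType PUnit.{u + 1}, valTree t = s ∧ t.Ascending := by
  induction s with
  | leaf x => exact ⟨.leaf PUnit.unit, rfl, trivial⟩
  | node b s₁ s₂ ih₁ ih₂ =>
    obtain ⟨t₁, rfl, h₁⟩ := ih₁ h.2.1
    obtain ⟨t₂, rfl, h₂⟩ := ih₂ h.2.2.1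
    obtain ⟨b, rfl⟩ := exists_val_eq h.1
    refine ⟨.node b t₁ t₂, rfl, h₁, h₂, fun c hc => ?_, fun c hc => ?_⟩
    · refine val_le_val.1 (h.2.2.2.1 _ ?_)
      rw [innerLabels_valTree]
      exact Set.mem_image_of_mem _ hc
    · refine val_le_val.1 (h.2.2.2.2 _ ?_)
      rw [innerLabels_valTree]
      exact Set.mem_image_of_mem _ hc

theorem exists_valTree_eq_of_mem_lsTrees {s : BinTree Ordinal.{u} PUnit.{v + 1}}
    (h : s ∈ lsTrees α Set.univ) :
    ∃ t : BinTree α.ToType PUnit.{u + 1}, valTree t = s ∧ t.LeftStrictAscending := by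
  induction s with
  | leaf x => exact ⟨.leaf PUnit.unit, rfl, trivial⟩
  | node b s₁ s₂ ih₁ ih₂ =>
    obtain ⟨t₁, rfl, h₁⟩ := ih₁ h.2.1
    obtain ⟨t₂, rfl, h₂⟩ := ih₂ h.2.2.1
    obtain ⟨b, rfl⟩ := exists_val_eq h.1
    refine ⟨.node b t₁ t₂, rfl, h₁, h₂, fun c hc => ?_, fun c hc => ?_⟩
    · refine val_lt_val.1 (h.2.2.2.1 _ ?_)
      rw [innerLabels_valTree]
      exact Set.mem_image_of_mem _ hc
    · refine val_le_val.1 (h.2.2.2.2 _ ?_)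
      rw [innerLabels_valTree]
      exact Set.mem_image_of_mem _ hc

end Transfer

/-! ### The partial orders on trees -/

theorem Emb.refl {X : Type v} {r : X → X → Prop} (hr : ∀ x, r x x) (s : BinTree Ordinal.{u} X) :
    Emb r s s := by
  induction s with
  | leaf x => exact .leaf (hr x)
  | node b s t ih₁ ih₂ => exact .node le_rfl ih₁ ih₂

theorem Emb.length_inorder_le {X : Type v} {r : X → X → Prop} {s t : BinTree Ordinal.{u} X}
    (h : Emb r s t) : (inorder s).length ≤ (inorder t).length := by
  induction h with
  | leaf _ => exact le_rfl
  | left _ ih => simp only [inorder, List.length_append, List.length_cons]; omega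
  | right _ ih => simp only [inorder, List.length_append, List.length_cons]; omega
  | node _ _ _ ih₁ ih₂ => simp only [inorder, List.length_append, List.length_cons]; omega

/-- The clauses that pass to a subtree strictly increase the number of inner nodes, so mutually
embeddable trees match node by node. -/
theorem Emb.antisymm {s t : BinTree Ordinal.{u} PUnit.{v + 1}} (h : Emb (fun _ _ => True) s t)
    (h' : Emb (fun _ _ => True) t s) : s = t := by
  induction h with
  | leaf _ => rfl
  | left h _ =>
    have h1 := h.length_inorder_le
    have h2 := h'.length_inorder_le
    simp only [inorder, List.length_append, List.length_cons] at h2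
    omega
  | right h _ =>
    have h1 := h.length_inorder_le
    have h2 := h'.length_inorder_le
    simp only [inorder, List.length_append, List.length_cons] at h2
    omega
  | node hbc h₁ h₂ ih₁ ih₂ =>
    cases h' with
    | left h' =>
      have h3 := h₁.length_inorder_le
      have h4 := h'.length_inorder_le
      simp only [inorder, List.length_append, List.length_cons] at h4
      omega
    | right h' =>
      have h3 := h₂.length_inorder_le
      have h4 := h'.length_inorder_le
      simp only [inorder, List.length_append, List.length_cons] at h4
      omega
    | node hcb h₁' h₂' => rw [le_antisymm hbc hcb, ih₁ h₁', ih₂ h₂']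

/-- Relations that are reflected along an injection into trees. -/
theorem isPartialOrder_of_valTree {α : Ordinal.{u}} {X : Type u} {r : X → X → Prop}
    (e : X → BinTree α.ToType PUnit.{u + 1}) (he : Function.Injective e)
    (hr : ∀ x y, r x y ↔ (e x).Embeds (e y)) : IsPartialOrder X r where
  refl x := (hr x x).2 (emb_valTree.{u, u}.1 (Emb.refl (fun _ => trivial) _))
  trans x y z hxy hyz := (hr x z).2 <| emb_valTree.{u, u}.1 <|
    have : IsTrans PUnit.{u + 1} (fun _ _ => True) := ⟨fun _ _ _ _ _ => trivial⟩
    (emb_valTree.2 ((hr x y).1 hxy)).trans (emb_valTree.2 ((hr y z).1 hyz))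
  antisymm x y hxy hyx := he <| valTree_injective.{u, u} <|
    (emb_valTree.2 ((hr x y).1 hxy)).antisymm (emb_valTree.2 ((hr y x).1 hyx))

theorem isPartialOrder_BLE (α : Ordinal.{u}) : IsPartialOrder _ (BLE α PUnit.{u + 1}) :=
  isPartialOrder_of_valTree Subtype.val Subtype.val_injective fun _ _ => Iff.rfl

theorem isPartialOrder_BlLE (α : Ordinal.{u}) : IsPartialOrder _ (BlLE α PUnit.{u + 1}) :=
  isPartialOrder_of_valTree Subtype.val Subtype.val_injective fun _ _ => Iff.rfl

/-! ### Upper bounds -/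

theorem typeLE_BLE (α : Ordinal.{u}) : TypeLE (BLE α PUnit.{u + 1}) Set.univ (F α) :=
  (typeLE_ascTrees α).comap (fun s => valTree s.1) (fun s _ => valTree_mem_ascTrees s.2)
    fun _ _ _ _ h => emb_valTree.1 h

theorem typeLE_BlLE (α : Ordinal.{u}) : TypeLE (BlLE α PUnit.{u + 1}) Set.univ (G α) :=
  (typeLE_lsTrees α).comap (fun s => valTree s.1) (fun s _ => valTree_mem_lsTrees s.2)
    fun _ _ _ _ h => emb_valTree.1 h

theorem typeLE_SwLE (α : Ordinal.{u}) : TypeLE (SwLE α) Set.univ (G α) :=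
  (typeLE_weakLE α).comap (List.map val) (fun s _ => map_val_mem s)
    fun _ _ _ _ h => (weakLE_map fun _ _ => val_le_val).1 h

theorem typeLE_SgLE (α : Ordinal.{u}) : TypeLE (SgLE α) Set.univ (G α) :=
  (typeLE_SwLE α).comap id (fun _ _ => Set.mem_univ _) fun _ _ _ _ h => h.gordeevLE

theorem typeLE_SsLE (α : Ordinal.{u}) : TypeLE (SsLE α) Set.univ (H α) :=
  (typeLE_strongLE α).comap (List.map val) (fun s _ => map_val_mem s)
    fun _ _ _ _ h => strongLE_map_val.1 h

/-! ### Lower bounds -/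

theorem le_maxOrderType {X : Type u} {r : X → X → Prop} (hr : ∀ x, r x x) {Y : Type v}
    {s : Y → Y → Prop} (e : X → Y) (he : ∀ x y, r x y → s (e x) (e y)) {β : Ordinal.{u}}
    (f : Ordinal.{u} → Y) (hf : ∀ a < β, ∃ x, e x = f a)
    (hs : ∀ a < β, ∀ b < β, s (f a) (f b) → a ≤ b) : β ≤ maxOrderType r := by
  choose g hg using hf
  refine le_csSup (bddAbove_quasiEmbedding r hr) ⟨fun x => g (val x) (val_lt x), fun x y h => ?_⟩
  refine val_le_val.1 (hs _ (val_lt x) _ (val_lt y) ?_)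
  rw [← hg _ (val_lt x), ← hg _ (val_lt y)]
  exact he _ _ h

section LowerBounds

variable {α β : Ordinal.{u}} {f : Ordinal.{u} → List Ordinal.{u}}

theorem le_maxOrderType_SgLE (hf : ∀ a < β, f a ∈ listsOf (Set.Iio α))
    (hs : ∀ a < β, ∀ b < β, GordeevLE (f a) (f b) → a ≤ b) :
    β ≤ maxOrderType (SgLE α) :=
  le_maxOrderType (refl_of GordeevLE) (List.map val)
    (fun _ _ h => (gordeevLE_map fun _ _ => val_le_val).2 h) f
    (fun a ha => exists_map_val_eq (hf a ha)) hs

theorem le_maxOrderType_SwLE (hf : ∀ a < β, f a ∈ listsOf (Set.Iio α))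
    (hs : ∀ a < β, ∀ b < β, GordeevLE (f a) (f b) → a ≤ b) :
    β ≤ maxOrderType (SwLE α) :=
  le_maxOrderType (refl_of WeakLE) (List.map val)
    (fun _ _ h => ((weakLE_map fun _ _ => val_le_val).2 h).gordeevLE) f
    (fun a ha => exists_map_val_eq (hf a ha)) hs

theorem le_maxOrderType_SsLE (hf : ∀ a < β, f a ∈ listsOf (Set.Iio α))
    (hs : ∀ a < β, ∀ b < β, StrongLE (f a) (f b) → a ≤ b) :
    β ≤ maxOrderType (SsLE α) :=
  le_maxOrderType (refl_of StrongLE) (List.map val) (fun _ _ h => strongLE_map_val.2 h) f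
    (fun a ha => exists_map_val_eq (hf a ha)) hs

theorem le_maxOrderType_BlLE (hf : ∀ a < β, f a ∈ listsOf (Set.Iio α))
    (hs : ∀ a < β, ∀ b < β, GordeevLE (f a) (f b) → a ≤ b) :
    β ≤ maxOrderType (BlLE α PUnit.{u + 1}) := by
  refine le_maxOrderType (isPartialOrder_BlLE α).refl (fun s => valTree.{u, u} s.1)
    (fun _ _ h => emb_valTree.2 h) (fun a => treeOf (f a)) (fun a ha => ?_) fun a ha b hb h => ?_
  · obtain ⟨t, h1, h2⟩ := exists_valTree_eq_of_mem_lsTrees (treeOf_mem.{u, u} (hf a ha))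
    exact ⟨⟨t, h2⟩, h1⟩
  · have h1 := h.gapLE_inorder (treeOf_mem (hf b hb))
    rw [inorder_treeOf, inorder_treeOf] at h1
    exact hs a ha b hb (weakLE_iff.2 h1).gordeevLE

end LowerBounds

theorem le_maxOrderType_BLE {α β : Ordinal.{u}} {f : Ordinal.{u} → BinTree Ordinal.{u} PUnit.{u + 1}}
    (hf : ∀ a < β, f a ∈ ascTrees α)
    (hs : ∀ a < β, ∀ b < β, Emb (fun _ _ => True) (f a) (f b) → a ≤ b) :
    β ≤ maxOrderType (BLE α PUnit.{u + 1}) := by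
  refine le_maxOrderType (isPartialOrder_BLE α).refl (fun s => valTree.{u, u} s.1)
    (fun _ _ h => emb_valTree.2 h) f (fun a ha => ?_) hs
  obtain ⟨t, h1, h2⟩ := exists_valTree_eq_of_mem_ascTrees (hf a ha)
  exact ⟨⟨t, h2⟩, h1⟩

/-! ### Normal forms -/

/-- Take the least `e < γ` for which `κ` is not a fixed point of `Ψ e`: it is then a value of `Ψ e`,
and the argument is smaller because it is not a fixed point. -/
theorem exists_normal_form {Ψ : Ordinal.{u} → Ordinal.{u} → Ordinal.{u}}
    (hΨ : ∀ e, StrictMono (Ψ e)) {κ : Ordinal.{u}}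
    (hκ : ∀ γ, (∀ e < γ, Ψ e κ = κ) → ∃ x, Ψ γ x = κ) (γ : Ordinal.{u}) :
    (∃ x, Ψ γ x = κ) ∨ ∃ e < γ, ∃ x < κ, Ψ e x = κ := by
  by_cases h : ∀ e < γ, Ψ e κ = κ
  · exact .inl (hκ γ h)
  · push Not at h
    obtain ⟨e, ⟨he, hne⟩, hmin⟩ := WellFounded.has_min (wellFounded_lt (α := Ordinal.{u}))
      {e | e < γ ∧ Ψ e κ ≠ κ} h
    obtain ⟨x, hx⟩ := hκ e fun e' he' => by
      by_contra h'
      exact hmin e' ⟨he'.trans he, h'⟩ he'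
    refine .inr ⟨e, he, x, (hΨ e).lt_iff_lt.1 ?_, hx⟩
    rw [hx]
    exact ((hΨ e).le_apply (x := κ)).lt_of_ne hne.symm

/-- The Veblen functions with `ω ^ ω ^ x` as initial function. -/
noncomputable def psi (e x : Ordinal.{u}) : Ordinal.{u} :=
  open Classical in if e = 0 then ω ^ ω ^ x else veblen e x

theorem psi_zero (x : Ordinal.{u}) : psi 0 x = ω ^ ω ^ x := if_pos rfl

theorem psi_of_ne_zero {e : Ordinal.{u}} (he : e ≠ 0) (x : Ordinal.{u}) : psi e x = veblen e x :=
  if_neg he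

theorem psi_strictMono (e : Ordinal.{u}) : StrictMono (psi e) := by
  rcases eq_or_ne e 0 with rfl | he
  · intro x y h
    rw [psi_zero, psi_zero, opow_lt_opow_iff_right one_lt_omega0,
      opow_lt_opow_iff_right one_lt_omega0]
    exact h
  · intro x y h
    rw [psi_of_ne_zero he, psi_of_ne_zero he]
    exact veblen_right_strictMono e h

theorem veblen_le_psi (e x : Ordinal.{u}) : veblen e x ≤ psi e x := by
  rcases eq_or_ne e 0 with rfl | he
  · rw [psi_zero, veblen_zero_apply]
    exact opow_le_opow_right omega0_pos (right_le_opow _ one_lt_omega0)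
  · rw [psi_of_ne_zero he]

theorem exists_psi_eq_opow (e x : Ordinal.{u}) : ∃ a : Ordinal.{u}, psi e x = ω ^ ω ^ a := by
  rcases eq_or_ne e 0 with rfl | he
  · exact ⟨x, psi_zero x⟩
  · exact ⟨veblen e x, by rw [psi_of_ne_zero he, opow_veblen he, opow_veblen he]⟩

theorem psi_psi_of_lt {e γ : Ordinal.{u}} (h : e < γ) (x : Ordinal.{u}) :
    psi e (psi γ x) = psi γ x := by
  have hγ : γ ≠ 0 := h.ne_bot
  rw [psi_of_ne_zero hγ]
  rcases eq_or_ne e 0 with rfl | he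
  · rw [psi_zero, opow_veblen hγ, opow_veblen hγ]
  · rw [psi_of_ne_zero he, veblen_veblen_of_lt h]

theorem exists_psi_normal_form (γ a : Ordinal.{u}) :
    (∃ x, psi γ x = ω ^ ω ^ a) ∨ ∃ e < γ, ∃ x < ω ^ ω ^ a, psi e x = ω ^ ω ^ a := by
  refine exists_normal_form psi_strictMono (fun γ h => ?_) γ
  rcases eq_or_ne γ 0 with rfl | hγ
  · exact ⟨a, psi_zero a⟩
  · have h1 : ω ^ ω ^ a ∈ Set.range (veblen γ) := by
      rw [mem_range_veblen hγ]
      intro e he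
      exact le_antisymm ((veblen_le_psi _ _).trans (h e he).le) (right_le_veblen _ _)
    obtain ⟨x, hx⟩ := h1
    exact ⟨x, by rw [psi_of_ne_zero hγ, hx]⟩

theorem isSuccLimit_psi (e x : Ordinal.{u}) : IsSuccLimit (psi e x) := by
  obtain ⟨a, h⟩ := exists_psi_eq_opow e x
  rw [h]
  exact isSuccLimit_omega0_opow (opow_pos _ omega0_pos).ne'

theorem mul_lt_psi {e x a b : Ordinal.{u}} (ha : a < psi e x) (hb : b < psi e x) :
    a * b < psi e x := by
  obtain ⟨c, h⟩ := exists_psi_eq_opow e x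
  rw [h] at ha hb ⊢
  exact isPrincipal_mul_omega0_opow_opow c ha hb

theorem exists_opow_mul_add_one {x : Ordinal.{u}} (h : x ≠ 0) : ∃ b m : Ordinal.{u}, x = ω ^ b * (m + 1) := by
  induction x using WellFoundedLT.induction with
  | ind x ih =>
    have h1 := omega0_opow_cnfExp_add h
    by_cases h0 : cnfRest x = 0
    · rw [h0, add_zero] at h1
      exact ⟨cnfExp x, 0, by rw [zero_add, mul_one, h1]⟩
    · obtain ⟨b, m, h2⟩ := ih _ (cnfRest_lt h) h0
      have hb : b ≤ cnfExp x := by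
        rw [← Order.lt_add_one_iff]
        refine (opow_lt_opow_iff_right one_lt_omega0).1 (lt_of_le_of_lt ?_
          ((cnfRest_lt h).trans (lt_opow_succ_log_self one_lt_omega0 x)))
        rw [h2]
        exact le_mul_left _ (by simp)
      refine ⟨b, ω ^ (cnfExp x - b) + m, ?_⟩
      rw [add_assoc, mul_add, ← h2, ← opow_add, Ordinal.add_sub_cancel_of_le hb, h1]

/-- The case of a limit that is not closed under multiplication. -/
theorem exists_mul_of_limit {x : Ordinal.{u}} (h0 : x ≠ 0) (hs : ∀ y, x ≠ y + 1)
    (hp : ∀ a : Ordinal.{u}, x ≠ ω ^ ω ^ a) :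
    ∃ a y : Ordinal.{u}, x = ω ^ ω ^ a * y ∧ ω ^ ω ^ a < x ∧ y < x := by
  obtain ⟨b, m, rfl⟩ := exists_opow_mul_add_one h0
  have hb : b ≠ 0 := fun hb => hs m (by rw [hb, opow_zero, one_mul])
  have hexp := omega0_opow_cnfExp_add hb
  have hmul : ω ^ b * (m + 1) = ω ^ ω ^ cnfExp b * (ω ^ cnfRest b * (m + 1)) := by
    rw [← mul_assoc, ← opow_add, hexp]
  refine ⟨cnfExp b, ω ^ cnfRest b * (m + 1), hmul, ?_, ?_⟩
  · rw [hmul]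
    refine lt_of_le_of_ne (le_mul_left _ (mul_pos (opow_pos _ omega0_pos) (by simp))) fun h => ?_
    exact hp _ (hmul.trans h.symm)
  -- Strictness survives multiplication on the right because the right factor is a successor; this
  -- is why `x` was written with `m + 1`.
  · rw [mul_add_one, mul_add_one]
    have hlt := (opow_lt_opow_iff_right one_lt_omega0).2 (cnfRest_lt hb)
    exact add_lt_add_of_le_of_lt (mul_le_mul_left hlt.le m) hlt

/-- The ordinal `φ_Γ(1)` is the supremum of the ordinals `φ_c(Γ + 1)` for `c < Γ`. -/
theorem exists_lt_veblen_add_one {γ ζ : Ordinal.{u}} (hγ : veblen γ 0 = γ) (hζ : ζ < veblen γ 1) :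
    ∃ c < γ, ζ < veblen c (γ + 1) := by
  by_contra! hcon
  have hγ0 : γ ≠ 0 := by
    rintro rfl
    rw [veblen_zero_apply, opow_zero] at hγ
    exact one_ne_zero hγ
  have hlim : IsSuccLimit γ := by
    rw [← hγ]
    exact isSuccLimit_veblen hγ0 0
  -- The least upper bound `s` of the values `φ_c(γ + 1)` is fixed by all `φ_e` with `e < γ`. Hence
  -- `s = φ_γ(y)`, and `s > γ = φ_γ(0)` forces `y ≥ 1`.
  obtain ⟨s, hs, hmin⟩ := WellFounded.has_min (wellFounded_lt (α := Ordinal.{u}))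
    {s | ∀ c < γ, veblen c (γ + 1) ≤ s} ⟨ζ, hcon⟩
  have hlt : ∀ e < γ, ∀ a < s, ∃ c < γ, e < c ∧ a < veblen c (γ + 1) := by
    intro e he a ha
    by_contra! h
    refine hmin a (fun c hc => ?_) ha
    have hc' : max c (e + 1) < γ := max_lt hc (hlim.add_one_lt he)
    exact (veblen_left_monotone _ (le_max_left c (e + 1))).trans
      (h _ hc' ((lt_add_one e).trans_le (le_max_right _ _)))
  have hpos : (0 : Ordinal.{u}) < γ := pos_iff_ne_zero.2 hγ0
  have hslim : IsSuccLimit s := by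
    refine ⟨?_, ?_⟩
    · rw [isMin_iff_eq_bot]
      exact (veblen_pos.trans_le (hs 0 hpos)).ne'
    · refine Order.isSuccPrelimit_of_succ_lt fun a ha => ?_
      obtain ⟨c, hc, h1, h2⟩ := hlt 0 hpos a ha
      exact (add_one_lt_veblen h1.ne' h2).trans_le (hs c hc)
  have hfix : ∀ e < γ, veblen e s = s := by
    intro e he
    refine le_antisymm (((isNormal_veblen e).le_iff_forall_le hslim).2 fun a ha => ?_)
      (right_le_veblen _ _)
    obtain ⟨c, hc, h1, h2⟩ := hlt e he a ha
    exact (veblen_lt_veblen h1 h2).le.trans (hs c hc)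
  obtain ⟨y, hy⟩ := (mem_range_veblen hγ0).2 hfix
  have h1 : γ < s := (lt_add_one γ).trans_le ((right_le_veblen 0 _).trans (hs 0 hpos))
  rw [← hy] at h1
  nth_rewrite 1 [← hγ] at h1
  have h2 : 1 ≤ y := Order.one_le_iff_pos.2 (veblen_lt_veblen_iff_right.1 h1)
  have h3 : veblen γ 1 ≤ s := hy ▸ veblen_le_veblen_iff_right.2 h2
  exact (h3.trans (not_lt.1 (hmin ζ hcon))).not_gt hζ

/-! ### Sequences with a separating zero -/

/-- The separating `0` is neither the image of a positive member nor may it be skipped between two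
positive neighbours. So `s` ends before it, and if `s` exhausts `s'`, the remainder starts at the
separator. -/
theorem ChainLE.of_append_zero {a : Ordinal.{u}} {s r s' r' : List Ordinal.{u}} (ha : 0 < a)
    (hs : ∀ x ∈ s, 0 < x) (h : ChainLE symGap a (s ++ r) (s' ++ 0 :: r')) :
    ChainLE symGap a s s' ∧ (s.length = s'.length → GapLE symGap r (0 :: r')) := by
  induction s' generalizing s a with
  | nil =>
    cases s with
    | nil => exact ⟨.nil, fun _ => h.gapLE⟩
    | cons x s =>
      have hx : 0 < x := hs x (by simp)
      rcases h with _ | ⟨h, -⟩ | ⟨h | h, -⟩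
      · exact absurd h hx.not_ge
      · exact absurd h ha.not_ge
      · exact absurd h hx.not_ge
  | cons d s' ih =>
    cases s with
    | nil => exact ⟨.nil, fun h => absurd h (by simp)⟩
    | cons x s =>
      rcases h with _ | ⟨h, h'⟩ | ⟨h, h'⟩
      · obtain ⟨h1, h2⟩ := ih (hs x (by simp)) (fun y hy => hs y (by simp [hy])) h'
        exact ⟨.cons h h1, fun hl => h2 (by simpa using hl)⟩
      · obtain ⟨h1, -⟩ := ih (s := x :: s) ha hs h'
        refine ⟨.skip h h1, fun hl => ?_⟩
        have := h1.length_le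
        simp only [List.length_cons] at this hl
        omega

/-- Without a left neighbour, the embedding may also start after the separator; this is the first
alternative. -/
theorem GapLE.of_append_zero {s r s' r' : List Ordinal.{u}} (hne : s ≠ []) (hs : ∀ x ∈ s, 0 < x)
    (h : GapLE symGap (s ++ r) (s' ++ 0 :: r')) :
    GapLE symGap (s ++ r) r' ∨
      GapLE symGap s s' ∧ (s.length = s'.length → GapLE symGap r (0 :: r')) := by
  obtain ⟨x, s, rfl⟩ := List.exists_cons_of_ne_nil hne
  have hx : 0 < x := hs x (by simp)
  induction s' with
  | nil =>
    rcases h with _ | ⟨h, -⟩ | h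
    · exact absurd h hx.not_ge
    · exact .inl h
  | cons d s' ih =>
    rcases h with _ | ⟨h, h'⟩ | h
    · obtain ⟨h1, h2⟩ := h'.of_append_zero hx fun y hy => hs y (by simp [hy])
      exact .inr ⟨.cons h h1, fun hl => h2 (by simpa using hl)⟩
    · refine (ih h).imp id fun ⟨h1, _⟩ => ⟨.skip h1, fun hl => ?_⟩
      have := h1.length_le
      simp only [List.length_cons] at this hl
      omega

theorem GapLE.of_cons {A : Type v} [LE A] {g : A → A → A → Prop} {x : A} {s t : List A}
    (h : GapLE g (x :: s) t) : GapLE g s t := by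
  induction t with
  | nil => cases h
  | cons y t ih =>
    rcases h with _ | ⟨_, h⟩ | h
    · exact .skip h.gapLE
    · exact .skip (ih h)

theorem GapLE.of_cons_cons {A : Type v} [LE A] {g : A → A → A → Prop} {x y : A} {s t : List A}
    (h : GapLE g (x :: s) (y :: t)) : GapLE g s t := by
  rcases h with _ | ⟨_, h⟩ | h
  · exact h.gapLE
  · exact h.of_cons

theorem GapLE.of_append {A : Type v} [LE A] {g : A → A → A → Prop} {r s t : List A}
    (h : GapLE g (r ++ s) t) : GapLE g s t := by
  induction r with
  | nil => exact h
  | cons x r ih => exact ih h.of_cons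

theorem ChainLE.append_left_of {A : Type v} [LE A] {g : A → A → A → Prop} {a : A} {r s t : List A}
    (h : ChainLE g a (r ++ s) t) : ChainLE g a r t := by
  induction t generalizing r a with
  | nil =>
    cases r with
    | nil => exact .nil
    | cons x r => cases h
  | cons y t ih =>
    cases r with
    | nil => exact .nil
    | cons x r =>
      rcases h with _ | ⟨h, h'⟩ | ⟨h, h'⟩
      · exact .cons h (ih h')
      · exact .skip h (ih (r := x :: r) h')

theorem GapLE.append_left_of {A : Type v} [LE A] {g : A → A → A → Prop} {r s t : List A}
    (h : GapLE g (r ++ s) t) : GapLE g r t := by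
  induction t with
  | nil =>
    cases r with
    | nil => exact .nil
    | cons x r => cases h
  | cons y t ih =>
    cases r with
    | nil => exact .nil
    | cons x r =>
      rcases h with _ | ⟨h, h'⟩ | h
      · exact .cons h h'.append_left_of
      · exact .skip (ih h)

theorem ChainLE.map_add {g : Ordinal.{u} → Ordinal.{u} → Ordinal.{u} → Prop} (a c : Ordinal.{u})
    (s : List Ordinal.{u}) : ChainLE g a s (s.map (c + ·)) := by
  induction s generalizing a with
  | nil => exact .nil
  | cons x s ih => exact .cons le_add_self (ih x)

theorem GapLE.map_add {g : Ordinal.{u} → Ordinal.{u} → Ordinal.{u} → Prop} (c : Ordinal.{u})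
    (s : List Ordinal.{u}) : GapLE g s (s.map (c + ·)) := by
  cases s with
  | nil => exact .nil
  | cons x s => exact .cons le_add_self (.map_add x c s)

theorem gapLE_map_add {c : Ordinal.{u}} {s t : List Ordinal.{u}} :
    GapLE symGap (s.map (c + ·)) (t.map (c + ·)) ↔ GapLE symGap s t :=
  gapLE_map (fun _ _ => add_le_add_iff_left c)
    fun _ _ _ => or_congr (add_le_add_iff_left c) (add_le_add_iff_left c)

/-- This absorption is the counterpart of `psi e (psi c x) = psi c x` for `e < c`. -/
theorem map_add_eq_self {e c : Ordinal.{u}} (h : e < c) {s : List Ordinal.{u}}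
    (hs : ∀ x ∈ s, ω ^ c ≤ x) : s.map (ω ^ e + ·) = s :=
  (List.map_congr_left fun x hx => add_of_omega0_opow_le
    ((opow_lt_opow_iff_right one_lt_omega0).2 h) (hs x hx)).trans (List.map_id s)

/-! ### Sequences for ordinals -/

open Classical in
/-- Sequences that realize the ordinals below `psi γ θ`, given sequences `f x` for `x < θ`. -/
noncomputable def word (γ : Ordinal.{u}) (f : Ordinal.{u} → List Ordinal.{u}) (ζ : Ordinal.{u}) :
    List Ordinal.{u} :=
  if ζ = 0 then []
  else if h : ∃ η, η < ζ ∧ ζ = η + 1 then 0 :: word γ f h.choose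
  else if h : ∃ x, psi γ x = ζ then (f h.choose).map (ω ^ γ + ·)
  else if h : ∃ e x, 1 + x < ζ ∧ e < γ ∧ psi e x = ζ then
    (word γ f (1 + h.choose_spec.choose)).map (ω ^ h.choose + ·)
  else if h : ∃ a y : Ordinal.{u}, ζ = ω ^ ω ^ a * y ∧ ω ^ ω ^ a < ζ ∧ y < ζ then
    word γ f (ω ^ ω ^ h.choose) ++ 0 :: word γ f h.choose_spec.choose
  else []
termination_by ζ
decreasing_by
  · exact h.choose_spec.1
  · exact h.choose_spec.choose_spec.1
  · exact h.choose_spec.choose_spec.2.1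
  · exact h.choose_spec.choose_spec.2.2

/-- The case of an ordinal `psi e x` in the definition of `word`. -/
def IsBlock (γ θ : Ordinal.{u}) (f : Ordinal.{u} → List Ordinal.{u}) (ζ : Ordinal.{u}) : Prop :=
  ∃ e x v, ζ = psi e x ∧ word γ f ζ = v.map (ω ^ e + ·) ∧
    ((e = γ ∧ x < θ ∧ v = f x) ∨ (e < γ ∧ 1 + x < ζ ∧ v = word γ f (1 + x)))

/-! ### The words reflect the order of ordinals. -/

section Word

variable {γ θ δ ζ : Ordinal.{u}} {f : Ordinal.{u} → List Ordinal.{u}}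

theorem word_zero : word γ f 0 = [] := by rw [word, if_pos rfl]

theorem word_add_one (ζ : Ordinal.{u}) : word γ f (ζ + 1) = 0 :: word γ f ζ := by
  have h : ∃ η, η < ζ + 1 ∧ ζ + 1 = η + 1 := ⟨ζ, lt_add_one ζ, rfl⟩
  rw [word, if_neg (by simp), dif_pos h]
  congr 2
  exact (Order.add_one_inj.1 h.choose_spec.2).symm

theorem psi_ne_zero (e x : Ordinal.{u}) : psi e x ≠ 0 := (isSuccLimit_psi e x).ne_bot

theorem psi_ne_add_one (e x y : Ordinal.{u}) : psi e x ≠ y + 1 := fun h =>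
  (isSuccLimit_psi e x).add_one_lt (h ▸ lt_add_one y) |>.ne h.symm

theorem one_add_lt_psi {e x y : Ordinal.{u}} (h : x < psi e y) : 1 + x < psi e y := by
  obtain ⟨a, ha⟩ := exists_psi_eq_opow e y
  rw [ha] at h ⊢
  refine add_lt_omega0_opow (lt_of_lt_of_le one_lt_omega0 ?_) h
  nth_rewrite 1 [← opow_one ω]
  exact opow_le_opow_right omega0_pos (Order.one_le_iff_pos.2 (opow_pos _ omega0_pos))

theorem isBlock_of_opow {a : Ordinal.{u}} (h : ω ^ ω ^ a < psi γ θ) :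
    IsBlock γ θ f (ω ^ ω ^ a) := by
  obtain ⟨z, hz⟩ : ∃ z, ω ^ ω ^ a = psi 0 z := ⟨a, (psi_zero a).symm⟩
  have h0 : ω ^ ω ^ a ≠ 0 := hz ▸ psi_ne_zero 0 z
  have hs : ¬ ∃ η, η < ω ^ ω ^ a ∧ ω ^ ω ^ a = η + 1 := fun ⟨η, _, h⟩ =>
    psi_ne_add_one 0 z η (hz ▸ h)
  by_cases htop : ∃ x, psi γ x = ω ^ ω ^ a
  · refine ⟨γ, htop.choose, _, htop.choose_spec.symm, ?_, .inl ⟨rfl, ?_, rfl⟩⟩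
    · rw [word, if_neg h0, dif_neg hs, dif_pos htop]
    · rw [← (psi_strictMono γ).lt_iff_lt, htop.choose_spec]
      exact h
  · obtain ⟨e, he, x, hx, hex⟩ := (exists_psi_normal_form γ a).resolve_left htop
    have hlow : ∃ e x, 1 + x < ω ^ ω ^ a ∧ e < γ ∧ psi e x = ω ^ ω ^ a :=
      ⟨e, x, by rw [← hex] at hx ⊢; exact one_add_lt_psi hx, he, hex⟩
    have hsp := hlow.choose_spec.choose_spec
    refine ⟨hlow.choose, hlow.choose_spec.choose, _, hsp.2.2.symm, ?_, .inr ⟨hsp.2.1, hsp.1, rfl⟩⟩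
    rw [word, if_neg h0, dif_neg hs, dif_neg htop, dif_pos hlow]

theorem word_cases (h : ζ < psi γ θ) : ζ = 0 ∨ (∃ η, ζ = η + 1) ∨ IsBlock γ θ f ζ ∨
    ∃ a y : Ordinal.{u}, ζ = ω ^ ω ^ a * y ∧ ω ^ ω ^ a < ζ ∧ y < ζ ∧
      word γ f ζ = word γ f (ω ^ ω ^ a) ++ 0 :: word γ f y := by
  by_cases h0 : ζ = 0
  · exact .inl h0
  by_cases hs : ∃ η, ζ = η + 1
  · exact .inr (.inl hs)
  by_cases hp : ∃ a : Ordinal.{u}, ζ = ω ^ ω ^ a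
  · obtain ⟨a, rfl⟩ := hp
    exact .inr (.inr (.inl (isBlock_of_opow h)))
  · have hm : ∃ a y : Ordinal.{u}, ζ = ω ^ ω ^ a * y ∧ ω ^ ω ^ a < ζ ∧ y < ζ :=
      exists_mul_of_limit h0 (fun y hy => hs ⟨y, hy⟩) fun a ha => hp ⟨a, ha⟩
    have hsp := hm.choose_spec.choose_spec
    refine .inr (.inr (.inr ⟨_, _, hsp.1, hsp.2.1, hsp.2.2, ?_⟩))
    have hpsi : ∀ e x, psi e x ≠ ζ := fun e x hx => by
      obtain ⟨a, ha⟩ := exists_psi_eq_opow e x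
      exact hp ⟨a, hx.symm.trans ha⟩
    rw [word, if_neg h0, dif_neg fun ⟨η, _, h⟩ => hs ⟨η, h⟩, dif_neg fun ⟨x, h⟩ => hpsi γ x h,
      dif_neg fun ⟨e, x, _, _, h⟩ => hpsi e x h, dif_pos hm]

theorem word_ne_nil (hne : ∀ x < θ, f x ≠ []) (h : ζ < psi γ θ) (h0 : ζ ≠ 0) : word γ f ζ ≠ [] := by
  induction ζ using WellFoundedLT.induction with
  | ind ζ ih =>
    rcases word_cases (f := f) h with rfl | ⟨η, rfl⟩ | ⟨e, x, v, -, hw, hv⟩ | ⟨a, y, -, -, -, hw⟩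
    · exact absurd rfl h0
    · rw [word_add_one]; simp
    · rw [hw, Ne, List.map_eq_nil_iff]
      rcases hv with ⟨-, hx, rfl⟩ | ⟨-, hx, rfl⟩
      · exact hne x hx
      · exact ih _ hx (hx.trans h) (by simp)
    · rw [hw]; simp

theorem word_mem (hf : ∀ x < θ, ∀ y ∈ f x, y < δ) (h : ζ < psi γ θ) :
    word γ f ζ ∈ listsOf (Set.Iio (ω ^ γ + δ)) := by
  have hpos : 0 < ω ^ γ + δ := (opow_pos _ omega0_pos).trans_le le_self_add
  induction ζ using WellFoundedLT.induction with
  | ind ζ ih =>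
    rcases word_cases (f := f) h with rfl | ⟨η, rfl⟩ | ⟨e, x, v, -, hw, hv⟩ | ⟨a, y, -, ha, hy, hw⟩
    · rw [word_zero]; exact fun x hx => absurd hx (by simp)
    · rw [word_add_one]
      intro x hx
      rcases List.mem_cons.1 hx with rfl | hx
      · exact hpos
      · exact ih _ (lt_add_one η) ((lt_add_one η).trans h) x hx
    · rw [hw]
      intro z hz
      obtain ⟨y, hy, rfl⟩ := List.mem_map.1 hz
      rcases hv with ⟨rfl, hx, rfl⟩ | ⟨he, hx, rfl⟩
      · exact add_lt_add_right (hf x hx y hy) _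
      · change ω ^ e + y < ω ^ γ + δ
        rw [← add_of_omega0_opow_le ((opow_lt_opow_iff_right one_lt_omega0).2 he)
          (le_self_add : ω ^ γ ≤ ω ^ γ + δ)]
        exact add_lt_add_right (ih _ hx (hx.trans h) y hy) _
    · rw [hw]
      intro x hx
      rcases List.mem_append.1 hx with hx | hx
      · exact ih _ ha (ha.trans h) x hx
      · rcases List.mem_cons.1 hx with rfl | hx
        · exact hpos
        · exact ih _ hy (hy.trans h) x hx

theorem IsBlock.pos (hb : IsBlock γ θ f ζ) : ∀ x ∈ word γ f ζ, 0 < x := by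
  obtain ⟨e, x, v, -, hw, -⟩ := hb
  rw [hw]
  intro z hz
  obtain ⟨y, hy, rfl⟩ := List.mem_map.1 hz
  exact (opow_pos _ omega0_pos).trans_le le_self_add

/-- Comparison of Veblen terms. For `e < e'`, the unshifted word of `ζ` embeds into `word γ f ζ`,
and it suffices to bound the argument of `ζ` by `ζ'`. For `e = e'`, the common shift cancels. For `e
> e'`, the word of `ζ` absorbs the shift by `ω ^ e'`, so `ζ` is compared with the argument of `ζ'`.
-/
theorem le_of_isBlock {ζ' : Ordinal.{u}} (hb : IsBlock γ θ f ζ) (hb' : IsBlock γ θ f ζ')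
    (hf : ∀ x < θ, ∀ y < θ, GapLE symGap (f x) (f y) → x ≤ y)
    (ih' : ∀ η' < ζ', ∀ η < psi γ θ, GapLE symGap (word γ f η) (word γ f η') → η ≤ η')
    (ih : ∀ η < ζ, GapLE symGap (word γ f η) (word γ f ζ') → η ≤ ζ') (hζ : ζ < psi γ θ)
    (h : GapLE symGap (word γ f ζ) (word γ f ζ')) : ζ ≤ ζ' := by
  obtain ⟨e, x, v, hex, hw, hv⟩ := hb
  obtain ⟨e', x', v', hex', hw', hv'⟩ := hb'
  rcases lt_trichotomy e e' with hee | rfl | hee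
  · have hx : 1 + x < ζ ∧ v = word γ f (1 + x) := by
      rcases hv with ⟨rfl, -⟩ | ⟨-, hx⟩
      · rcases hv' with ⟨rfl, -⟩ | ⟨h, -⟩
        · exact absurd hee (lt_irrefl _)
        · exact absurd (hee.trans h) (lt_irrefl _)
      · exact hx
    have h1 : GapLE symGap (word γ f (1 + x)) (word γ f ζ) := by
      rw [hw, ← hx.2]
      exact .map_add _ v
    have h2 := ih _ hx.1 (h1.trans_symGap h)
    rcases h2.lt_or_eq with h2 | h2
    · rw [hex, hex', ← psi_psi_of_lt hee]
      refine (psi_strictMono e).le_iff_le.2 ?_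
      rw [← hex']
      exact le_add_self.trans h2.le
    · refine absurd hx.1 ?_
      rw [h2, hex, hex', not_lt, ← psi_psi_of_lt hee x', ← hex']
      exact (psi_strictMono e).le_iff_le.2 (h2 ▸ le_add_self)
  · rw [hw, hw', gapLE_map_add] at h
    rw [hex, hex']
    refine (psi_strictMono e).le_iff_le.2 ?_
    rcases hv with ⟨rfl, hx, rfl⟩ | ⟨he, hx, rfl⟩
    · rcases hv' with ⟨-, hx', rfl⟩ | ⟨h, -⟩
      · exact hf _ hx _ hx' h
      · exact absurd h (lt_irrefl _)
    · rcases hv' with ⟨rfl, -⟩ | ⟨-, hx', rfl⟩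
      · exact absurd he (lt_irrefl _)
      · exact (add_le_add_iff_left 1).1 (ih' _ hx' _ (hx.trans hζ) h)
  · have hx : 1 + x' < ζ' ∧ v' = word γ f (1 + x') := by
      rcases hv' with ⟨rfl, -⟩ | ⟨-, hx⟩
      · rcases hv with ⟨rfl, -⟩ | ⟨h, -⟩
        · exact absurd hee (lt_irrefl _)
        · exact absurd (hee.trans h) (lt_irrefl _)
      · exact hx
    have h1 : (word γ f ζ).map (ω ^ e' + ·) = word γ f ζ := by
      refine map_add_eq_self hee fun z hz => ?_
      rw [hw] at hz
      obtain ⟨y, -, rfl⟩ := List.mem_map.1 hz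
      exact le_self_add
    rw [hw', hx.2, ← h1, gapLE_map_add] at h
    exact (ih' _ hx.1 _ hζ h).trans hx.1.le

/-- The outer induction is on `ζ'` for all `ζ`, the inner one on `ζ`. The positive words of blocks
cannot cross a separator `0`, so embeddings split along the normal forms. -/
theorem le_of_word_le (hne : ∀ x < θ, f x ≠ [])
    (hf : ∀ x < θ, ∀ y < θ, GapLE symGap (f x) (f y) → x ≤ y) {ζ' : Ordinal.{u}}
    (hζ : ζ < psi γ θ) (hζ' : ζ' < psi γ θ) (h : GapLE symGap (word γ f ζ) (word γ f ζ')) :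
    ζ ≤ ζ' := by
  induction ζ' using WellFoundedLT.induction generalizing ζ with
  | ind ζ' ih' =>
  replace ih' := fun η' (h : η' < ζ') η hη => ih' η' h (ζ := η) hη (h.trans hζ')
  induction ζ using WellFoundedLT.induction with
  | ind ζ ih =>
  replace ih := fun η (h : η < ζ) => ih η h (h.trans hζ)
  -- Equal ordinals have equal words, so different lengths make the inequality strict.
  have ihlt : ∀ η < ζ, GapLE symGap (word γ f η) (word γ f ζ') →
      (word γ f η).length ≠ (word γ f ζ').length → η < ζ' := fun η hη h hl =>
    (ih η hη h).lt_of_ne fun he => hl (by rw [he])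
  have hz := hζ
  rcases word_cases (f := f) hζ with rfl | ⟨η, rfl⟩ | hb | ⟨a, y, hay, ha, hy, hw⟩
  · exact zero_le
  · refine Order.add_one_le_of_lt (ihlt η (lt_add_one η) ?_ ?_)
    · rw [word_add_one] at h
      exact h.of_cons
    · have := h.length_le
      rw [word_add_one, List.length_cons] at this
      omega
  · have hb0 := hb.pos
    have hbne := word_ne_nil hne hζ (fun h0 => by
      obtain ⟨e, x, v, h, -⟩ := hb
      exact psi_ne_zero e x (h.symm.trans h0))
    have h' := h
    rw [← List.append_nil (word γ f ζ)] at h'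
    rcases word_cases (f := f) hζ' with rfl | ⟨η', rfl⟩ | hb' | ⟨a', y', hay', ha', hy', hw'⟩
    · rw [word_zero] at h
      generalize word γ f ζ = s at h hbne
      cases h
      exact absurd rfl hbne
    · rw [word_add_one] at h'
      rcases GapLE.of_append_zero (s' := []) hbne hb0 h' with h' | ⟨h', -⟩
      · rw [List.append_nil] at h'
        exact (ih' η' (lt_add_one η') _ hζ h').trans (lt_add_one η').le
      · generalize word γ f ζ = s at h' hbne
        cases h'
        exact absurd rfl hbne
    · exact le_of_isBlock hb hb' hf ih' ih hζ h
    · rw [hw'] at h'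
      rcases GapLE.of_append_zero hbne hb0 h' with h' | ⟨h', -⟩
      · rw [List.append_nil] at h'
        exact (ih' _ hy' _ hζ h').trans hy'.le
      · exact (ih' _ ha' _ hζ h').trans ha'.le
  · have hκ := ha.trans hζ
    have hb : IsBlock γ θ f (ω ^ ω ^ a) := isBlock_of_opow hκ
    have hb0 := hb.pos
    have hbne := word_ne_nil hne hκ (opow_pos _ omega0_pos).ne'
    have h' := h
    rw [hw] at h'
    have hl := h.length_le
    rw [hw, List.length_append, List.length_cons] at hl
    have hy1 : GapLE symGap (word γ f y) (word γ f ζ') := h'.of_append.of_cons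
    have ha1 : GapLE symGap (word γ f (ω ^ ω ^ a)) (word γ f ζ') := h'.append_left_of
    rcases word_cases (f := f) hζ' with rfl | ⟨η', rfl⟩ | hb' | ⟨a', y', hay', ha', hy', hw'⟩
    · rw [word_zero] at hl
      simp at hl
    · rw [word_add_one] at h'
      rcases GapLE.of_append_zero (s' := []) hbne hb0 h' with h' | ⟨h', -⟩
      · rw [← hw] at h'
        exact (ih' η' (lt_add_one η') _ hζ h').trans (lt_add_one η').le
      · generalize word γ f (ω ^ ω ^ a) = s at h' hbne
        cases h'
        exact absurd rfl hbne
    · have h1 := ihlt _ ha ha1 (by omega)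
      have h2 := ihlt _ hy hy1 (by omega)
      obtain ⟨e, x, v, hex, -⟩ := hb'
      rw [hay]
      rw [hex] at h1 h2 ⊢
      exact (mul_lt_psi h1 h2).le
    · rw [hw'] at h'
      rcases GapLE.of_append_zero hbne hb0 h' with h' | ⟨h', h''⟩
      · rw [← hw] at h'
        exact (ih' _ hy' _ hζ h').trans hy'.le
      · rcases (ih' _ ha' _ hκ h').lt_or_eq with hlt | heq
        -- A smaller multiplicatively closed factor is absorbed by the larger one, so `ζ'` is
        -- unchanged under multiplication by it, and `y ≤ ζ'` suffices.
        · rw [hay, hay', ← mul_omega0_opow_opow (opow_pos _ omega0_pos) hlt, mul_assoc, ← hay']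
          exact mul_le_mul_right (ih _ hy hy1) _
        · rw [hay, hay', heq]
          exact mul_le_mul_right (ih' _ hy' _ (hy.trans hζ) (h'' (by rw [heq])).of_cons_cons) _

end Word

/-! ### The lower bound for sequences -/

/-- The ordinal `θ` quasi-embeds into the sequences over `α` with symmetric gap condition. -/
def Attains (α θ : Ordinal.{u}) : Prop :=
  ∃ f : Ordinal.{u} → List Ordinal.{u}, (∀ x < θ, f x ∈ listsOf (Set.Iio α)) ∧
    ∀ x < θ, ∀ y < θ, GapLE symGap (f x) (f y) → x ≤ y

theorem attains_one (α : Ordinal.{u}) : Attains α 1 := by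
  refine ⟨fun _ => [], fun _ _ x hx => absurd hx (by simp), fun x hx y _ _ => ?_⟩
  rw [lt_one_iff.1 hx]
  exact zero_le

/-- The index `0` is given up so that all sequences used are nonempty: the empty one embeds
everywhere, and a shift leaves no trace on it. The `1 + x` inside `word` has the same purpose. -/
theorem attains_psi {γ δ θ : Ordinal.{u}} (h : Attains δ (1 + θ)) :
    Attains (ω ^ γ + δ) (psi γ θ) := by
  obtain ⟨f, hf, hq⟩ := h
  have hlt : ∀ x < θ, 1 + x < 1 + θ := fun x hx => (add_lt_add_iff_left 1).2 hx
  refine ⟨word γ fun x => f (1 + x), fun ζ hζ => word_mem (fun x hx => hf _ (hlt x hx)) hζ,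
    fun ζ hζ ζ' hζ' => le_of_word_le (fun x hx h0 => ?_) (fun x hx y hy h => ?_) hζ hζ'⟩
  · have h1 := hq _ (hlt x hx) 0 (zero_lt_one.trans_le le_self_add) (h0 ▸ .nil)
    simp at h1
  · exact (add_le_add_iff_left 1).1 (hq _ (hlt x hx) _ (hlt y hy) h)

/-- Members from `ω ^ γ` on cannot cross zeros, and shifts by `ω ^ e` with `e < γ` can be cancelled,
so such a sequence ends up inside one of the given sequences. -/
theorem exists_gapLE_of_gapLE_word {γ θ ζ : Ordinal.{u}} {f : Ordinal.{u} → List Ordinal.{u}}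
    {s : List Ordinal.{u}} (hne : s ≠ []) (hs : ∀ x ∈ s, ω ^ γ ≤ x) (hζ : ζ < psi γ θ)
    (h : GapLE symGap s (word γ f ζ)) : ∃ x < θ, GapLE symGap s ((f x).map (ω ^ γ + ·)) := by
  have hpos : ∀ x ∈ s, 0 < x := fun x hx => (opow_pos _ omega0_pos).trans_le (hs x hx)
  have hnil : ¬ GapLE symGap s [] := fun h => by cases h; exact hne rfl
  induction ζ using WellFoundedLT.induction with
  | ind ζ ih =>
  rcases word_cases (f := f) hζ with rfl | ⟨η, rfl⟩ | ⟨e, x, v, -, hw, hv⟩ | ⟨a, y, -, ha, hy, hw⟩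
  · rw [word_zero] at h
    exact absurd h hnil
  · rw [word_add_one, ← List.append_nil s] at h
    rcases GapLE.of_append_zero (s' := []) hne hpos h with h' | ⟨h', -⟩
    · rw [List.append_nil] at h'
      exact ih η (lt_add_one η) ((lt_add_one η).trans hζ) h'
    · exact absurd h' hnil
  · rw [hw] at h
    rcases hv with ⟨rfl, hx, rfl⟩ | ⟨he, hx, rfl⟩
    · exact ⟨x, hx, h⟩
    · rw [← map_add_eq_self he hs, gapLE_map_add] at h
      exact ih _ hx (hx.trans hζ) h
  · rw [hw, ← List.append_nil s] at h
    rcases GapLE.of_append_zero hne hpos h with h' | ⟨h', -⟩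
    · rw [List.append_nil] at h'
      exact ih _ hy (hy.trans hζ) h'
    · exact ih _ ha (ha.trans hζ) h'

/-- The case of an ordinal with `γ = φ_γ(0)`. -/
theorem attains_veblen_one {γ : Ordinal.{u}} (hγ : veblen γ 0 = γ) : Attains γ (veblen γ 1) := by
  classical
  have hγ0 : γ ≠ 0 := by
    rintro rfl
    rw [veblen_zero_apply, opow_zero] at hγ
    exact one_ne_zero hγ
  have hlim : IsSuccLimit γ := by
    rw [← hγ]
    exact isSuccLimit_veblen hγ0 0
  have hopow : ∀ c < γ, ω ^ c < γ := fun c hc => by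
    rw [← hγ] at hc ⊢
    exact opow_lt_veblen hγ0 hc
  have hγω : ω ^ γ = γ := by
    have := opow_veblen hγ0 0
    rwa [hγ] at this
  have hone : 1 + (γ + 1) = γ + 1 := by
    rw [← add_assoc, one_add_of_omega0_le (omega0_le_of_isSuccLimit hlim)]
  -- Singletons realize the indices below `γ`. The extra index is realized by a pair, which is too
  -- long to embed into a singleton and has the least labels, so that no larger pair embeds into it.
  let f : Ordinal.{u} → List Ordinal.{u} := fun x => if 1 + x < γ then [1 + x] else [0, 0]
  have hlt : ∀ x < γ + 1, 1 + x < γ + 1 := fun x hx => by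
    rw [← hone]
    exact (add_lt_add_iff_left 1).2 hx
  have hne : ∀ x < γ + 1, f x ≠ [] := fun x _ => by
    simp only [f]
    split_ifs <;> simp
  have hmem : ∀ x < γ + 1, ∀ y ∈ f x, y < γ := fun x _ y hy => by
    simp only [f] at hy
    split_ifs at hy with h
    · exact (List.mem_singleton.1 hy) ▸ h
    · have : y = 0 := by simpa using hy
      exact this ▸ pos_iff_ne_zero.2 hγ0
  have hq : ∀ x < γ + 1, ∀ y < γ + 1, GapLE symGap (f x) (f y) → x ≤ y := fun x hx y hy h => by
    refine (add_le_add_iff_left 1).1 ?_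
    simp only [f] at h
    split_ifs at h with h1 h2 h2
    · rcases h with _ | ⟨h, -⟩ | h
      · exact h
      · cases h
    · exact h1.le.trans (not_lt.1 h2)
    · exact absurd h.length_le (by simp)
    · exact (Order.lt_add_one_iff.1 (hlt x hx)).trans (not_lt.1 h2)
  -- The level of `ζ` is the least `c` at which `word c f` covers `ζ`; ordinals of smaller level are
  -- smaller.
  let c : Ordinal.{u} → Ordinal.{u} := fun ζ => sInf {c | ζ < psi c (γ + 1)}
  have hc : ∀ ζ < veblen γ 1, c ζ < γ ∧ ζ < psi (c ζ) (γ + 1) := fun ζ hζ => by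
    obtain ⟨e, he, h⟩ := exists_lt_veblen_add_one hγ hζ
    have h' := h.trans_le (veblen_le_psi _ _)
    exact ⟨(csInf_le' (s := {c | ζ < psi c (γ + 1)}) h').trans_lt he, csInf_mem (s := {c | ζ < psi c (γ + 1)}) ⟨e, h'⟩⟩
  -- The prefix `[d ζ, d ζ]` encodes the level. The `+ 1` puts `d ζ` above the shifted pair `[0, 0]`
  -- for every level up to `c ζ`, so the prefix can only be sent to a prefix.
  let d : Ordinal.{u} → Ordinal.{u} := fun ζ => ω ^ c ζ + 1
  have hdpos : ∀ ζ, ∀ x ∈ [d ζ, d ζ], 0 < x := fun ζ x hx => by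
    have : x = d ζ := by simpa using hx
    rw [this]
    simp [d]
  refine ⟨fun ζ => [d ζ, d ζ] ++ 0 :: word (c ζ) f ζ, fun ζ hζ x hx => ?_,
    fun ζ hζ ζ' hζ' h => ?_⟩
  · obtain ⟨h1, h2⟩ := hc ζ hζ
    rcases List.mem_append.1 hx with hx | hx
    · have : x = d ζ := by simpa using hx
      rw [this]
      exact hlim.add_one_lt (hopow _ h1)
    · rcases List.mem_cons.1 hx with rfl | hx
      · exact pos_iff_ne_zero.2 hγ0
      · have := word_mem hmem h2 x hx
        rwa [add_of_omega0_opow_le ((opow_lt_opow_iff_right one_lt_omega0).2 h1) hγω.le] at this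
  · obtain ⟨-, h2⟩ := hc ζ hζ
    obtain ⟨-, h2'⟩ := hc ζ' hζ'
    rcases lt_or_ge (c ζ) (c ζ') with hcc | hcc
    · exact h2.le.trans (not_lt.1 fun h => 
        (csInf_le' (s := {c | ζ' < psi c (γ + 1)}) h).not_gt hcc)
    · rcases GapLE.of_append_zero (by simp) (hdpos ζ) h with h | ⟨h, h'⟩
      · exfalso
        have hd : ω ^ c ζ' < d ζ := Order.lt_add_one_iff.2 (opow_le_opow_right omega0_pos hcc)
        obtain ⟨x, hx, h3⟩ := exists_gapLE_of_gapLE_word (by simp) (fun x hx => by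
          have : x = d ζ := by simpa using hx
          exact this ▸ hd.le) h2' h.append_left_of
        simp only [f] at h3
        split_ifs at h3 with h4
        · exact absurd h3.length_le (by simp)
        · have := h3.forall₂ (by simp)
          simp only [List.map_cons, List.map_nil, add_zero, List.forall₂_cons] at this
          exact this.1.not_gt hd
      · have h3 : c ζ ≤ c ζ' := by
          have := h.forall₂ (by simp)
          simp only [d, List.forall₂_cons] at this
          exact (opow_le_opow_iff_right one_lt_omega0).1 
            (Order.lt_add_one_iff.1 ((lt_add_one _).trans_le this.1))
        have heq := le_antisymm h3 hcc
        have h4 := (h' rfl).of_cons_cons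
        rw [← heq] at h4
        exact le_of_word_le hne hq h2 (heq ▸ h2') h4

theorem one_add_G {α : Ordinal.{u}} (h : α ≠ 0) : 1 + G α = G α :=
  one_add_of_omega0_le (omega0_le_of_isSuccLimit (isSuccLimit_G h))

/-- All of `G α` is realized by one map, not just every smaller ordinal: `exists_strongLE_H` needs a
sequence for each digit below `G α`. -/
theorem attains_G (α : Ordinal.{u}) : Attains α (G α) := by
  induction α using WellFoundedLT.induction with
  | ind α ih =>
    have hbase : Attains (0 : Ordinal.{u}) (1 + 0) := by
      rw [add_zero]
      exact attains_one 0
    rcases lt_or_ge α ω with hω | hω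
    · obtain ⟨n, rfl⟩ := lt_omega0.1 hω
      match n with
      | 0 =>
        rw [Nat.cast_zero, G_zero]
        exact attains_one 0
      | 1 =>
        have := attains_psi (γ := 0) hbase
        rw [psi_zero, opow_zero, opow_one, add_zero] at this
        rwa [Nat.cast_one, G_one]
      | n + 2 =>
        have h1 := ih ((n + 1 : ℕ) : Ordinal.{u}) (by exact_mod_cast (by omega : n + 1 < n + 2))
        rw [← one_add_G (by exact_mod_cast (by omega : n + 1 ≠ 0))] at h1
        have h2 := attains_psi (γ := 0) h1
        rwa [psi_zero, opow_zero, ← G_natCast_add_two, ← Nat.cast_one, ← Nat.cast_add,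
          show 1 + (n + 1) = n + 2 by omega] at h2
    · have h0 : α ≠ 0 := (omega0_pos.trans_le hω).ne'
      have hγ := cnfExp_ne_zero hω
      have hadd := omega0_opow_cnfExp_add h0
      by_cases hδ : cnfRest α = 0
      · rw [hδ, add_zero] at hadd
        by_cases h : cnfExp α < veblen (cnfExp α) 0
        · have := attains_psi (γ := cnfExp α) hbase
          rwa [add_zero, psi_of_ne_zero hγ, ← G_of_lt hω hδ h, hadd] at this
        · have heq := le_antisymm (not_lt.1 h) (left_le_veblen (cnfExp α) 0)
          rw [G_of_not hω fun h' => h h'.2, hδ, G_zero]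
          have h1 := attains_veblen_one heq
          have h2 := opow_veblen hγ 0
          rw [heq] at h2
          rw [h2] at hadd
          nth_rewrite 1 [← hadd]
          exact h1
      · have h1 := ih _ (cnfRest_lt h0)
        rw [← one_add_G hδ] at h1
        have h2 := attains_psi (γ := cnfExp α) h1
        rwa [psi_of_ne_zero hγ, ← G_of_not hω fun h => hδ h.1, hadd] at h2

/-! ### The lower bound for sequences with the strong gap condition -/

/-- The head of `r'` is below every member of `s`, so it is neither an image of one nor may it be
skipped before one. Hence `s` embeds into `s'`. -/
theorem ChainLE.of_append {a c : Ordinal.{u}} {s r s' r' : List Ordinal.{u}}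
    (hs : ∀ x ∈ s, c ≤ x) (hr : ∀ x, r'.head? = some x → x < c)
    (h : ChainLE rightGap a (s ++ r) (s' ++ r')) :
    ChainLE rightGap a s s' ∧ (s.length = s'.length → ChainLE rightGap a r r') := by
  induction s' generalizing s a with
  | nil =>
    cases s with
    | nil => exact ⟨.nil, fun _ => h⟩
    | cons x s =>
      cases r' with
      | nil => cases h
      | cons y r' =>
        have hxy : y < x := (hr y rfl).trans_le (hs x (by simp))
        rcases h with _ | ⟨h, -⟩ | ⟨h, -⟩ <;> exact absurd h hxy.not_ge
  | cons d s' ih =>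
    cases s with
    | nil => exact ⟨.nil, fun h => absurd h (by simp)⟩
    | cons x s =>
      rcases h with _ | ⟨h, h'⟩ | ⟨h, h'⟩
      · obtain ⟨h1, h2⟩ := ih (fun y hy => hs y (by simp [hy])) h'
        exact ⟨.cons h h1, fun hl => (h2 (by simpa using hl)).congr_left⟩
      · obtain ⟨h1, -⟩ := ih (s := x :: s) hs h'
        refine ⟨.skip h h1, fun hl => ?_⟩
        have := h1.length_le
        simp only [List.length_cons] at this hl
        omega

open Classical in
/-- Sequences that realize the ordinals in base `b`, given sequences for the digits. -/
noncomputable def baseWord (b : Ordinal.{u}) (g : Ordinal.{u} → List Ordinal.{u})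
    (x : Ordinal.{u}) : List Ordinal.{u} :=
  if h : x = 0 then []
  else (log b x :: (g (x / b ^ log b x)).map (log b x + ·)) ++ baseWord b g (x % b ^ log b x)
termination_by x
decreasing_by exact mod_opow_log_lt_self b h

section BaseWord

variable {b : Ordinal.{u}} {g : Ordinal.{u} → List Ordinal.{u}}

theorem baseWord_zero : baseWord b g 0 = [] := by rw [baseWord, dif_pos rfl]

theorem baseWord_of_ne_zero {x : Ordinal.{u}} (h : x ≠ 0) : baseWord b g x =
    (log b x :: (g (x / b ^ log b x)).map (log b x + ·)) ++ baseWord b g (x % b ^ log b x) := by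
  rw [baseWord, dif_neg h]

theorem head?_baseWord {x c : Ordinal.{u}} (hb : 1 < b) (hx : x < b ^ c) :
    ∀ y, (baseWord b g x).head? = some y → y < c := by
  intro y hy
  rcases eq_or_ne x 0 with rfl | h
  · simp [baseWord_zero] at hy
  · rw [baseWord_of_ne_zero h] at hy
    have : log b x = y := by simpa using hy
    exact this ▸ (lt_opow_iff_log_lt hb h).1 hx

theorem baseWord_mem {x γ δ : Ordinal.{u}} (hb : 1 < b)
    (hg : ∀ y < b, ∀ z ∈ g y, z < ω ^ γ + δ) (hx : x < b ^ ω ^ γ) :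
    baseWord b g x ∈ listsOf (Set.Iio (ω ^ γ + δ)) := by
  induction x using WellFoundedLT.induction with
  | ind x ih =>
    rcases eq_or_ne x 0 with rfl | h
    · rw [baseWord_zero]
      exact fun x hx => absurd hx (by simp)
    · have hlog : log b x < ω ^ γ := (lt_opow_iff_log_lt hb h).1 hx
      have hmod := mod_opow_log_lt_self b h
      rw [baseWord_of_ne_zero h]
      intro z hz
      rcases List.mem_append.1 hz with hz | hz
      · rcases List.mem_cons.1 hz with rfl | hz
        · exact hlog.trans_le le_self_add
        · obtain ⟨y, hy, rfl⟩ := List.mem_map.1 hz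
          change _ + y < _
          rw [← add_of_omega0_opow_le hlog (le_self_add : ω ^ γ ≤ ω ^ γ + δ)]
          exact add_lt_add_right (hg _ (div_opow_log_lt x hb) y hy) _
      · exact ih _ hmod (hmod.trans hx) z hz

/-- If `y < x`, comparing first members forces equal leading exponents. The members from this
exponent on then encode the leading digits, and equal digits have words of equal length, which
leaves an embedding of the remainders. -/
theorem le_of_baseWord_le (hb : 1 < b) (hg : ∀ x < b, ∀ y < b, WeakLE (g x) (g y) → x ≤ y)
    {x y a : Ordinal.{u}} (h : ChainLE rightGap a (baseWord b g x) (baseWord b g y)) : x ≤ y := by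
  induction x using WellFoundedLT.induction generalizing y a with
  | ind x ih =>
    rcases eq_or_ne x 0 with rfl | hx
    · exact zero_le
    rcases eq_or_ne y 0 with rfl | hy
    · rw [baseWord_zero, baseWord_of_ne_zero hx] at h
      cases h
    by_contra! hlt
    have hx' := baseWord_of_ne_zero (b := b) (g := g) hx
    have hy' := baseWord_of_ne_zero (b := b) (g := g) hy
    have hlog : log b x = log b y := by
      refine le_antisymm ?_ (log_mono_right b hlt.le)
      rw [hx', hy', List.cons_append, List.cons_append] at h
      rcases h with _ | ⟨h, -⟩ | ⟨h, -⟩ <;> exact h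
    rw [← hlog] at hy'
    rw [hx', hy'] at h
    have hpos : b ^ log b x ≠ 0 := (opow_pos _ (zero_lt_one.trans hb)).ne'
    obtain ⟨h1, h2⟩ := h.of_append (c := log b x) (fun z hz => by
      rcases List.mem_cons.1 hz with rfl | hz
      · exact le_rfl
      · obtain ⟨w, -, rfl⟩ := List.mem_map.1 hz
        exact le_self_add) (head?_baseWord hb (mod_lt _ hpos))
    have h3 := h1.gapLE.of_cons_cons
    rw [← weakLE_iff, weakLE_map fun _ _ => add_le_add_iff_left _] at h3
    have h4 := hg _ (div_opow_log_lt x hb) _ (hlog ▸ div_opow_log_lt y hb) h3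
    rw [← div_add_mod x (b ^ log b x), ← div_add_mod y (b ^ log b x)] at hlt
    rcases h4.lt_or_eq with h4 | h4
    · refine hlt.not_ge (le_trans ?_ le_self_add)
      refine (add_le_add_right (mod_lt x hpos).le _).trans ?_
      rw [← mul_add_one]
      exact mul_le_mul_right (Order.add_one_le_of_lt h4) _
    · rw [h4] at hlt h2
      exact hlt.not_ge (add_le_add_right (ih _ (mod_opow_log_lt_self b hx) (h2 rfl)) _)

end BaseWord

theorem one_lt_G {α : Ordinal.{u}} (h : α ≠ 0) : 1 < G α :=
  one_lt_omega0.trans_le (omega0_le_of_isSuccLimit (isSuccLimit_G h))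

/-- Division by `p` yields a quotient below `H (cnfRest α)`, encoded first by members from `ω ^
cnfExp α` on, and a remainder that is written in base `G α` and starts below this threshold. The
strong gap condition compares quotients before remainders. -/
theorem exists_strongLE_H (α : Ordinal.{u}) : ∃ f : Ordinal.{u} → List Ordinal.{u},
    (∀ x < H α, f x ∈ listsOf (Set.Iio α)) ∧
      ∀ x < H α, ∀ y < H α, StrongLE (f x) (f y) → x ≤ y := by
  induction α using WellFoundedLT.induction with
  | ind α ih =>
    rcases eq_or_ne α 0 with rfl | h0
    · refine ⟨fun _ => [], fun _ _ x hx => absurd hx (by simp), fun x hx y _ _ => ?_⟩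
      rw [H_zero, lt_one_iff] at hx
      rw [hx]
      exact zero_le
    · obtain ⟨h, hmem, hq⟩ := ih _ (cnfRest_lt h0)
      obtain ⟨g, hgmem, hgq⟩ := attains_G α
      have hadd := omega0_opow_cnfExp_add h0
      have hG := one_lt_G h0
      rw [H_of_ne_zero h0]
      set p := G α ^ ω ^ cnfExp α with hp
      have hp0 : p ≠ 0 := (opow_pos _ (zero_lt_one.trans hG)).ne'
      have hdiv : ∀ x < p * H (cnfRest α), x / p < H (cnfRest α) := fun x hx =>
        (lt_mul_iff_div_lt hp0).1 hx
      refine ⟨fun x => (h (x / p)).map (ω ^ cnfExp α + ·) ++ baseWord (G α) g (x % p),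
        fun x hx y hy => ?_, fun x hx y hy hxy => ?_⟩
      · change y < α
        rw [← hadd]
        rcases List.mem_append.1 hy with hy | hy
        · obtain ⟨z, hz, rfl⟩ := List.mem_map.1 hy
          exact add_lt_add_right (hmem _ (hdiv x hx) z hz) _
        · refine baseWord_mem hG (fun z hz w hw => ?_) (mod_lt x hp0) y hy
          rw [hadd]
          exact hgmem z hz w hw
      · obtain ⟨h1, h2⟩ := ((strongLE_iff 0).1 hxy).of_append (c := ω ^ cnfExp α) (fun z hz => by
          obtain ⟨w, -, rfl⟩ := List.mem_map.1 hz
          exact le_self_add) (head?_baseWord hG (mod_lt y hp0))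
        rw [← strongLE_iff, strongLE_map fun _ _ => add_le_add_iff_left _] at h1
        have h3 := hq _ (hdiv x hx) _ (hdiv y hy) h1
        rw [← div_add_mod x p, ← div_add_mod y p]
        rcases h3.lt_or_eq with h3 | h3
        · refine le_trans ?_ le_self_add
          refine (add_le_add_right (mod_lt x hp0).le _).trans ?_
          rw [← mul_add_one]
          exact mul_le_mul_right (Order.add_one_le_of_lt h3) _
        · have h4 := le_of_baseWord_le hG
            (fun x hx y hy h => hgq x hx y hy (gordeevLE_iff.1 h.gordeevLE)) (h2 (by simp [h3]))
          rw [h3]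
          exact add_le_add_right h4 _

/-! ### The lower bound for trees that ascend weakly -/

theorem Emb.mapLabels_add {X : Type v} {r : X → X → Prop} (hr : ∀ x, r x x) (c : Ordinal.{u})
    (s : BinTree Ordinal.{u} X) : Emb r s (GapOrder.mapLabels (c + ·) s) := by
  induction s with
  | leaf x => exact .leaf (hr x)
  | node b s t ih₁ ih₂ => exact .node le_add_self ih₁ ih₂

theorem emb_mapLabels_add {X : Type v} {r : X → X → Prop} {c : Ordinal.{u}}
    {s t : BinTree Ordinal.{u} X} :
    Emb r (mapLabels (c + ·) s) (mapLabels (c + ·) t) ↔ Emb r s t :=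
  ⟨emb_of_mapLabels fun _ _ _ _ => (add_le_add_iff_left c).1,
    Emb.mapLabels fun _ _ h => add_le_add_right h c⟩

theorem mapLabels_add_eq_self {X : Type v} {e c : Ordinal.{u}} (h : e < c)
    {s : BinTree Ordinal.{u} X} (hs : ∀ x ∈ s.innerLabels, ω ^ c ≤ x) :
    mapLabels (ω ^ e + ·) s = s := by
  induction s with
  | leaf x => rfl
  | node b s t ih₁ ih₂ =>
    rw [mapLabels, ih₁ fun x hx => hs x (.inr (.inl hx)), ih₂ fun x hx => hs x (.inr (.inr hx)),
      add_of_omega0_opow_le ((opow_lt_opow_iff_right one_lt_omega0).2 h) (hs b (.inl rfl))]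

theorem mapLabels_add_mem {X : Type v} {c δ : Ordinal.{u}} {s : BinTree Ordinal.{u} X}
    (hs : s ∈ ascTrees δ) : mapLabels (c + ·) s ∈ ascTrees (c + δ) := by
  induction s with
  | leaf x => exact trivial
  | node b s t ih₁ ih₂ =>
    refine ⟨add_lt_add_right hs.1 c, ih₁ hs.2.1, ih₂ hs.2.2.1, ?_, ?_⟩ <;> intro d hd <;>
      rw [innerLabels_mapLabels] at hd <;> obtain ⟨d, hd, rfl⟩ := hd
    · exact add_le_add_right (hs.2.2.2.1 d hd) c
    · exact add_le_add_right (hs.2.2.2.2 d hd) c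

/-- Being an epsilon number, `κ` is fixed by `φ_0`, so only the functions `φ_{1+e}` matter. -/
theorem veblen_one_add_normal_form {κ : Ordinal.{u}} (hκ : ω ^ κ = κ) (γ : Ordinal.{u}) :
    (∃ x, veblen (1 + γ) x = κ) ∨ ∃ e < γ, ∃ x < κ, veblen (1 + e) x = κ := by
  refine exists_normal_form (Ψ := fun e => veblen (1 + e))
    (fun e => veblen_right_strictMono (1 + e)) (fun γ h => ?_) γ
  refine (mem_range_veblen (by simp)).2 fun e he => ?_
  rcases eq_or_ne e 0 with rfl | h0
  · rw [veblen_zero_apply, hκ]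
  · have h1 : 1 + (e - 1) = e := Ordinal.add_sub_cancel_of_le (Order.one_le_iff_ne_zero.2 h0)
    rw [← h1] at he ⊢
    exact h _ ((add_lt_add_iff_left 1).1 he)

open Classical in
/-- Trees that realize the ordinals below `veblen (1 + γ) θ`, given trees `f x` for `x < θ`. -/
noncomputable def tree (γ : Ordinal.{u}) (f : Ordinal.{u} → BinTree Ordinal.{u} PUnit.{v + 1})
    (ζ : Ordinal.{u}) : BinTree Ordinal.{u} PUnit.{v + 1} :=
  if h0 : ζ = 0 then .leaf PUnit.unit
  else if h : ∃ x, veblen (1 + γ) x = ζ then mapLabels (ω ^ γ + ·) (f h.choose)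
  else if h : ∃ e x, 1 + x < ζ ∧ e < γ ∧ veblen (1 + e) x = ζ then
    mapLabels (ω ^ h.choose + ·) (tree γ f (1 + h.choose_spec.choose))
  else if h : log ω ζ < ζ then .node 0 (tree γ f (log ω ζ)) (tree γ f (ζ - ω ^ log ω ζ))
  else .leaf PUnit.unit
termination_by ζ
decreasing_by
  · exact h.choose_spec.choose_spec.1
  · exact h
  · exact (exists_log_rest h0).2

/-- The case of an ordinal `veblen (1 + e) x` in the definition of `tree`. -/
def IsTreeBlock (γ θ : Ordinal.{u}) (f : Ordinal.{u} → BinTree Ordinal.{u} PUnit.{v + 1})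
    (ζ : Ordinal.{u}) : Prop :=
  ∃ e x s, ζ = veblen (1 + e) x ∧ tree γ f ζ = mapLabels (ω ^ e + ·) s ∧
    ((e = γ ∧ x < θ ∧ s = f x) ∨ (e < γ ∧ 1 + x < ζ ∧ s = tree γ f (1 + x)))

/-! ### The trees reflect the order of ordinals. -/

section Tree

variable {γ θ δ ζ : Ordinal.{u}} {f : Ordinal.{u} → BinTree Ordinal.{u} PUnit.{v + 1}}

theorem tree_zero : tree γ f 0 = .leaf PUnit.unit := by rw [tree, dif_pos rfl]

theorem one_add_ne_zero (e : Ordinal.{u}) : 1 + e ≠ 0 := by simp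

theorem tree_cases (h : ζ < veblen (1 + γ) θ) : ζ = 0 ∨ IsTreeBlock γ θ f ζ ∨
    ∃ a b : Ordinal.{u}, ζ = ω ^ a + b ∧ a < ζ ∧ b < ζ ∧
      tree γ f ζ = .node 0 (tree γ f a) (tree γ f b) := by
  by_cases h0 : ζ = 0
  · exact .inl h0
  by_cases htop : ∃ x, veblen (1 + γ) x = ζ
  · refine .inr (.inl ⟨γ, htop.choose, _, htop.choose_spec.symm, ?_, .inl ⟨rfl, ?_, rfl⟩⟩)
    · rw [tree, dif_neg h0, dif_pos htop]
    · rw [← veblen_lt_veblen_iff_right (o := 1 + γ), htop.choose_spec]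
      exact h
  by_cases hlow : ∃ e x, 1 + x < ζ ∧ e < γ ∧ veblen (1 + e) x = ζ
  · have hsp := hlow.choose_spec.choose_spec
    refine .inr (.inl ⟨hlow.choose, hlow.choose_spec.choose, _, hsp.2.2.symm, ?_,
      .inr ⟨hsp.2.1, hsp.1, rfl⟩⟩)
    rw [tree, dif_neg h0, dif_neg htop, dif_pos hlow]
  · have hlog : log ω ζ < ζ := by
      refine (log_le_self ω ζ).lt_of_ne fun heq => ?_
      have hε : ω ^ ζ = ζ := by
        refine le_antisymm ?_ (right_le_opow ζ one_lt_omega0)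
        have := opow_log_le_self ω h0
        rwa [heq] at this
      obtain ⟨e, he, x, hx, hex⟩ := (veblen_one_add_normal_form hε γ).resolve_left htop
      refine hlow ⟨e, x, ?_, he, hex⟩
      rw [← hex] at hx ⊢
      exact add_lt_veblen (one_lt_omega0.trans (omega0_lt_veblen (one_add_ne_zero e) x)) hx
    obtain ⟨h1, h2⟩ := exists_log_rest h0
    refine .inr (.inr ⟨_, _, h1.symm, hlog, h2, ?_⟩)
    rw [tree, dif_neg h0, dif_neg htop, dif_neg hlow, dif_pos hlog]

theorem exists_tree_eq_node (hne : ∀ x < θ, ∃ b s t, f x = .node b s t)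
    (h : ζ < veblen (1 + γ) θ) (h0 : ζ ≠ 0) : ∃ b s t, tree γ f ζ = .node b s t := by
  induction ζ using WellFoundedLT.induction with
  | ind ζ ih =>
    rcases tree_cases (f := f) h with rfl | ⟨e, x, s, -, hw, hv⟩ | ⟨a, b, -, -, -, hw⟩
    · exact absurd rfl h0
    · have hs : ∃ b s₁ s₂, s = .node b s₁ s₂ := by
        rcases hv with ⟨-, hx, rfl⟩ | ⟨-, hx, rfl⟩
        · exact hne x hx
        · exact ih _ hx (hx.trans h) (one_add_ne_zero x)
      obtain ⟨b, s₁, s₂, rfl⟩ := hs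
      exact ⟨_, _, _, hw⟩
    · exact ⟨_, _, _, hw⟩

theorem tree_mem (hf : ∀ x < θ, f x ∈ ascTrees δ) (h : ζ < veblen (1 + γ) θ) :
    tree γ f ζ ∈ ascTrees (ω ^ γ + δ) := by
  induction ζ using WellFoundedLT.induction with
  | ind ζ ih =>
    rcases tree_cases (f := f) h with rfl | ⟨e, x, s, -, hw, hv⟩ | ⟨a, b, -, ha, hb, hw⟩
    · rw [tree_zero]
      exact trivial
    · rw [hw]
      rcases hv with ⟨rfl, hx, rfl⟩ | ⟨he, hx, rfl⟩
      · exact mapLabels_add_mem (hf x hx)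
      · have h1 := mapLabels_add_mem (c := ω ^ e) (ih _ hx (hx.trans h))
        rwa [add_of_omega0_opow_le ((opow_lt_opow_iff_right one_lt_omega0).2 he)
          (le_self_add : ω ^ γ ≤ ω ^ γ + δ)] at h1
    · rw [hw]
      exact ⟨(opow_pos _ omega0_pos).trans_le le_self_add, ih a ha (ha.trans h),
        ih b hb (hb.trans h), fun _ _ => zero_le, fun _ _ => zero_le⟩

theorem IsTreeBlock.pos (hb : IsTreeBlock γ θ f ζ) : ∀ x ∈ (tree γ f ζ).innerLabels, 0 < x := by
  obtain ⟨e, x, s, -, hw, -⟩ := hb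
  rw [hw, innerLabels_mapLabels]
  rintro _ ⟨y, -, rfl⟩
  exact (opow_pos _ omega0_pos).trans_le le_self_add

theorem le_of_isTreeBlock {ζ' : Ordinal.{u}} (hb : IsTreeBlock γ θ f ζ)
    (hb' : IsTreeBlock γ θ f ζ')
    (hf : ∀ x < θ, ∀ y < θ, Emb (fun _ _ => True) (f x) (f y) → x ≤ y)
    (ih' : ∀ η' < ζ', ∀ η < veblen (1 + γ) θ,
      Emb (fun _ _ => True) (tree γ f η) (tree γ f η') → η ≤ η')
    (ih : ∀ η < ζ, Emb (fun _ _ => True) (tree γ f η) (tree γ f ζ') → η ≤ ζ')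
    (hζ : ζ < veblen (1 + γ) θ) (h : Emb (fun _ _ => True) (tree γ f ζ) (tree γ f ζ')) :
    ζ ≤ ζ' := by
  obtain ⟨e, x, v, hex, hw, hv⟩ := hb
  obtain ⟨e', x', v', hex', hw', hv'⟩ := hb'
  rcases lt_trichotomy e e' with hee | rfl | hee
  · have hx : 1 + x < ζ ∧ v = tree γ f (1 + x) := by
      rcases hv with ⟨rfl, -⟩ | ⟨-, hx⟩
      · rcases hv' with ⟨rfl, -⟩ | ⟨h, -⟩
        · exact absurd hee (lt_irrefl _)
        · exact absurd (hee.trans h) (lt_irrefl _)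
      · exact hx
    have h1 : Emb (fun _ _ => True) (tree γ f (1 + x)) (tree γ f ζ) := by
      rw [hw, ← hx.2]
      exact Emb.mapLabels_add (r := fun _ _ => True) (fun _ => trivial) _ v
    have h2 := ih _ hx.1 (h1.trans h)
    have hee' : 1 + e < 1 + e' := (add_lt_add_iff_left 1).2 hee
    rcases h2.lt_or_eq with h2 | h2
    · rw [hex, hex', ← veblen_veblen_of_lt hee']
      refine veblen_le_veblen_iff_right.2 ?_
      rw [← hex']
      exact le_add_self.trans h2.le
    · refine absurd hx.1 ?_
      rw [h2, hex, hex', not_lt, ← veblen_veblen_of_lt hee' x', ← hex']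
      exact veblen_le_veblen_iff_right.2 (h2 ▸ le_add_self)
  · rw [hw, hw', emb_mapLabels_add] at h
    rw [hex, hex']
    refine veblen_le_veblen_iff_right.2 ?_
    rcases hv with ⟨rfl, hx, rfl⟩ | ⟨he, hx, rfl⟩
    · rcases hv' with ⟨-, hx', rfl⟩ | ⟨h, -⟩
      · exact hf _ hx _ hx' h
      · exact absurd h (lt_irrefl _)
    · rcases hv' with ⟨rfl, -⟩ | ⟨-, hx', rfl⟩
      · exact absurd he (lt_irrefl _)
      · exact (add_le_add_iff_left 1).1 (ih' _ hx' _ (hx.trans hζ) h)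
  · have hx : 1 + x' < ζ' ∧ v' = tree γ f (1 + x') := by
      rcases hv' with ⟨rfl, -⟩ | ⟨-, hx⟩
      · rcases hv with ⟨rfl, -⟩ | ⟨h, -⟩
        · exact absurd hee (lt_irrefl _)
        · exact absurd (hee.trans h) (lt_irrefl _)
      · exact hx
    have h1 : mapLabels (ω ^ e' + ·) (tree γ f ζ) = tree γ f ζ := by
      refine mapLabels_add_eq_self hee fun z hz => ?_
      rw [hw, innerLabels_mapLabels] at hz
      obtain ⟨y, -, rfl⟩ := hz
      exact le_self_add
    rw [hw', hx.2, ← h1, emb_mapLabels_add] at h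
    exact (ih' _ hx.1 _ hζ h).trans hx.1.le

/-- Blocks have positive labels and cannot match a root `0`, so they embed into one of the two
subtrees. Two roots `0` compare `ω ^ a + b` componentwise, and blocks as targets are closed under
`a, b ↦ ω ^ a + b`. -/
theorem le_of_tree_le (hne : ∀ x < θ, ∃ b s t, f x = .node b s t)
    (hf : ∀ x < θ, ∀ y < θ, Emb (fun _ _ => True) (f x) (f y) → x ≤ y) {ζ' : Ordinal.{u}}
    (hζ : ζ < veblen (1 + γ) θ) (hζ' : ζ' < veblen (1 + γ) θ)
    (h : Emb (fun _ _ => True) (tree γ f ζ) (tree γ f ζ')) : ζ ≤ ζ' := by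
  induction ζ' using WellFoundedLT.induction generalizing ζ with
  | ind ζ' ih' =>
  replace ih' := fun η' (h : η' < ζ') η hη => ih' η' h (ζ := η) hη (h.trans hζ')
  induction ζ using WellFoundedLT.induction with
  | ind ζ ih =>
  replace ih := fun η (h : η < ζ) => ih η h (h.trans hζ)
  rcases eq_or_ne ζ 0 with rfl | h0
  · exact zero_le
  obtain ⟨c, s, t, hst⟩ := exists_tree_eq_node hne hζ h0
  rcases tree_cases (f := f) hζ' with rfl | hb' | ⟨a', b', hab', ha', hb', hw'⟩
  · rw [tree_zero, hst] at h
    cases h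
  · rcases tree_cases (f := f) hζ with rfl | hb | ⟨a, b, hab, ha, hb, hw⟩
    · exact zero_le
    · exact le_of_isTreeBlock hb hb' hf ih' ih hζ h
    · have hlen := h.length_inorder_le
      rw [hw] at h hlen
      simp only [inorder, List.length_append, List.length_cons] at hlen
      have hrefl := fun x => Emb.refl (fun _ => trivial) (tree γ f x) (r := fun _ _ => True)
      have h1 : a < ζ' := (ih a ha ((Emb.left (hrefl a)).trans h)).lt_of_ne fun he => by
        rw [he] at hlen; omega
      have h2 : b < ζ' := (ih b hb ((Emb.right (hrefl b)).trans h)).lt_of_ne fun he => by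
        rw [he] at hlen; omega
      obtain ⟨e, x, v, hex, -⟩ := hb'
      rw [hab]
      rw [hex] at h1 h2 ⊢
      exact (add_lt_veblen (opow_lt_veblen (one_add_ne_zero e) h1) h2).le
  · rw [hw'] at h
    rcases tree_cases (f := f) hζ with rfl | hb | ⟨a, b, hab, ha, hb, hw⟩
    · exact zero_le
    · have hc : 0 < c := hb.pos c (by rw [hst]; exact .inl rfl)
      rw [hst] at h
      rcases h with _ | h | h | ⟨h, -, -⟩
      · rw [← hst] at h
        exact (ih' _ ha' _ hζ h).trans ha'.le
      · rw [← hst] at h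
        exact (ih' _ hb' _ hζ h).trans hb'.le
      · exact absurd h hc.not_ge
    · rw [hw] at h
      rcases h with _ | h | h | ⟨-, h₁, h₂⟩
      · rw [← hw] at h
        exact (ih' _ ha' _ hζ h).trans ha'.le
      · rw [← hw] at h
        exact (ih' _ hb' _ hζ h).trans hb'.le
      · rw [hab, hab']
        exact add_le_add (opow_le_opow_right omega0_pos (ih' _ ha' _ (ha.trans hζ) h₁))
          (ih' _ hb' _ (hb.trans hζ) h₂)

end Tree

/-- The ordinal `θ` quasi-embeds into the weakly ascending trees over `α`. -/
def TreeAttains (α θ : Ordinal.{u}) : Prop :=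
  ∃ f : Ordinal.{u} → BinTree Ordinal.{u} PUnit.{u + 1}, (∀ x < θ, f x ∈ ascTrees α) ∧
    ∀ x < θ, ∀ y < θ, Emb (fun _ _ => True) (f x) (f y) → x ≤ y

theorem TreeAttains.mono {α θ θ' : Ordinal.{u}} (h : TreeAttains α θ) (hle : θ' ≤ θ) :
    TreeAttains α θ' := by
  obtain ⟨f, hf, hq⟩ := h
  exact ⟨f, fun x hx => hf x (hx.trans_le hle),
    fun x hx y hy => hq x (hx.trans_le hle) y (hy.trans_le hle)⟩

theorem treeAttains_one (α : Ordinal.{u}) : TreeAttains α 1 := by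
  refine ⟨fun _ => .leaf PUnit.unit, fun _ _ => trivial, fun x hx y _ _ => ?_⟩
  rw [lt_one_iff.1 hx]
  exact zero_le

theorem treeAttains_veblen {γ δ θ : Ordinal.{u}} (h : TreeAttains δ (1 + θ)) :
    TreeAttains (ω ^ γ + δ) (veblen (1 + γ) θ) := by
  obtain ⟨f, hf, hq⟩ := h
  have hlt : ∀ x < θ, 1 + x < 1 + θ := fun x hx => (add_lt_add_iff_left 1).2 hx
  refine ⟨tree γ fun x => f (1 + x), fun ζ hζ => tree_mem (fun x hx => hf _ (hlt x hx)) hζ,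
    fun ζ hζ ζ' hζ' => le_of_tree_le (fun x hx => ?_) (fun x hx y hy h => ?_) hζ hζ'⟩
  · cases hx' : f (1 + x) with
    | node b s t => exact ⟨b, s, t, rfl⟩
    | leaf y =>
      have h1 : ∀ s : BinTree Ordinal.{u} PUnit.{u + 1}, Emb (fun _ _ => True) (.leaf y) s := by
        intro s
        induction s with
        | leaf _ => exact .leaf trivial
        | node _ _ _ ih _ => exact .left ih
      have h2 := hq _ (hlt x hx) 0 (zero_lt_one.trans_le le_self_add) (hx' ▸ h1 _)
      simp at h2
  · exact (add_le_add_iff_left 1).1 (hq _ (hlt x hx) _ (hlt y hy) h)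

/-- Single nodes realize the labels below `γ`; a tree with two nodes labelled `0` realizes `γ`,
since it has too many nodes to embed into the former. -/
theorem treeAttains_add_one {γ : Ordinal.{u}} (hγ : γ ≠ 0) : TreeAttains γ (γ + 1) := by
  classical
  have h1 : ∀ (b : Ordinal.{u}) (s : BinTree Ordinal.{u} PUnit.{u + 1}),
      (∀ c ∈ s.innerLabels, b ≤ c) → b < γ → s ∈ ascTrees γ →
        BinTree.node b (.leaf PUnit.unit) s ∈ ascTrees γ :=
    fun b s h hb hs => ⟨hb, trivial, hs, fun c hc => hc.elim, h⟩
  refine ⟨fun x => .node (if x < γ then x else 0) (.leaf PUnit.unit)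
    (if x < γ then .leaf PUnit.unit else .node 0 (.leaf PUnit.unit) (.leaf PUnit.unit)),
    fun x hx => ?_, fun x hx y hy h => ?_⟩
  · by_cases h : x < γ
    · simp only [if_pos h]
      exact h1 _ _ (fun c hc => hc.elim) h trivial
    · simp only [if_neg h]
      have h0 := pos_iff_ne_zero.2 hγ
      exact h1 _ _ (fun _ _ => zero_le) h0 (h1 _ _ (fun _ _ => zero_le) h0 trivial)
  · by_cases hx' : x < γ
    · by_cases hy' : y < γ
      · simp only [if_pos hx', if_pos hy'] at h
        rcases h with _ | h | h | ⟨h, -, -⟩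
        · cases h
        · cases h
        · exact h
      · exact hx'.le.trans (not_lt.1 hy')
    · by_cases hy' : y < γ
      · simp only [if_neg hx', if_pos hy'] at h
        exact absurd h.length_inorder_le (by simp [inorder])
      · exact (Order.lt_add_one_iff.1 hx).trans (not_lt.1 hy')

/-- The level `c` with `β < φ_c(γ + 1)` may depend on `β`, so no label is needed to encode it. -/
theorem treeAttains_of_lt_veblen_one {γ β : Ordinal.{u}} (hγ : veblen γ 0 = γ)
    (hβ : β < veblen γ 1) : TreeAttains γ β := by
  have hγ0 : γ ≠ 0 := by
    rintro rfl
    rw [veblen_zero_apply, opow_zero] at hγ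
    exact one_ne_zero hγ
  have hlim : IsSuccLimit γ := by
    rw [← hγ]
    exact isSuccLimit_veblen hγ0 0
  have hγω : ω ^ γ = γ := by
    have := opow_veblen hγ0 0
    rwa [hγ] at this
  obtain ⟨c, hc, h⟩ := exists_lt_veblen_add_one hγ hβ
  have hone : 1 + (γ + 1) = γ + 1 := by
    rw [← add_assoc, one_add_of_omega0_le (omega0_le_of_isSuccLimit hlim)]
  have h1 := treeAttains_add_one hγ0
  rw [← hone] at h1
  have h2 := treeAttains_veblen (γ := c) h1
  rw [add_of_omega0_opow_le ((opow_lt_opow_iff_right one_lt_omega0).2 hc) hγω.le] at h2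
  exact h2.mono (h.le.trans (veblen_left_monotone _ le_add_self))

theorem isSuccLimit_F {α : Ordinal.{u}} (h : α ≠ 0) : IsSuccLimit (F α) := by
  rw [F_eq_G h]
  exact isSuccLimit_G (mul_ne_zero omega0_ne_zero h)

/-- Since `F α` is a limit and `maxOrderType` a supremum, it is enough to realize every smaller
ordinal. Normality of `φ_{1+γ}` then reduces `β` to some argument below `F (cnfRest α)`. -/
theorem treeAttains_of_lt_F {α β : Ordinal.{u}} (h0 : α ≠ 0) (hβ : β < F α) :
    TreeAttains α β := by
  induction α using WellFoundedLT.induction generalizing β with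
  | ind α ih =>
    have hadd := omega0_opow_cnfExp_add h0
    by_cases hδ : cnfRest α = 0
    · rw [hδ, add_zero] at hadd
      by_cases h : cnfExp α < veblen (cnfExp α) 0
      · have h1 : TreeAttains (0 : Ordinal.{u}) (1 + 0) := by
          rw [add_zero]
          exact treeAttains_one 0
        have h2 := treeAttains_veblen (γ := cnfExp α) h1
        rw [add_zero, hadd] at h2
        rw [F, dif_neg h0, if_pos ⟨hδ, h⟩] at hβ
        exact h2.mono hβ.le
      · have heq := le_antisymm (not_lt.1 h) (left_le_veblen (cnfExp α) 0)
        have hγ0 : cnfExp α ≠ 0 := by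
          intro h'
          rw [h', veblen_zero_apply, opow_zero] at h
          exact h zero_lt_one
        have h2 := opow_veblen hγ0 0
        rw [heq] at h2
        have hω : ω ≤ cnfExp α := by
          rw [← heq]
          exact (omega0_lt_veblen hγ0 0).le
        rw [F, dif_neg h0, if_neg fun h' => h h'.2, hδ, F_zero, one_add_of_omega0_le hω] at hβ
        rw [h2] at hadd
        rw [← hadd]
        exact treeAttains_of_lt_veblen_one heq hβ
    · rw [F, dif_neg h0, if_neg fun h => hδ h.1,
        (isNormal_veblen _).lt_iff_exists_lt (isSuccLimit_F hδ)] at hβ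
      obtain ⟨θ, hθ, hβ⟩ := hβ
      have hθ' : 1 + θ < F (cnfRest α) := by
        have h1 := one_lt_omega0.trans_le (omega0_le_of_isSuccLimit (isSuccLimit_F hδ))
        obtain ⟨g, hg⟩ := exists_G_eq_opow (ω * cnfRest α)
        rw [F_eq_G hδ, hg] at hθ h1 ⊢
        exact add_lt_omega0_opow h1 hθ
      have h1 := treeAttains_veblen (γ := cnfExp α) (ih _ (cnfRest_lt h0) hδ hθ')
      rw [hadd] at h1
      exact h1.mono hβ.le

theorem F_le_maxOrderType (α : Ordinal.{u}) : F α ≤ maxOrderType (BLE α PUnit.{u + 1}) := by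
  rcases eq_or_ne α 0 with rfl | h0
  · obtain ⟨f, hf, hq⟩ := treeAttains_one.{u} 0
    rw [F_zero]
    exact le_maxOrderType_BLE hf hq
  · refine (isSuccLimit_F h0).le_iff_forall_le.2 fun β hβ => ?_
    obtain ⟨f, hf, hq⟩ := treeAttains_of_lt_F h0 hβ
    exact le_maxOrderType_BLE hf hq

end GapOrder

open GapOrder in
/-- For every ordinal `α`, the five structures are well partial orders, with maximal order types
`o(B_{α,1}) = F(α)`, `o(S^g_α) = o(S^w_α) = o(B^l_{α,1}) = G(α)` and `o(S^s_α) = H(α)`. -/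
theorem theorem1p7 (α : Ordinal.{u}) :
    (GapOrder.IsWellPartialOrder (GapOrder.BLE α PUnit.{u + 1}) ∧
      GapOrder.IsWellPartialOrder (GapOrder.SgLE α) ∧
      GapOrder.IsWellPartialOrder (GapOrder.SwLE α) ∧
      GapOrder.IsWellPartialOrder (GapOrder.BlLE α PUnit.{u + 1}) ∧
      GapOrder.IsWellPartialOrder (GapOrder.SsLE α)) ∧
    GapOrder.maxOrderType (GapOrder.BLE α PUnit.{u + 1}) = GapOrder.F α ∧
    GapOrder.maxOrderType (GapOrder.SgLE α) = GapOrder.G α ∧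
    GapOrder.maxOrderType (GapOrder.SwLE α) = GapOrder.G α ∧
    GapOrder.maxOrderType (GapOrder.BlLE α PUnit.{u + 1}) = GapOrder.G α ∧
    GapOrder.maxOrderType (GapOrder.SsLE α) = GapOrder.H α := by
  obtain ⟨g, hg, hgq⟩ := attains_G α
  obtain ⟨h, hh, hhq⟩ := exists_strongLE_H α
  replace hgq := fun a ha b hb hab => hgq a ha b hb (gordeevLE_iff.1 hab)
  refine ⟨⟨⟨isPartialOrder_BLE α, (typeLE_BLE α).wellQuasiOrdered⟩,
    ⟨inferInstanceAs (IsPartialOrder _ GordeevLE), (typeLE_SgLE α).wellQuasiOrdered⟩,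
    ⟨inferInstanceAs (IsPartialOrder _ WeakLE), (typeLE_SwLE α).wellQuasiOrdered⟩,
    ⟨isPartialOrder_BlLE α, (typeLE_BlLE α).wellQuasiOrdered⟩,
    ⟨inferInstanceAs (IsPartialOrder _ StrongLE), (typeLE_SsLE α).wellQuasiOrdered⟩⟩,
    ?_, ?_, ?_, ?_, ?_⟩
  · exact le_antisymm (typeLE_BLE α).maxOrderType_le (F_le_maxOrderType α)
  · exact le_antisymm (typeLE_SgLE α).maxOrderType_le (le_maxOrderType_SgLE hg hgq)
  · exact le_antisymm (typeLE_SwLE α).maxOrderType_le (le_maxOrderType_SwLE hg hgq)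
  · exact le_antisymm (typeLE_BlLE α).maxOrderType_le (le_maxOrderType_BlLE hg hgq)
  · exact le_antisymm (typeLE_SsLE α).maxOrderType_le (le_maxOrderType_SsLE hh hhq)
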